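/- **Setting.** Let $\mathcal G$ be a group-generator scheme which on input $1^\lambda$ outputs in polynomial time $(\mathbb G,p,g)$, where $\mathbb G$ is a group of prime order $p$ with $\log_2 p=\lambda$ (up to rounding), with polynomial-time multiplication and inversion, and $g$ is a generator. Let $\sigma=\sigma(\lambda)\ge 1$ be polynomially bounded and let $\mathsf H:\{0,1\}^*\to\{0,1\}^{\sigma}$ be a random oracle, available to all parties, simulators and distinguishers. "PPT" means non-uniform probabilistic polynomial time. **Protocol DQ$^{\rm MR}$-OT.** The sender $S$ holds $z$ pairs of messages $\boldsymbol m=[(m_{0,0},m_{1,0}),\dots,(m_{0,z-1},m_{1,z-1})]$ in $\{0,1\}^\sigma$, server $P_1$ holds an index $v\in\{0,\dots,z-1\}$, server $P_2$ holds nothing ($\epsilon$), and the receiver $R$ holds $s\in\{0,1\}$. 1. $S$ generates $(\mathbb G,p,g)$, picks a uniform $C\in\mathbb G$ and publishes $pk=(C,p,g)$ with the description of $\mathbb G$. 2. $R$ picks a uniform bit $s_1$, sets $s_2=s_1\oplus s$, picks uniform $r_1,r_2\in\mathbb Z_p$, and sends $(s_1,r_1)$ to $P_1$ and $(s_2,r_2)$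 to $P_2$. 3. $P_2$ sends $(\delta_0,\delta_1)$ to $P_1$, where $\delta_{s_2}=g^{r_2}$ and $\delta_{1-s_2}=C/g^{r_2}$. 4. $P_1$ sends $(\beta_0,\beta_1)$ to $S$, where $\beta_{s_1}=\delta_0\cdot g^{r_1}$ and $\beta_{1-s_1}=\delta_1/g^{r_1}$. 5. $S$ aborts if $C\ne\beta_0\beta_1$. Otherwise, for each $t\in\{0,\dots,z-1\}$ and $i\in\{0,1\}$ it picks a uniform $y_{i,t}\in\mathbb Z_p$ and sets $e_{i,t}=(g^{y_{i,t}},\ \mathsf H(\beta_i^{y_{i,t}})\oplus m_{i,t})$; it sends all pairs $(e_{0,t},e_{1,t})$ to $P_1$. 6. $P_1$ outputs $z$ (the number of pairs received), forwards only $(e_{0,v},e_{1,v})$ to $R$ and discards the rest. 7. $R$ sets $x=r_2+r_1(-1)^{s_2}$, writes $e_{s,v}=(e',e'')$ and outputs $\mathsf H((e')^{x})\oplus e''$. **Theorem.** If the discrete-logarithm (DL) and computational Diffie-Hellman (CDH) assumptions hold for $\mathcal G$, that is, if every PPT algorithm that is given $(\mathbb G,p,g,g^{a})$, respectively $(\mathbb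 G,p,g,g^{a_1},g^{a_2})$, with uniform exponents, outputs $a$, respectively $g^{a_1a_2}$, with at most negligible probability, then in the random-oracle model DQ$^{\rm MR}$-OT securely computes the functionality $(\boldsymbol m,v,\epsilon,s)\mapsto(\epsilon,z,\epsilon,m_{s,v})$ (the inputs and outputs of $S,P_1,P_2,R$ in this order) in the presence of a semi-honest adversary that corrupts one of $S$, $R$, $P_1$, $P_2$. This means: the protocol never aborts and all parties obtain their outputs; and there are PPT simulators such that $$\mathsf{Sim}_S(\boldsymbol m)\stackrel{c}{\equiv}\mathsf{View}_S,\qquad \mathsf{Sim}_{P_1}(v,z)\stackrel{c}{\equiv}\mathsf{View}_{P_1},\qquad \mathsf{Sim}_{P_2}(\epsilon)\stackrel{c}{\equiv}\mathsf{View}_{P_2},\qquad \mathsf{Sim}_R(s,m_{s,v})\stackrel{c}{\equiv}\mathsf{View}_R .$$ Here the view of a party consists of its input, its random coins and the messages it receives, and $\stackrel{c}{\equiv}$ means that for every PPT distinguisher and every polynomial bound on $z$ the distinguishing advantage is at most a negligible function of $\lambda$, uniformly over all inputs $(\boldsymbol m,v,s)$ within that bound. In particular, $R$ learns nothing about $z$: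 its views on any two inputs with the same $s$ and the same requested message, but possibly different $z$, are computationally indistinguishable. And $S$ does not learn $v$: its views on any two inputs with the same $\boldsymbol m$ are computationally indistinguishable. -/

import Mathlib

open MeasureTheory

noncomputable section

/-! ## Probabilistic oracle circuits and non-uniform probabilistic polynomial time -/

/-- The number whose little-endian binary expansion is the given list of bits. -/
def bitsToNat : List Bool → ℕ
  | [] => 0
  | b :: l => b.toNat + 2 * bitsToNat l

/-- The `len` lowest-order bits of `k`, little-endian. -/
def natToBits (len k : ℕ) : List Bool :=
  List.ofFn fun i : Fin len => k.testBit i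

/-- A gate of a circuit. Wires are numbered `0, 1, 2, …`; a gate reads existing wires and appends
one or several new wires at the end. -/
inductive Gate where
  /-- a constant bit -/
  | const (b : Bool)
  /-- the NAND of two wires -/
  | nand (i j : ℕ)
  /-- a uniformly random bit -/
  | coin
  /-- a uniformly random element of `{0, …, k - 1}`, in binary, where `k` is the number held in
  binary by the listed wires (all zeros when `k = 0`) -/
  | sample (ws : List ℕ)
  /-- the answer of the oracle to the bit string held by the listed wires -/
  | oracle (ws : List ℕ)

/-- The bit carried by a wire; wires that do not exist carry `false`. -/
def wire (w : List Bool) (i : ℕ) : Bool := w.getD i false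

/-- The random bits that a gate appends, when the oracle is `O` and the present wires are `w`. -/
def Gate.run (O : List Bool → List Bool) (w : List Bool) : Gate → PMF (List Bool)
  | .const b => PMF.pure [b]
  | .nand i j => PMF.pure [!(wire w i && wire w j)]
  | .coin => (PMF.uniformOfFintype Bool).map fun b => [b]
  | .sample ws =>
      match bitsToNat (ws.map (wire w)) with
      | 0 => PMF.pure (List.replicate ws.length false)
      | k + 1 => (PMF.uniformOfFintype (Fin (k + 1))).map fun a => natToBits ws.length a
  | .oracle ws => PMF.pure (O (ws.map (wire w)))

/-- The size of a gate: one plus its number of input wires. -/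
def Gate.size : Gate → ℕ
  | .const _ => 1
  | .nand _ _ => 3
  | .coin => 1
  | .sample ws => 1 + ws.length
  | .oracle ws => 1 + ws.length

/-- A probabilistic oracle circuit: a list of gates, and the list of its output wires. The first
wires are the input bits. -/
structure Circuit where
  gates : List Gate
  outs : List ℕ

/-- The distribution of all wires after the gates have been run one after the other. -/
def runGates (O : List Bool → List Bool) : List Gate → List Bool → PMF (List Bool)
  | [], w => PMF.pure w
  | gt :: gs, w => (gt.run O w).bind fun new => runGates O gs (w ++ new)

/-- The output distribution of a circuit on input `x`, with oracle `O`. -/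
def Circuit.eval (O : List Bool → List Bool) (c : Circuit) (x : List Bool) : PMF (List Bool) :=
  (runGates O c.gates x).map fun w => c.outs.map (wire w)

/-- The size of a circuit: the sizes of its gates plus the number of its outputs. -/
def Circuit.size (c : Circuit) : ℕ := (c.gates.map Gate.size).sum + c.outs.length

/-- Absence of an oracle: every query has the empty answer. -/
def noOracle : List Bool → List Bool := fun _ => []

/-- A non-uniform probabilistic algorithm: for every security parameter `lam` and every input
length `n`, a circuit that is used on the inputs of length `n`. -/
def Algorithm : Type := ℕ → ℕ → Circuit

/-- The algorithm is polynomial time in the non-uniform sense: the circuit sizes are bounded by a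
polynomial in the security parameter and the input length. -/
def Algorithm.PolyTime (A : Algorithm) : Prop :=
  ∃ P : Polynomial ℕ, ∀ lam n, (A lam n).size ≤ P.eval (lam + n)

/-- The output distribution of the algorithm on security parameter `lam` and input `x`. -/
def Algorithm.run (A : Algorithm) (O : List Bool → List Bool) (lam : ℕ) (x : List Bool) :
    PMF (List Bool) :=
  (A lam x.length).eval O x

/-- A function of the security parameter that is bounded by a polynomial. -/
def PolyBounded (f : ℕ → ℕ) : Prop := ∃ P : Polynomial ℕ, ∀ lam, f lam ≤ P.eval lam

/-- A negligible function of the security parameter. -/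
def Negligible (f : ℕ → ℝ) : Prop :=
  Asymptotics.SuperpolynomialDecay Filter.atTop (fun lam : ℕ => (lam : ℝ)) f

/-! ## Random oracles and computational indistinguishability -/

/-- A string of `k` bits. -/
abbrev Str (k : ℕ) : Type := Fin k → Bool

/-- Bitwise exclusive or. -/
def Str.xor {k : ℕ} (a b : Str k) : Str k := fun i => Bool.xor (a i) (b i)

/-- A hash function from bit strings of arbitrary length to strings of `sig` bits. -/
abbrev Hash (sig : ℕ) : Type := List Bool → Str sig

/-- A hash function as an oracle for circuits. -/
def Hash.oracle {sig : ℕ} (H : Hash sig) : List Bool → List Bool := fun q => List.ofFn (H q)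

/-- The law of a random oracle: its values are independent and uniform. -/
def randomOracle (sig : ℕ) : Measure (Hash sig) :=
  Measure.infinitePi fun _ : List Bool => (PMF.uniformOfFintype (Str sig)).toMeasure

/-- The probability that `D`, with access to the random oracle, outputs `1` on a sample of `X`,
where `X` may depend on the same random oracle. -/
def acceptProb {sig : ℕ} (D : Algorithm) (lam : ℕ) (X : Hash sig → PMF (List Bool)) : ℝ :=
  (∫⁻ H, ((X H).bind fun w => D.run H.oracle lam w) [true] ∂(randomOracle sig)).toReal

/-- Computational indistinguishability, in the random-oracle model, of two ensembles indexed by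
the security parameter and by an index `i` (the parties' inputs) of polynomially bounded size:
the advantage of every non-uniform polynomial-time distinguisher is bounded by a negligible
function that does not depend on `i`. -/
def CompIndist (sig : ℕ → ℕ) {ι : ℕ → Type} (size : ∀ lam, ι lam → ℕ)
    (X Y : ∀ lam, ι lam → Hash (sig lam) → PMF (List Bool)) : Prop :=
  ∀ D : Algorithm, D.PolyTime → ∀ Z : Polynomial ℕ, ∃ μ : ℕ → ℝ, Negligible μ ∧
    ∀ (lam : ℕ) (i : ι lam), size lam i ≤ Z.eval lam →
      |acceptProb D lam (X lam i) - acceptProb D lam (Y lam i)| ≤ μ lam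

/-! ## Group-generator schemes and the DL and CDH assumptions -/

/-- A cyclic group of prime order `p` with a generator `g`, a description of `d` bits, and a binary
encoding of its elements by strings of `e` bits. -/
structure GroupDesc (d e : ℕ) where
  Elt : Type
  [group : CommGroup Elt]
  [fintype : Fintype Elt]
  p : ℕ
  [prime : Fact p.Prime]
  card_eq : Fintype.card Elt = p
  g : Elt
  g_generates : ∀ x : Elt, x ∈ Subgroup.zpowers g
  desc : Str d
  enc : Elt → Str e
  enc_injective : Function.Injective enc

attribute [instance] GroupDesc.group GroupDesc.fintype GroupDesc.prime

namespace GroupDesc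

variable {d e : ℕ} (I : GroupDesc d e)

/-- `g ^ r` for an exponent `r` modulo `p`. -/
def gpow (r : ZMod I.p) : I.Elt := I.g ^ r.val

/-- The bit string that encodes a group element. -/
def bits (x : I.Elt) : List Bool := List.ofFn (I.enc x)

/-- The bit string that encodes an exponent, for security parameter `lam`. -/
def expBits (lam : ℕ) (r : ZMod I.p) : List Bool := natToBits (lam + 1) r.val

/-- The public bit string `(𝔾, p, g)`, for security parameter `lam`. -/
def pub (lam : ℕ) : List Bool := List.ofFn I.desc ++ natToBits (lam + 1) I.p ++ I.bits I.g

end GroupDesc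

/-- A group-generator scheme: on security parameter `lam` and `coinLen lam` random bits it outputs
a group `(𝔾, p, g)`, where `p` is a prime with `log₂ p = lam` up to rounding. The generation of the
group, and the multiplication and the inversion in it, are polynomial-time. -/
structure GroupScheme where
  coinLen : ℕ → ℕ
  descLen : ℕ → ℕ
  eltLen : ℕ → ℕ
  inst : ∀ lam, Str (coinLen lam) → GroupDesc (descLen lam) (eltLen lam)
  order_gt : ∀ lam w, 0 < lam → 2 ^ lam < 2 * (inst lam w).p
  order_lt : ∀ lam w, 0 < lam → (inst lam w).p < 2 ^ (lam + 1)
  coinLen_poly : PolyBounded coinLen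
  gen : Algorithm
  gen_poly : gen.PolyTime
  gen_run : ∀ lam w, gen.run noOracle lam (List.ofFn w) = PMF.pure ((inst lam w).pub lam)
  mul : Algorithm
  mul_poly : mul.PolyTime
  mul_run : ∀ lam w (x y : (inst lam w).Elt),
    mul.run noOracle lam ((inst lam w).pub lam ++ (inst lam w).bits x ++ (inst lam w).bits y) =
      PMF.pure ((inst lam w).bits (x * y))
  inv : Algorithm
  inv_poly : inv.PolyTime
  inv_run : ∀ lam w (x : (inst lam w).Elt),
    inv.run noOracle lam ((inst lam w).pub lam ++ (inst lam w).bits x) =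
      PMF.pure ((inst lam w).bits x⁻¹)

namespace GroupScheme

variable (G : GroupScheme)

open Classical in
/-- The discrete-logarithm experiment: does `A`, given `(𝔾, p, g)` and `g ^ a` for a uniform
exponent `a`, output `a`? -/
def dlExp (A : Algorithm) (lam : ℕ) : PMF Bool := do
  let w ← PMF.uniformOfFintype (Str (G.coinLen lam))
  let I := G.inst lam w
  let a ← PMF.uniformOfFintype (ZMod I.p)
  let out ← A.run noOracle lam (I.pub lam ++ I.bits (I.gpow a))
  return decide (out = I.expBits lam a)

/-- The DL assumption for the scheme. -/
def DLHard : Prop :=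
  ∀ A : Algorithm, A.PolyTime → Negligible fun lam => (G.dlExp A lam true).toReal

open Classical in
/-- The computational Diffie-Hellman experiment: does `A`, given `(𝔾, p, g)` and
`g ^ a₁, g ^ a₂` for uniform exponents, output `g ^ (a₁ * a₂)`? -/
def cdhExp (A : Algorithm) (lam : ℕ) : PMF Bool := do
  let w ← PMF.uniformOfFintype (Str (G.coinLen lam))
  let I := G.inst lam w
  let a₁ ← PMF.uniformOfFintype (ZMod I.p)
  let a₂ ← PMF.uniformOfFintype (ZMod I.p)
  let out ← A.run noOracle lam (I.pub lam ++ I.bits (I.gpow a₁) ++ I.bits (I.gpow a₂))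
  return decide (out = I.bits (I.gpow (a₁ * a₂)))

/-- The CDH assumption for the scheme. -/
def CDHHard : Prop :=
  ∀ A : Algorithm, A.PolyTime → Negligible fun lam => (G.cdhExp A lam true).toReal

end GroupScheme

/-! ## The functionality and the security definition -/

/-- The parties' inputs: a vector `m` of `z` pairs of messages (from the sender), where `m t i` is
the `i`-th message of the `t`-th pair (`false` is `0` and `true` is `1`); the index `v` of a pair
(from the first server); and the index `s` of a message in a pair (from the receiver). -/
structure Input (sig : ℕ) where
  z : ℕ
  m : Fin z → Bool → Str sig
  v : Fin z
  s : Bool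

namespace Input

variable {sig : ℕ}

/-- The functionality `(m, v, ε, s) ↦ (ε, z, ε, m_{s,v})`; the outputs are those of the sender, of
the two servers and of the receiver. -/
def functionality (x : Input sig) : Unit × ℕ × Unit × Str sig := ((), x.z, (), x.m x.v x.s)

/-- The sender's vector of messages as a bit string. -/
def msgBits (x : Input sig) : List Bool :=
  (List.ofFn fun t => List.ofFn (x.m t false) ++ List.ofFn (x.m t true)).flatten

end Input

/-- An index `v < z` together with the number `z`, as a bit string: the unit vector of length `z`
that has its one at position `v`. -/
def indexBits (v z : ℕ) : List Bool := List.ofFn fun t : Fin z => decide ((t : ℕ) = v)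

/-- What comes out of one execution of a protocol between the sender `S`, the servers `P₁` and `P₂`
and the receiver `R`: the view of each party (its input, its random coins and the messages that it
received, as a bit string) and the outputs of all parties (`none` after an abort). -/
structure Execution (sig : ℕ) where
  viewS : List Bool
  viewP1 : List Bool
  viewP2 : List Bool
  viewR : List Bool
  output : Option (Unit × ℕ × Unit × Str sig)

/-- A protocol in the random-oracle model: for every security parameter, all inputs and every hash
function, the law of its execution. -/
def Protocol (sig : ℕ → ℕ) : Type :=
  ∀ lam, Input (sig lam) → Hash (sig lam) → PMF (Execution (sig lam))

/-- The protocol securely computes the functionality `(m, v, ε, s) ↦ (ε, z, ε, m_{s,v})` in the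
presence of a semi-honest adversary that corrupts `S`, `R`, `P₁` or `P₂`. -/
structure SecurelyComputes (sig : ℕ → ℕ) (Γ : Protocol sig) : Prop where
  /-- all parties obtain their outputs -/
  correct : ∀ (lam : ℕ) (x : Input (sig lam)) (H : Hash (sig lam)),
    ∀ E ∈ (Γ lam x H).support, E.output = some x.functionality
  /-- the view of `S` is simulated from its input `m` -/
  simS : ∃ Sim : Algorithm, Sim.PolyTime ∧
    CompIndist sig (ι := fun lam => Input (sig lam)) (fun _ x => x.z)
      (fun lam x H => Sim.run H.oracle lam x.msgBits)
      (fun lam x H => (Γ lam x H).map Execution.viewS)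
  /-- the view of `P₁` is simulated from its input `v` and its output `z` -/
  simP1 : ∃ Sim : Algorithm, Sim.PolyTime ∧
    CompIndist sig (ι := fun lam => Input (sig lam)) (fun _ x => x.z)
      (fun lam x H => Sim.run H.oracle lam (indexBits x.v x.functionality.2.1))
      (fun lam x H => (Γ lam x H).map Execution.viewP1)
  /-- the view of `P₂` is simulated from nothing -/
  simP2 : ∃ Sim : Algorithm, Sim.PolyTime ∧
    CompIndist sig (ι := fun lam => Input (sig lam)) (fun _ x => x.z)
      (fun lam _ H => Sim.run H.oracle lam [])
      (fun lam x H => (Γ lam x H).map Execution.viewP2)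
  /-- the view of `R` is simulated from its input `s` and its output `m_{s,v}` -/
  simR : ∃ Sim : Algorithm, Sim.PolyTime ∧
    CompIndist sig (ι := fun lam => Input (sig lam)) (fun _ x => x.z)
      (fun lam x H => Sim.run H.oracle lam (x.s :: List.ofFn x.functionality.2.2.2))
      (fun lam x H => (Γ lam x H).map Execution.viewR)

/-- The receiver learns nothing about `z`: its views on any two inputs with the same index `s` and
the same requested message, but possibly different numbers of pairs, are indistinguishable. -/
def HidesCountFromReceiver (sig : ℕ → ℕ) (Γ : Protocol sig) : Prop :=
  CompIndist sig
    (ι := fun lam => {q : Input (sig lam) × Input (sig lam) //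
      q.1.s = q.2.s ∧ q.1.m q.1.v q.1.s = q.2.m q.2.v q.2.s})
    (fun _ q => max q.1.1.z q.1.2.z)
    (fun lam q H => (Γ lam q.1.1 H).map Execution.viewR)
    (fun lam q H => (Γ lam q.1.2 H).map Execution.viewR)

/-- The sender learns nothing about `v` (nor about `s`): its views on any two inputs with the same
vector of messages are indistinguishable. -/
def HidesIndexFromSender (sig : ℕ → ℕ) (Γ : Protocol sig) : Prop :=
  CompIndist sig
    (ι := fun lam => (x : Input (sig lam)) × Fin x.z × Bool)
    (fun _ q => q.1.z)
    (fun lam q H => (Γ lam q.1 H).map Execution.viewS)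
    (fun lam q H => (Γ lam { q.1 with v := q.2.1, s := q.2.2 } H).map Execution.viewS)

/-! ## The protocol -/

namespace DQMR

/-- Sharing of the bit `s` into two shares whose exclusive or is `s`, with random coin `b`. -/
def share (s b : Bool) : Bool × Bool := (b, Bool.xor b s)

variable {d e : ℕ} (I : GroupDesc d e) {sig : ℕ}

/-- Query generation by `P₂`: `δ_{s₂} = g ^ r₂` and `δ_{1-s₂} = C / g ^ r₂`. -/
def genQuery2 (C : I.Elt) (s₂ : Bool) (r₂ : ZMod I.p) : Bool → I.Elt :=
  fun i => if i = s₂ then I.gpow r₂ else C / I.gpow r₂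

/-- Query generation by `P₁`: `β_{s₁} = δ₀ * g ^ r₁` and `β_{1-s₁} = δ₁ / g ^ r₁`. -/
def genQuery1 (s₁ : Bool) (r₁ : ZMod I.p) (δ : Bool → I.Elt) : Bool → I.Elt :=
  fun i => if i = s₁ then δ false * I.gpow r₁ else δ true / I.gpow r₁

/-- An encrypted pair of messages. -/
abbrev Pair (sig : ℕ) : Type := Bool → I.Elt × Str sig

open Classical in
/-- Response generation by `S`: abort if `C ≠ β₀ * β₁`, else send the `z` pairs with
`e_{i,t} = (g ^ y_{i,t}, H (β_i ^ y_{i,t}) ⊕ m_{i,t})`. -/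
def genRes (H : Hash sig) (C : I.Elt) {z : ℕ} (m : Fin z → Bool → Str sig)
    (y : Fin z → Bool → ZMod I.p) (β : Bool → I.Elt) : Option (List (Pair I sig)) :=
  if C ≠ β false * β true then none
  else some (List.ofFn fun t i =>
    (I.gpow (y t i), (H (I.bits (β i ^ (y t i).val))).xor (m t i)))

/-- Filtering by `P₁`: forward only the `v`-th pair of the response. -/
def oblFilter (v : ℕ) (res : List (Pair I sig)) : Option (Pair I sig) := res[v]?

/-- Message extraction by `R`: with `x = r₂ + r₁ * (-1) ^ s₂`, compute
`H (e_{s,0} ^ x) ⊕ e_{s,1}`. -/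
def retrieve (H : Hash sig) (s s₂ : Bool) (r₁ r₂ : ZMod I.p) (pr : Pair I sig) : Str sig :=
  let x : ZMod I.p := r₂ + r₁ * (-1) ^ s₂.toNat
  (H (I.bits ((pr s).1 ^ x.val))).xor (pr s).2

/-- A pair as a bit string. -/
def pairBits (pr : Pair I sig) : List Bool :=
  I.bits (pr false).1 ++ List.ofFn (pr false).2 ++ I.bits (pr true).1 ++ List.ofFn (pr true).2

/-- The execution of the protocol on given coins: `w` (group generation, by `S`), `C` (by `S`), `b`
(sharing, by `R`), `r₁` and `r₂` (by `R`), and `y` (by `S`). An abort is received as the empty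
string. -/
def execution (G : GroupScheme) (lam : ℕ) (x : Input sig) (H : Hash sig)
    (w : Str (G.coinLen lam)) (C : (G.inst lam w).Elt) (b : Bool)
    (r₁ r₂ : ZMod (G.inst lam w).p) (y : Fin x.z → Bool → ZMod (G.inst lam w).p) :
    Execution sig :=
  let I := G.inst lam w
  let pk : List Bool := I.pub lam ++ I.bits C
  let s₁ := (share x.s b).1
  let s₂ := (share x.s b).2
  let δ := genQuery2 I C s₂ r₂
  let β := genQuery1 I s₁ r₁ δ
  let res := genRes I H C x.m y β
  let res' := res.bind (oblFilter I x.v)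
  { viewS :=
      x.msgBits
      ++ (List.ofFn w ++ I.bits C
        ++ (List.ofFn fun t => I.expBits lam (y t false) ++ I.expBits lam (y t true)).flatten)
      ++ (I.bits (β false) ++ I.bits (β true))
    viewP1 :=
      indexBits x.v x.z
      ++ pk
      ++ ([s₁] ++ I.expBits lam r₁)
      ++ (I.bits (δ false) ++ I.bits (δ true))
      ++ (res.elim [] fun l => (l.map (pairBits I)).flatten)
    viewP2 :=
      pk
      ++ ([s₂] ++ I.expBits lam r₂)
    viewR :=
      [x.s]
      ++ ([b] ++ I.expBits lam r₁ ++ I.expBits lam r₂)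
      ++ pk
      ++ (res'.elim [] (pairBits I))
    output := do
      let l ← res
      let pr ← res'
      return ((), l.length, (), retrieve I H x.s s₂ r₁ r₂ pr) }

/-- The delegated-query multi-receiver oblivious transfer protocol. -/
def protocol (G : GroupScheme) (sig : ℕ → ℕ) : Protocol sig := fun lam x H => do
  let w ← PMF.uniformOfFintype (Str (G.coinLen lam))
  let I := G.inst lam w
  let C ← PMF.uniformOfFintype I.Elt
  let b ← PMF.uniformOfFintype Bool
  let r₁ ← PMF.uniformOfFintype (ZMod I.p)
  let r₂ ← PMF.uniformOfFintype (ZMod I.p)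
  let y ← PMF.uniformOfFintype (Fin x.z → Bool → ZMod I.p)
  return execution G lam x H w C b r₁ r₂ y

end DQMR

end

noncomputable section

/-! ## Relocation and composition of circuits -/

/-! Each message is encrypted by hashed ElGamal under one of two public keys `β false`, `β true`
whose product is `C`. The two swaps made by the servers compose to the choice bit `s`, so the
receiver knows the discrete logarithm `x` of `β s`, and the other key is `C / g ^ x`. Correctness is
the identity `(g ^ y) ^ x = (g ^ x) ^ y`, and the product test always passes.

Every security claim starts from a change of variables in the exponents. For given `C`, the first
key is uniform whatever `s`, `b`, `r₁` are (`exists_equiv_query`), so the law of the sender's view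
depends on its messages alone (`viewS_law`). The second server sees a one-time padded bit
(`viewP2_law`). These two views are simulated perfectly.

The first server sees both keys, and they are independent and uniform, as are its own coins
(`queries_law`). The receiver's view can be parametrised so that the unrequested key is `g ^ a` with
`a` independent of its coins (`viewR_law`); it contains one ciphertext under that key, and all pairs
other than the `v`-th have disappeared. The simulators replace each ciphertext that must stay hidden
by a random group element and a random string: one ciphertext for the receiver (`close_recv`), and
all of them, one after the other, for the first server (`close_mixed_step`, `close_mixed`).

One replacement costs little because of CDH. The mask is `H` at `q`, the encoding of `g ^ (a * y)`,
while the view shows `g ^ a` and `g ^ y`. If the value of `H` at `q` is resampled, the real game and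
the game with an independent mask differ only in the oracle's answer at `q`; hence the acceptance
probabilities differ by at most the expected number of queries to `q` in the game with the
independent mask (`close_hash_uniform`). In that game the oracle has no relation to the view and can
be sampled lazily. For each oracle gate, the part of the distinguisher that computes its query thus
becomes an oracle-free circuit that outputs the CDH solution with the probability that this query is
`q` (`close_mask`).

Running time is explicit circuit size. `Impl Γ F s` provides one circuit of size at most `s` for all
values of a hidden index, and combinators build reductions and simulators from gates. Since inputs
are quantified after the negligible bound, CDH is first turned into one bound for all circuits of a
given polynomial size (`CDHHard.exists_bound`); messages and indices can then be hard-wired into the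
reductions. -/

theorem PMF.bind_congr_support {α β : Type*} (p : PMF α) {f g : α → PMF β}
    (h : ∀ a ∈ p.support, f a = g a) : p.bind f = p.bind g := by
  ext b
  rw [PMF.bind_apply, PMF.bind_apply]
  refine tsum_congr fun a => ?_
  by_cases ha : a ∈ p.support
  · rw [h a ha]
  · rw [PMF.mem_support_iff, not_not] at ha
    simp [ha]

theorem PMF.map_congr_support {α β : Type*} (p : PMF α) {f g : α → β}
    (h : ∀ a ∈ p.support, f a = g a) : p.map f = p.map g :=
  p.bind_congr_support fun a ha => by simp [h a ha]

theorem wire_append_left {w : List Bool} {i : ℕ} (h : i < w.length) (t : List Bool) :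
    wire (w ++ t) i = wire w i := by
  simp [wire, List.getElem?_append_left h]

theorem wire_append_right (w t : List Bool) (j : ℕ) : wire (w ++ t) (w.length + j) = wire t j := by
  simp [wire, List.getElem?_append_right]

theorem wire_of_le {w : List Bool} {i : ℕ} (h : w.length ≤ i) : wire w i = false := by
  simp [wire, List.getElem?_eq_none h]

theorem wire_eq_getElem {w : List Bool} {i : ℕ} (h : i < w.length) : wire w i = w[i] := by
  simp [wire, h]

theorem map_wire_range (w : List Bool) : (List.range w.length).map (wire w) = w := by
  refine List.ext_getElem (by simp) fun i h1 h2 => ?_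
  simp [wire_eq_getElem h2]

theorem map_wire_congr {l : List ℕ} {w w' : List Bool} (h : ∀ i ∈ l, wire w i = wire w' i) :
    l.map (wire w) = l.map (wire w') := List.map_congr_left h

theorem wire_map {l : List ℕ} {i : ℕ} (h : i < l.length) (w : List Bool) :
    wire (l.map (wire w)) i = wire w l[i] := by
  simp [wire, h]

/-- The gate with its input wires renamed. -/
def Gate.rename (f : ℕ → ℕ) : Gate → Gate
  | .const b => .const b
  | .nand i j => .nand (f i) (f j)
  | .coin => .coin
  | .sample ws => .sample (ws.map f)
  | .oracle ws => .oracle (ws.map f)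

theorem Gate.size_rename (f : ℕ → ℕ) (g : Gate) : (g.rename f).size = g.size := by
  cases g <;> simp [Gate.rename, Gate.size]

theorem Gate.run_rename {f : ℕ → ℕ} {u W : List Bool} (h : ∀ i, wire u i = wire W (f i))
    (O : List Bool → List Bool) (g : Gate) : (g.rename f).run O W = g.run O u := by
  have hl : ∀ ws : List ℕ, (ws.map f).map (wire W) = ws.map (wire u) := fun ws => by
    simp [Function.comp_def, h]
  cases g <;> simp [Gate.rename, Gate.run, h, -List.map_map, hl]

theorem gates_size_rename (f : ℕ → ℕ) (gs : List Gate) :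
    ((gs.map (Gate.rename f)).map Gate.size).sum = (gs.map Gate.size).sum := by
  simp [Function.comp_def, Gate.size_rename]

theorem runGates_append (O : List Bool → List Bool) (gs gs' : List Gate) (w : List Bool) :
    runGates O (gs ++ gs') w = (runGates O gs w).bind (runGates O gs') := by
  induction gs generalizing w with
  | nil => simp [runGates]
  | cons g gs ih => simp [runGates, ih]

theorem runGates_support_prefix {O : List Bool → List Bool} {gs : List Gate} {w w' : List Bool}
    (h : w' ∈ (runGates O gs w).support) : w <+: w' := by
  induction gs generalizing w with
  | nil =>
    simp only [runGates, PMF.support_pure, Set.mem_singleton_iff] at h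
    exact h ▸ List.prefix_rfl
  | cons g gs ih =>
    simp only [runGates, PMF.mem_support_bind_iff] at h
    obtain ⟨new, -, h⟩ := h
    exact (List.prefix_append w new).trans (ih h)

/-- The number of wires that a gate appends, when the oracle's answers have length `ℓ`. -/
def Gate.width (ℓ : ℕ) : Gate → ℕ
  | .const _ => 1
  | .nand _ _ => 1
  | .coin => 1
  | .sample ws => ws.length
  | .oracle _ => ℓ

theorem Gate.length_run {O : List Bool → List Bool} {ℓ : ℕ} (hO : ∀ q, (O q).length = ℓ) {g : Gate}
    {w new : List Bool} (h : new ∈ (g.run O w).support) : new.length = g.width ℓ := by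
  cases g with
  | sample ws =>
    simp only [Gate.run] at h
    split at h
    · simp at h; simp [h, Gate.width]
    · simp only [PMF.support_map, Set.mem_image] at h
      obtain ⟨a, -, rfl⟩ := h
      simp [natToBits, Gate.width]
  | coin =>
    simp only [Gate.run, PMF.support_map, Set.mem_image] at h
    obtain ⟨a, -, rfl⟩ := h
    simp [Gate.width]
  | const b => simp [Gate.run] at h; simp [h, Gate.width]
  | nand i j => simp [Gate.run] at h; simp [h, Gate.width]
  | oracle ws => simp [Gate.run] at h; simp [h, Gate.width, hO]

theorem runGates_length {O : List Bool → List Bool} {ℓ : ℕ} (hO : ∀ q, (O q).length = ℓ)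
    {gs : List Gate} {w w' : List Bool} (h : w' ∈ (runGates O gs w).support) :
    w'.length = w.length + (gs.map (Gate.width ℓ)).sum := by
  induction gs generalizing w with
  | nil =>
    simp only [runGates, PMF.support_pure, Set.mem_singleton_iff] at h
    simp [h]
  | cons g gs ih =>
    simp only [runGates, PMF.mem_support_bind_iff] at h
    obtain ⟨new, hn, h⟩ := h
    rw [ih h, List.length_append, Gate.length_run hO hn]
    simp [add_assoc]

/-- Corresponding gates read the same bits in both runs, so they append the same blocks, and a
renaming that shifts new wires past the end of `W` stays valid. Wires that do not exist carry
`false` on both sides; hence only the existing wires enter the hypothesis `h`. The wires in `pre`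
lie in `W` and keep their bits. -/
theorem runGates_rename {O : List Bool → List Bool} {f : ℕ → ℕ} (gs : List Gate)
    (pre outs : List ℕ) (u W : List Bool)
    (h : ∀ i < u.length, f i < W.length ∧ wire u i = wire W (f i))
    (hf : ∀ j, f (u.length + j) = W.length + j) (hpre : ∀ j ∈ pre, j < W.length) :
    (runGates O (gs.map (Gate.rename f)) W).map (fun W' => (pre ++ outs.map f).map (wire W')) =
      (runGates O gs u).map (fun u' => pre.map (wire W) ++ outs.map (wire u')) := by
  have hall : ∀ i, wire u i = wire W (f i) := fun i => by
    by_cases hi : i < u.length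
    · exact (h i hi).2
    · obtain ⟨j, rfl⟩ := Nat.exists_eq_add_of_le (not_lt.1 hi)
      rw [hf, wire_of_le (by simp), wire_of_le (by simp)]
  induction gs generalizing u W with
  | nil => simp [runGates, PMF.pure_map, Function.comp_def, show wire u = _ from funext hall]
  | cons g gs ih =>
    simp only [List.map_cons, runGates, PMF.map_bind, Gate.run_rename hall]
    congr 1
    funext new
    have h' : ∀ i < (u ++ new).length,
        f i < (W ++ new).length ∧ wire (u ++ new) i = wire (W ++ new) (f i) := by
      intro i hi
      by_cases hi' : i < u.length
      · obtain ⟨h1, h2⟩ := h i hi'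
        refine ⟨by simp; omega, ?_⟩
        rw [wire_append_left hi', wire_append_left h1, h2]
      · obtain ⟨j, rfl⟩ := Nat.exists_eq_add_of_le (not_lt.1 hi')
        rw [hf, wire_append_right, wire_append_right]
        simp at hi ⊢
        omega
    have hf' : ∀ j, f ((u ++ new).length + j) = (W ++ new).length + j := fun j => by
      simp only [List.length_append, add_assoc, hf]
    have hpre' : ∀ j ∈ pre, j < (W ++ new).length := fun j hj => by
      have := hpre j hj
      simp; omega
    rw [ih (u ++ new) (W ++ new) h' hf' hpre' (fun i => ?_)]
    · congr 1
      funext u'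
      congr 1
      exact map_wire_congr fun i hi => wire_append_left (hpre i hi) new
    · by_cases hi : i < (u ++ new).length
      · exact (h' i hi).2
      · obtain ⟨j, rfl⟩ := Nat.exists_eq_add_of_le (not_lt.1 hi)
        rw [hf', wire_of_le (by simp), wire_of_le (by simp)]

/-- The context of a circuit under construction, for every value of a hidden index `i`: the oracle,
and the bits on the present wires, whose number does not depend on `i`. -/
structure Env (ι : Type) where
  O : ι → List Bool → List Bool
  X : ι → List Bool
  ansLen : ℕ
  len : ℕ
  length_O : ∀ i q, (O i q).length = ansLen
  length_X : ∀ i, (X i).length = len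

namespace Env

variable {ι κ : Type}

/-- Append further wires to the context. -/
def snoc (Γ : Env ι) (y : ι → List Bool) (m : ℕ) (hy : ∀ i, (y i).length = m) : Env ι where
  O := Γ.O
  X i := Γ.X i ++ y i
  ansLen := Γ.ansLen
  len := Γ.len + m
  length_O := Γ.length_O
  length_X i := by simp [Γ.length_X, hy]

/-- Change of the hidden index. -/
def pull (Γ : Env ι) (φ : κ → ι) : Env κ where
  O k := Γ.O (φ k)
  X k := Γ.X (φ k)
  ansLen := Γ.ansLen
  len := Γ.len
  length_O k := Γ.length_O (φ k)
  length_X k := Γ.length_X (φ k)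

/-- Extension of the hidden index by a value of type `κ i` that is put on new wires. -/
def ext (Γ : Env ι) {κ : ι → Type} (e : ∀ i, κ i → List Bool) (m : ℕ)
    (he : ∀ i k, (e i k).length = m) : Env (Σ i, κ i) :=
  (Γ.pull Sigma.fst).snoc (fun j => e j.1 j.2) m fun j => he j.1 j.2

end Env

/-- The bits `y i` can be read off the wires of the context. -/
def Reads {ι : Type} (Γ : Env ι) (y : ι → List Bool) : Prop :=
  ∃ idx : List ℕ, (∀ j ∈ idx, j < Γ.len) ∧ ∀ i, y i = idx.map (wire (Γ.X i))

namespace Reads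

variable {ι κ : Type} {Γ : Env ι} {y z : ι → List Bool}

theorem length_eq (h : Reads Γ y) (i j : ι) : (y i).length = (y j).length := by
  obtain ⟨idx, -, h⟩ := h
  simp [h]

theorem self (Γ : Env ι) : Reads Γ Γ.X :=
  ⟨List.range Γ.len, by simp, fun i => by rw [← Γ.length_X i, map_wire_range]⟩

theorem nil (Γ : Env ι) : Reads Γ fun _ => [] := ⟨[], by simp, by simp⟩

theorem append (hy : Reads Γ y) (hz : Reads Γ z) : Reads Γ fun i => y i ++ z i := by
  obtain ⟨a, ha, ha'⟩ := hy
  obtain ⟨b, hb, hb'⟩ := hz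
  refine ⟨a ++ b, fun j hj => ?_, fun i => by simp [ha', hb']⟩
  rcases List.mem_append.1 hj with hj | hj
  exacts [ha j hj, hb j hj]

theorem snoc (hy : Reads Γ y) {m : ℕ} {hz : ∀ i, (z i).length = m} : Reads (Γ.snoc z m hz) y := by
  obtain ⟨a, ha, ha'⟩ := hy
  refine ⟨a, fun j hj => Nat.lt_add_right m (ha j hj), fun i => ?_⟩
  rw [ha']
  exact map_wire_congr fun j hj => (wire_append_left ((Γ.length_X i).symm ▸ ha j hj) _).symm

theorem last {m : ℕ} {hz : ∀ i, (z i).length = m} : Reads (Γ.snoc z m hz) z := by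
  refine ⟨(List.range m).map (Γ.len + ·), by simp [Env.snoc], fun i => ?_⟩
  conv_lhs => rw [← map_wire_range (z i), hz]
  simp only [Env.snoc, List.map_map]
  refine List.map_congr_left fun j _ => ?_
  simp only [Function.comp, ← Γ.length_X i, wire_append_right]

theorem pull (hy : Reads Γ y) (φ : κ → ι) : Reads (Γ.pull φ) fun k => y (φ k) := by
  obtain ⟨a, ha, ha'⟩ := hy
  exact ⟨a, ha, fun k => ha' (φ k)⟩

theorem ext (hy : Reads Γ y) {κ : ι → Type} {e : ∀ i, κ i → List Bool} {m : ℕ}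
    {he : ∀ i k, (e i k).length = m} : Reads (Γ.ext e m he) fun j => y j.1 :=
  (hy.pull Sigma.fst).snoc

theorem extLast {κ : ι → Type} {e : ∀ i, κ i → List Bool} {m : ℕ}
    {he : ∀ i k, (e i k).length = m} : Reads (Γ.ext e m he) fun j => e j.1 j.2 :=
  last

theorem bit (hy : Reads Γ y) {j : ℕ} (hj : ∀ i, j < (y i).length) :
    Reads Γ fun i => [wire (y i) j] := by
  obtain ⟨a, ha, ha'⟩ := hy
  rcases isEmpty_or_nonempty ι with hι | ⟨⟨i₀⟩⟩
  · exact ⟨[], by simp, fun i => hι.elim i⟩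
  have hj' : j < a.length := by simpa [ha'] using hj i₀
  exact ⟨[a[j]], by simpa using ha _ (List.getElem_mem hj'), fun i => by
    simp [ha', wire_map hj']⟩

theorem take (hy : Reads Γ y) (k : ℕ) : Reads Γ fun i => (y i).take k := by
  obtain ⟨a, ha, ha'⟩ := hy
  exact ⟨a.take k, fun j hj => ha j (List.mem_of_mem_take hj),
    fun i => by simp [ha', List.map_take]⟩

theorem drop (hy : Reads Γ y) (k : ℕ) : Reads Γ fun i => (y i).drop k := by
  obtain ⟨a, ha, ha'⟩ := hy
  exact ⟨a.drop k, fun j hj => ha j (List.mem_of_mem_drop hj),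
    fun i => by simp [ha', List.map_drop]⟩

end Reads

/-- In the context `Γ`, a circuit of size at most `s` has the output distribution `F i`. -/
def Impl {ι : Type} (Γ : Env ι) (F : ι → PMF (List Bool)) (s : ℕ) : Prop :=
  ∃ c : Circuit, c.size ≤ s ∧ ∀ i, c.eval (Γ.O i) (Γ.X i) = F i

/-! ### Combinators for circuits of bounded size -/

namespace Impl

variable {ι κ : Type} {Γ : Env ι} {y z : ι → List Bool} {F : ι → PMF (List Bool)} {s s₁ s₂ : ℕ}

theorem mono (h : Impl Γ F s₁) (hs : s₁ ≤ s₂) : Impl Γ F s₂ := by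
  obtain ⟨c, hc, h⟩ := h
  exact ⟨c, hc.trans hs, h⟩

theorem congr (h : Impl Γ F s) {F' : ι → PMF (List Bool)} (hF : ∀ i, F i = F' i) : Impl Γ F' s :=
  (funext hF : F = F') ▸ h

/-- Run a circuit on bits that can be read off the context. -/
theorem ofCircuit (c : Circuit) (hy : Reads Γ y) :
    Impl Γ (fun i => c.eval (Γ.O i) (y i)) c.size := by
  obtain ⟨idx, hidx, hy⟩ := hy
  -- Inputs of `c` are looked up in the context; the wires created by `c` are numbered from the end
  -- of the context.
  set f : ℕ → ℕ := fun i => if h : i < idx.length then idx[i] else Γ.len + (i - idx.length)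
    with hfdef
  refine ⟨⟨c.gates.map (Gate.rename f), c.outs.map f⟩, ?_, fun i => ?_⟩
  · simp only [Circuit.size, gates_size_rename, List.length_map, le_refl]
  · have := runGates_rename (O := Γ.O i) (f := f) c.gates [] c.outs (y i) (Γ.X i)
      (fun j hj => ?_) (fun j => ?_) (by simp)
    · simpa [Circuit.eval] using this
    · rw [hy, List.length_map] at hj
      simp only [hfdef, hj, dif_pos, Γ.length_X, hy, wire_map hj, and_true]
      exact hidx _ (List.getElem_mem hj)
    · simp [hfdef, hy, Γ.length_X]

theorem weaken (h : Impl Γ F s) {m : ℕ} {hz : ∀ i, (z i).length = m} :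
    Impl (Γ.snoc z m hz) F s := by
  obtain ⟨c, hc, h⟩ := h
  exact ((ofCircuit (Γ := Γ.snoc z m hz) c (Reads.self Γ).snoc).mono hc).congr h

theorem weakenExt (h : Impl Γ F s) {κ : ι → Type} {e : ∀ i, κ i → List Bool} {m : ℕ}
    {he : ∀ i k, (e i k).length = m} : Impl (Γ.ext e m he) (fun j => F j.1) s := by
  obtain ⟨c, hc, h⟩ := h
  exact ((ofCircuit (Γ := Γ.ext e m he) c (Reads.self Γ).ext).mono hc).congr fun j => h j.1

theorem ret (hy : Reads Γ y) {m : ℕ} (hm : ∀ i, (y i).length = m) :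
    Impl Γ (fun i => PMF.pure (y i)) m := by
  obtain ⟨idx, hidx, hy⟩ := hy
  rcases isEmpty_or_nonempty ι with hι | ⟨⟨i₀⟩⟩
  · exact ⟨⟨[], []⟩, by simp [Circuit.size], fun i => hι.elim i⟩
  · have : idx.length = m := by simpa [hy] using hm i₀
    exact ⟨⟨[], idx⟩, by simp [Circuit.size, this], fun i => by
      simp [Circuit.eval, runGates, PMF.pure_map, hy]⟩

/-- The second circuit is relocated behind the first and reads the first one's outputs in place. The
flag `keep` decides whether these outputs are also passed on, which serves concatenation; the
additional unit of size pays for a constant gate. -/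
theorem bind_core {κ : ι → Type} {P : ∀ i, PMF (κ i)} {e : ∀ i, κ i → List Bool} {m : ℕ}
    {he : ∀ i k, (e i k).length = m} {G : ∀ i, κ i → PMF (List Bool)} (keep : Bool)
    (h₁ : Impl Γ (fun i => (P i).map (e i)) s₁)
    (h₂ : Impl (Γ.ext e m he) (fun j => G j.1 j.2) s₂) :
    Impl Γ (fun i => (P i).bind fun k => (G i k).map
      fun z => (if keep then e i k else []) ++ z) (s₁ + s₂ + 1) := by
  obtain ⟨c₁, hc₁, h₁⟩ := h₁
  obtain ⟨c₂, hc₂, h₂⟩ := h₂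
  rcases isEmpty_or_nonempty ι with hι | ⟨⟨i₀⟩⟩
  · exact ⟨⟨[], []⟩, by simp [Circuit.size], fun i => hι.elim i⟩
  -- Any point of the support shows that the first circuit has as many outputs as an encoding has
  -- bits.
  have hm : c₁.outs.length = m := by
    obtain ⟨y, hy⟩ := (c₁.eval (Γ.O i₀) (Γ.X i₀)).support_nonempty
    have hy' := hy
    simp only [h₁ i₀, PMF.support_map, Set.mem_image] at hy'
    obtain ⟨k, -, hk⟩ := hy'
    simp only [Circuit.eval, PMF.support_map, Set.mem_image] at hy
    obtain ⟨w, -, hw⟩ := hy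
    rw [← he i₀ k, hk, ← hw, List.length_map]
  set N := Γ.len + (c₁.gates.map (Gate.width Γ.ansLen)).sum with hN
  -- An output wire of `c₁` may fail to exist and then carries `false`. Once further gates are
  -- appended its number would belong to another wire, so it is redirected to a constant `false` at
  -- position `N`.
  set fix : ℕ → ℕ := fun o => if o < N then o else N with hfix
  set f : ℕ → ℕ := fun i => if i < Γ.len then i else
    if h : i - Γ.len < c₁.outs.length then fix c₁.outs[i - Γ.len]
    else N + 1 + (i - Γ.len - m) with hfdef
  set pre : List ℕ := if keep then c₁.outs.map fix else [] with hpre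
  have hpre_lt : ∀ j ∈ pre, j < N + 1 := by
    intro j hj
    simp only [hpre] at hj
    split_ifs at hj
    · obtain ⟨o, -, rfl⟩ := List.mem_map.1 hj
      simp only [hfix]
      split_ifs <;> omega
    · simp at hj
  have hpre_len : pre.length ≤ c₁.outs.length := by
    simp only [hpre]
    split_ifs <;> simp
  refine ⟨⟨c₁.gates ++ (Gate.const false :: c₂.gates.map (Gate.rename f)),
    pre ++ c₂.outs.map f⟩, ?_, fun i => ?_⟩
  · simp only [Circuit.size, List.map_append, List.map_cons, List.sum_append, List.sum_cons,
      gates_size_rename, List.length_append, List.length_map, Gate.size] at hc₁ hc₂ ⊢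
    omega
  · have hstep : ∀ w ∈ (runGates (Γ.O i) c₁.gates (Γ.X i)).support,
        (runGates (Γ.O i) (Gate.const false :: c₂.gates.map (Gate.rename f)) w).map
          (fun W' => (pre ++ c₂.outs.map f).map (wire W')) =
        (c₂.eval (Γ.O i) (Γ.X i ++ c₁.outs.map (wire w))).map
          fun z => (if keep then c₁.outs.map (wire w) else []) ++ z := by
      intro w hw
      obtain ⟨t, rfl⟩ := runGates_support_prefix hw
      have hlen := runGates_length (Γ.length_O i) hw
      rw [Γ.length_X, ← hN] at hlen
      have hfixw : ∀ o, wire (Γ.X i ++ t ++ [false]) (fix o) = wire (Γ.X i ++ t) o := by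
        intro o
        simp only [hfix]
        split_ifs with ho
        · exact wire_append_left (by omega) _
        · rw [wire_of_le (w := Γ.X i ++ t) (by omega)]
          have := wire_append_right (Γ.X i ++ t) [false] 0
          rw [hlen] at this
          simpa [wire] using this
      simp only [runGates, Gate.run, PMF.pure_bind]
      rw [runGates_rename c₂.gates pre c₂.outs (Γ.X i ++ c₁.outs.map (wire (Γ.X i ++ t)))
        (Γ.X i ++ t ++ [false])]
      · have : pre.map (wire (Γ.X i ++ t ++ [false])) =
            if keep then c₁.outs.map (wire (Γ.X i ++ t)) else [] := by
          simp only [hpre]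
          split_ifs
          · simp [Function.comp_def, hfixw, -List.append_assoc]
          · simp
        rw [this, Circuit.eval, PMF.map_comp]
        rfl
      · intro j hj
        rw [List.length_append, List.length_map, Γ.length_X] at hj
        rw [List.length_append, hlen]
        by_cases hj1 : j < Γ.len
        · have : f j = j := by simp [hfdef, hj1]
          rw [this, wire_append_left (by rw [Γ.length_X]; exact hj1), List.append_assoc,
            wire_append_left (by rw [Γ.length_X]; exact hj1)]
          simp; omega
        · obtain ⟨k, rfl⟩ := Nat.exists_eq_add_of_le (not_lt.1 hj1)
          have hk : k < c₁.outs.length := by omega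
          have : f (Γ.len + k) = fix c₁.outs[k] := by simp [hfdef, hk]
          rw [this, hfixw, ← Γ.length_X i, wire_append_right, wire_map hk]
          refine ⟨?_, rfl⟩
          simp only [hfix, List.length_singleton]
          split_ifs <;> omega
      · intro j
        simp only [List.length_append, List.length_map, Γ.length_X, hfdef, List.length_singleton]
        rw [if_neg (by omega), dif_neg (by omega)]
        simp only [List.length_append, Γ.length_X] at hlen
        omega
      · intro j hj
        have := hpre_lt j hj
        rw [List.length_append, hlen]
        simpa using this
    rw [Circuit.eval, runGates_append, PMF.map_bind, PMF.bind_congr_support _ hstep]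
    have h1 := h₁ i
    rw [Circuit.eval] at h1
    have := congrArg (fun p => PMF.bind p fun y => (c₂.eval (Γ.O i) (Γ.X i ++ y)).map
      fun z => (if keep then y else []) ++ z) h1
    simp only [PMF.bind_map] at this
    refine this.trans ?_
    congr 1
    funext k
    have h2 := h₂ ⟨i, k⟩
    simp only [Env.ext, Env.snoc, Env.pull] at h2
    simp [Function.comp, h2]

/-- Sequential composition: the result of the first step is put on new wires. -/
theorem bind {κ : ι → Type} {P : ∀ i, PMF (κ i)} {e : ∀ i, κ i → List Bool} {m : ℕ}
    {he : ∀ i k, (e i k).length = m} {G : ∀ i, κ i → PMF (List Bool)}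
    (h₁ : Impl Γ (fun i => (P i).map (e i)) s₁)
    (h₂ : Impl (Γ.ext e m he) (fun j => G j.1 j.2) s₂) :
    Impl Γ (fun i => (P i).bind (G i)) (s₁ + s₂ + 1) :=
  (bind_core false h₁ h₂).congr fun i => by
    simp [show (fun z : List Bool => z) = id from rfl,
      PMF.map_id]

/-- Sequential composition of a deterministic step with a further one. -/
theorem letE {m : ℕ} (hy : ∀ i, (y i).length = m) (h₁ : Impl Γ (fun i => PMF.pure (y i)) s₁)
    (h₂ : Impl (Γ.snoc y m hy) F s₂) : Impl Γ F (s₁ + s₂ + 1) := by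
  obtain ⟨c, hc, h⟩ := h₂
  have := bind (Γ := Γ) (κ := fun _ => Unit) (P := fun _ => PMF.pure ()) (e := fun i _ => y i)
    (he := fun i _ => hy i) (G := fun i _ => F i) (s₁ := s₁) (s₂ := s₂)
    (h₁.congr fun i => by simp [PMF.pure_map]) ⟨c, hc, fun j => h j.1⟩
  exact this.congr fun i => by simp

/-- Independent runs one after the other, with the concatenation of the outputs as output. -/
theorem append {P Q : ι → PMF (List Bool)} {m : ℕ} (hP : ∀ i, ∀ y ∈ (P i).support, y.length = m)
    (h₁ : Impl Γ P s₁) (h₂ : Impl Γ Q s₂) :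
    Impl Γ (fun i => (P i).bind fun y => (Q i).map (y ++ ·)) (s₁ + s₂ + 1) := by
  -- The encoding must have length `m` on every string, also outside the support, where its value is
  -- irrelevant.
  let fixLen : List Bool → List Bool := fun y => if y.length = m then y else List.replicate m false
  have hfix : ∀ i, ∀ y ∈ (P i).support, fixLen y = y := fun i y hy => by simp [fixLen, hP i y hy]
  have h := bind_core (Γ := Γ) (κ := fun _ => List Bool) (P := P) (e := fun _ => fixLen)
    (m := m) (he := fun i k => by simp only [fixLen]; split_ifs <;> simp_all)
    (G := fun i _ => Q i) true
    (h₁.congr fun i => ?_) h₂.weakenExt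
  · refine h.congr fun i => PMF.bind_congr_support _ fun y hy => ?_
    simp [hfix i y hy]
  · rw [PMF.map_congr_support (P i) (hfix i), show (fun z : List Bool => z) = id from rfl,
      PMF.map_id]

theorem appendPure {m : ℕ} (hy : ∀ i, (y i).length = m) (h₁ : Impl Γ (fun i => PMF.pure (y i)) s₁)
    (h₂ : Impl Γ (fun i => PMF.pure (z i)) s₂) :
    Impl Γ (fun i => PMF.pure (y i ++ z i)) (s₁ + s₂ + 1) :=
  (append (m := m) (fun i w hw => by simp at hw; simp [hw, hy]) h₁ h₂).congr fun i => by
    simp [PMF.pure_map]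

theorem constBits (Γ : Env ι) (l : List Bool) : Impl Γ (fun _ => PMF.pure l) (3 * l.length) := by
  induction l with
  | nil => exact ret (Reads.nil Γ) (by simp)
  | cons b l ih =>
    have h1 : Impl Γ (fun _ => PMF.pure [b]) 2 :=
      ⟨⟨[.const b], [Γ.len]⟩, by simp [Circuit.size, Gate.size], fun i => by
        simp only [Circuit.eval, runGates, Gate.run, PMF.pure_bind, PMF.pure_map, List.map_cons,
          List.map_nil]
        have := wire_append_right (Γ.X i) [b] 0
        rw [Γ.length_X] at this
        rw [← add_zero Γ.len, this]
        simp [wire]⟩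
    refine ((appendPure (m := 1) (by simp) h1 ih).mono ?_).congr fun i => by simp
    simp; omega

end Impl

/-! ## Uniform distributions -/

@[simp]
theorem PMF.map_id_fun {α : Type*} (p : PMF α) : p.map (fun a => a) = p := p.map_id

section Uniform

variable {α β : Type} [Fintype α] [Nonempty α] [Fintype β] [Nonempty β]

theorem uniform_map_equiv (e : α ≃ β) :
    (PMF.uniformOfFintype α).map e = PMF.uniformOfFintype β := by
  ext b
  rw [PMF.map_apply, tsum_eq_single (e.symm b)]
  · simp [Fintype.card_congr e]
  · intro a ha
    rw [if_neg]
    rintro rfl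
    simp at ha

theorem uniform_bind_equiv {γ : Type} (e : α ≃ β) (f : β → PMF γ) :
    (PMF.uniformOfFintype α).bind (fun a => f (e a)) = (PMF.uniformOfFintype β).bind f := by
  rw [← uniform_map_equiv e, PMF.bind_map]
  rfl

theorem uniform_prod : PMF.uniformOfFintype (α × β) =
    (PMF.uniformOfFintype α).bind fun a => (PMF.uniformOfFintype β).map fun b => (a, b) := by
  ext ⟨a, b⟩
  rw [PMF.bind_apply, tsum_eq_single a]
  · rw [PMF.map_apply, tsum_eq_single b]
    · simp [ENNReal.mul_inv]
    · intro b' hb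
      rw [if_neg]
      simpa using hb.symm
  · intro a' ha
    rw [PMF.map_apply]
    simp [ha.symm]

theorem uniform_prod_bind {γ : Type} (f : α × β → PMF γ) :
    (PMF.uniformOfFintype (α × β)).bind f =
      (PMF.uniformOfFintype α).bind fun a => (PMF.uniformOfFintype β).bind fun b => f (a, b) := by
  simp [uniform_prod, PMF.bind_map, Function.comp_def]

theorem uniform_fin_succ_bind {γ : Type} (n : ℕ) (f : (Fin (n + 1) → α) → PMF γ) :
    (PMF.uniformOfFintype (Fin (n + 1) → α)).bind f =
      (PMF.uniformOfFintype α).bind fun a =>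
        (PMF.uniformOfFintype (Fin n → α)).bind fun v => f (Fin.cons a v) := by
  rw [← uniform_bind_equiv (Fin.consEquiv fun _ => α), uniform_prod_bind]
  rfl

theorem uniform_eval_bind {γ κ : Type} [Fintype κ] [DecidableEq κ] (k : κ) (f : α → PMF γ) :
    (PMF.uniformOfFintype (κ → α)).bind (fun y => f (y k)) = (PMF.uniformOfFintype α).bind f := by
  rw [← uniform_bind_equiv (Equiv.funSplitAt k α).symm, uniform_prod_bind]
  simp

theorem uniform_bool_pi_bind {γ : Type} (f : (Bool → α) → PMF γ) :
    (PMF.uniformOfFintype (Bool → α)).bind f =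
      (PMF.uniformOfFintype α).bind fun a => (PMF.uniformOfFintype α).bind fun b =>
        f (fun i => bif i then b else a) := by
  rw [← uniform_bind_equiv (Equiv.boolArrowEquivProd α).symm, uniform_prod_bind]
  congr 1; funext a; congr 1; funext b; congr 1; funext i
  cases i <;> rfl

end Uniform

/-- The concatenation of independent random strings. -/
def seqBits : List (PMF (List Bool)) → PMF (List Bool)
  | [] => PMF.pure []
  | p :: l => p.bind fun y => (seqBits l).map (y ++ ·)

theorem seqBits_append (l l' : List (PMF (List Bool))) :
    seqBits (l ++ l') = (seqBits l).bind fun y => (seqBits l').map (y ++ ·) := by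
  induction l with
  | nil => simp [seqBits]
  | cons p l ih =>
    simp only [List.cons_append, seqBits, ih, PMF.bind_bind, PMF.map_bind, PMF.map_comp,
      PMF.bind_map, Function.comp_def, List.append_assoc]

/-- The coordinates of a uniform vector are independent. This turns the joint choice of all
encryption exponents into independent blocks, which can be computed and replaced one at a time. -/
theorem uniform_map_flatten {α : Type} [Fintype α] [Nonempty α] (n : ℕ)
    (f : Fin n → α → List Bool) :
    (PMF.uniformOfFintype (Fin n → α)).map (fun y => (List.ofFn fun t => f t (y t)).flatten) =
      seqBits (List.ofFn fun t => (PMF.uniformOfFintype α).map (f t)) := by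
  induction n with
  | zero => simp [seqBits, show (fun _ : Fin 0 → α => ([] : List Bool)) = Function.const _ [] from rfl,
      PMF.map_const]
  | succ n ih =>
    have := uniform_fin_succ_bind n (α := α)
      fun y => PMF.pure (List.ofFn fun t => f t (y t)).flatten
    rw [show (PMF.uniformOfFintype (Fin (n + 1) → α)).map
      (fun y => (List.ofFn fun t => f t (y t)).flatten) = _ from this]
    simp only [List.ofFn_succ, seqBits, ← ih, PMF.bind_map, PMF.map_comp]
    rfl

/-! ## Elementary circuits -/

namespace Impl

variable {ι κ : Type} {Γ : Env ι} {y z : ι → List Bool} {F : ι → PMF (List Bool)} {s s₁ s₂ : ℕ}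

theorem xorBit {a b : ι → Bool} (ha : Reads Γ fun i => [a i]) (hb : Reads Γ fun i => [b i]) :
    Impl Γ (fun i => PMF.pure [Bool.xor (a i) (b i)]) 13 :=
  (ofCircuit ⟨[.nand 0 1, .nand 0 2, .nand 1 2, .nand 3 4], [5]⟩ (ha.append hb)).congr fun i => by
    simp only [Circuit.eval, runGates, Gate.run, PMF.pure_map, PMF.pure_bind]
    cases a i <;> cases b i <;> rfl

theorem muxBit {c a b : ι → Bool} (hc : Reads Γ fun i => [c i]) (ha : Reads Γ fun i => [a i])
    (hb : Reads Γ fun i => [b i]) :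
    Impl Γ (fun i => PMF.pure [if c i then a i else b i]) 13 :=
  (ofCircuit ⟨[.nand 0 0, .nand 0 1, .nand 3 2, .nand 4 5], [6]⟩
    ((hc.append ha).append hb)).congr fun i => by
    simp only [Circuit.eval, runGates, Gate.run, PMF.pure_map, PMF.pure_bind]
    cases c i <;> cases a i <;> cases b i <;> rfl

/-- Add the equality test of two further bits to a Boolean. -/
theorem andEqBit {c a b : ι → Bool} (hc : Reads Γ fun i => [c i]) (ha : Reads Γ fun i => [a i])
    (hb : Reads Γ fun i => [b i]) :
    Impl Γ (fun i => PMF.pure [c i && (a i == b i)]) 22 :=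
  -- Wire 6 is the exclusive or of the two bits, and wire 7 its negation.
  (ofCircuit ⟨[.nand 1 2, .nand 1 3, .nand 2 3, .nand 4 5, .nand 6 6, .nand 7 0, .nand 8 8], [9]⟩
    ((hc.append ha).append hb)).congr fun i => by
    simp only [Circuit.eval, runGates, Gate.run, PMF.pure_map, PMF.pure_bind]
    cases c i <;> cases a i <;> cases b i <;> rfl

/-- A string that is computed bit by bit. -/
theorem bitwise {f : ι → ℕ → Bool} {k : ℕ} (m : ℕ)
    (h : ∀ j < m, Impl Γ (fun i => PMF.pure [f i j]) k) :
    Impl Γ (fun i => PMF.pure ((List.range m).map (f i))) (m * (k + 1)) := by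
  induction m with
  | zero => simpa using ret (Reads.nil Γ) (m := 0) (by simp)
  | succ m ih =>
    refine ((appendPure (m := m) (by simp) (ih fun j hj => h j (by omega)) (h m (by omega))).mono
      (le_of_eq (by ring))).congr fun i => ?_
    simp [List.range_succ]

theorem _root_.map_range_wire {l : List Bool} {m : ℕ} (h : l.length = m) :
    (List.range m).map (fun j => wire l j) = l := by
  subst h
  exact map_wire_range l

theorem mux {c : ι → Bool} {m : ℕ} (hc : Reads Γ fun i => [c i]) (hy : Reads Γ y)
    (hz : Reads Γ z) (hym : ∀ i, (y i).length = m) (hzm : ∀ i, (z i).length = m) :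
    Impl Γ (fun i => PMF.pure (if c i then y i else z i)) (14 * m) := by
  refine ((bitwise (f := fun i j => if c i then wire (y i) j else wire (z i) j) m fun j hj =>
    muxBit hc (hy.bit fun i => (hym i).symm ▸ hj) (hz.bit fun i => (hzm i).symm ▸ hj)).mono
    (le_of_eq (by ring))).congr fun i => ?_
  cases hci : c i <;> simp [map_range_wire (hym i), map_range_wire (hzm i)]

theorem eqBits {m : ℕ} (hy : Reads Γ y) (hz : Reads Γ z) (hym : ∀ i, (y i).length = m)
    (hzm : ∀ i, (z i).length = m) :
    Impl Γ (fun i => PMF.pure [decide (y i = z i)]) (23 * m + 3) := by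
  -- The comparison is accumulated over prefixes, at 22 units and one composition per bit; the 3
  -- pays for the initial constant `true`.
  have key : ∀ k ≤ m, Impl Γ (fun i => PMF.pure [decide ((y i).take k = (z i).take k)])
      (23 * k + 3) := by
    intro k
    induction k with
    | zero => exact fun _ => (constBits Γ [true]).congr fun i => by simp
    | succ k ih =>
      intro hk
      refine ((letE (m := 1) (by simp) (ih (by omega)) (andEqBit Reads.last
        (Reads.snoc (hy.bit (j := k) fun i => by rw [hym]; omega))
        (Reads.snoc (hz.bit (j := k) fun i => by rw [hzm]; omega)))).mono (by omega)).congr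
        fun i => ?_
      have h1 : k < (y i).length := by rw [hym]; omega
      have h2 : k < (z i).length := by rw [hzm]; omega
      rw [List.take_succ_eq_append_getElem h1, List.take_succ_eq_append_getElem h2,
        wire_eq_getElem h1, wire_eq_getElem h2]
      congr 2
      rw [Bool.eq_iff_iff]
      simp only [Bool.and_eq_true, decide_eq_true_eq, beq_iff_eq]
      constructor
      · rintro ⟨h, h'⟩; rw [h, h']
      · intro h
        have := List.append_inj h (by simp [hym, hzm])
        simpa using this
  exact (key m le_rfl).congr fun i => by
    rw [List.take_of_length_le (hym i).le, List.take_of_length_le (hzm i).le]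

theorem xorStr {n : ℕ} {u m : ι → Str n} (hu : Reads Γ fun i => List.ofFn (u i))
    (hm : Reads Γ fun i => List.ofFn (m i)) :
    Impl Γ (fun i => PMF.pure (List.ofFn ((u i).xor (m i)))) (17 * n) := by
  refine ((bitwise (k := 13) (f := fun i j => if h : j < n then Bool.xor (u i ⟨j, h⟩) (m i ⟨j, h⟩)
    else false) n fun j hj => ?_).mono (by omega)).congr fun i => ?_
  · refine (xorBit (hu.bit (j := j) fun i => by simpa using hj)
      (hm.bit (j := j) fun i => by simpa using hj)).congr fun i => ?_
    simp [hj, wire]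
  · congr 1
    exact List.ext_getElem (by simp) fun j h1 h2 => by simp at h1; simp [Str.xor, h1]

/-- Independent random strings, each computed by a circuit. -/
theorem seq {P : List ((ι → PMF (List Bool)) × ℕ)} {k : ℕ}
    (hm : ∀ p ∈ P, ∀ i, ∀ y ∈ (p.1 i).support, y.length = p.2) (h : ∀ p ∈ P, Impl Γ p.1 k) :
    Impl Γ (fun i => seqBits (P.map fun p => p.1 i)) (P.length * (k + 1)) := by
  induction P with
  | nil => simpa [seqBits] using ret (Reads.nil Γ) (m := 0) (by simp)
  | cons p P ih =>
    refine ((append (hm p (by simp)) (h p (by simp)) (ih (fun q hq => hm q (by simp [hq]))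
      fun q hq => h q (by simp [hq]))).mono (le_of_eq (by simp; ring))).congr fun i => ?_
    simp [seqBits]

theorem coin (Γ : Env ι) : Impl Γ (fun _ => (PMF.uniformOfFintype Bool).map fun b => [b]) 2 :=
  (ofCircuit ⟨[.coin], [0]⟩ (Reads.nil Γ)).congr fun i => by
    simp [Circuit.eval, runGates, Gate.run, PMF.map_comp, wire, Function.comp_def]

theorem coins (Γ : Env ι) (n : ℕ) :
    Impl Γ (fun _ => (PMF.uniformOfFintype (Str n)).map fun u => List.ofFn u) (3 * n) := by
  refine ((seq (P := List.ofFn fun _ : Fin n => (fun _ => (PMF.uniformOfFintype Bool).map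
    fun b => [b], 1)) (k := 2) ?_ ?_).mono (by simp; omega)).congr fun i => ?_
  · simp only [List.mem_ofFn]
    rintro _ ⟨_, rfl⟩ i y hy
    simp at hy
    rcases hy with rfl | rfl <;> rfl
  · simp only [List.mem_ofFn]
    rintro _ ⟨_, rfl⟩
    exact coin Γ
  · have := uniform_map_flatten n (α := Bool) fun _ b => [b]
    rw [List.map_ofFn]
    refine this.symm.trans ?_
    congr 1
    funext u
    clear this
    induction n with
    | zero => rfl
    | succ n ih => rw [List.ofFn_succ, List.ofFn_succ, ← ih]; rfl

theorem oracleCall {m : ℕ} (hy : Reads Γ y) (hm : ∀ i, (y i).length = m) :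
    Impl Γ (fun i => PMF.pure (Γ.O i (y i))) (m + 1 + Γ.ansLen) := by
  refine ((ofCircuit ⟨[.oracle (List.range m)], (List.range Γ.ansLen).map (m + ·)⟩ hy).mono
    (by simp [Circuit.size, Gate.size]; omega)).congr fun i => ?_
  have h1 : (List.range m).map (wire (y i)) = y i := map_range_wire (hm i)
  have h2 : (List.range Γ.ansLen).map (fun j => wire (Γ.O i (y i)) j) = Γ.O i (y i) :=
    map_range_wire (Γ.length_O i _)
  simp only [Circuit.eval, runGates, Gate.run, PMF.pure_bind, PMF.pure_map, List.map_map,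
    Function.comp_def, ← hm i, wire_append_right]
  rw [hm i, h1, h2]

theorem _root_.run_sample {O : List Bool → List Bool} {w : List Bool} {ws : List ℕ} {k : ℕ} [NeZero k]
    (h : bitsToNat (ws.map (wire w)) = k) : (Gate.sample ws).run O w =
      (PMF.uniformOfFintype (Fin k)).map fun a : Fin k => natToBits ws.length a.val := by
  cases k with
  | zero => exact absurd rfl (NeZero.ne 0)
  | succ k =>
    simp only [Gate.run, h]
    exact PMF.map_comp _ _ _

theorem sampleNat {p : ι → ℕ} [∀ i, NeZero (p i)] {m : ℕ} (hy : Reads Γ y)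
    (hm : ∀ i, (y i).length = m) (hp : ∀ i, bitsToNat (y i) = p i) :
    Impl Γ (fun i => (PMF.uniformOfFintype (Fin (p i))).map fun a : Fin (p i) =>
      natToBits m a.val) (2 * m + 1) := by
  refine ((ofCircuit ⟨[.sample (List.range m)], (List.range m).map (m + ·)⟩ hy).mono
    (by simp [Circuit.size, Gate.size]; omega)).congr fun i => ?_
  have h1 : (List.range m).map (wire (y i)) = y i := map_range_wire (hm i)
  have h2 : ∀ l : List Bool, l.length = m →
      (List.range m).map (fun j => wire (y i ++ l) (m + j)) = l := fun l hl => by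
    conv_rhs => rw [← map_range_wire hl]
    refine List.map_congr_left fun j _ => ?_
    rw [← hm i, wire_append_right]
  simp only [Circuit.eval, runGates, run_sample (h1.symm ▸ hp i), PMF.map_bind, PMF.bind_map,
    PMF.pure_map, List.map_map, Function.comp_def, List.length_range,
    h2 _ (show (natToBits m _).length = m by simp [natToBits])]
  rfl

end Impl

/-! ## Lazily sampled oracles -/

/-- The value at `q` of the association list `T`, with default value `a`. -/
def lookupOr : List (List Bool × List Bool) → List Bool → List Bool → List Bool
  | [], _, a => a
  | (q', a') :: T, q, a => if q = q' then a' else lookupOr T q a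

/-- Run gates with an oracle whose answers, of `n` bits, are sampled at the first query and then
kept in a table. -/
def lazyRun (n : ℕ) : List Gate → List (List Bool × List Bool) → List Bool → PMF (List Bool)
  | [], _, w => PMF.pure w
  | .oracle ws :: gs, T, w =>
      (PMF.uniformOfFintype (Str n)).bind fun a =>
        let ans := lookupOr T (ws.map (wire w)) (List.ofFn a)
        lazyRun n gs ((ws.map (wire w), ans) :: T) (w ++ ans)
  | g :: gs, T, w => (g.run noOracle w).bind fun new => lazyRun n gs T (w ++ new)

/-- The output distribution of a circuit with a lazily sampled oracle. -/
def Circuit.lazyEval (n : ℕ) (c : Circuit) (x : List Bool) : PMF (List Bool) :=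
  (lazyRun n c.gates [] x).map fun w => c.outs.map (wire w)

theorem length_lookupOr {n : ℕ} {T : List (List Bool × List Bool)} (hT : ∀ p ∈ T, p.2.length = n)
    (q : List Bool) {a : List Bool} (ha : a.length = n) : (lookupOr T q a).length = n := by
  induction T with
  | nil => exact ha
  | cons p T ih =>
    simp only [lookupOr]
    split_ifs
    · exact hT p (by simp)
    · exact ih fun r hr => hT r (by simp [hr])

/-! ### Circuits that simulate a lazily sampled oracle -/

namespace Impl

variable {ι κ : Type} {Γ : Env ι} {y z : ι → List Bool} {F : ι → PMF (List Bool)} {s s₁ s₂ : ℕ}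

/-- Sequential composition, for a first step that returns a bit string. -/
theorem bindBits {P : ι → PMF (List Bool)} {m : ℕ} {G : ι → List Bool → PMF (List Bool)}
    (hP : ∀ i, ∀ y ∈ (P i).support, y.length = m) (h₁ : Impl Γ P s₁)
    (h₂ : Impl (Γ.ext (κ := fun _ => {l : List Bool // l.length = m}) (fun _ l => l.1) m
      fun _ l => l.2) (fun j => G j.1 j.2.1) s₂) :
    Impl Γ (fun i => (P i).bind (G i)) (s₁ + s₂ + 1) := by
  let fixLen : List Bool → {l : List Bool // l.length = m} := fun y =>
    if h : y.length = m then ⟨y, h⟩ else ⟨List.replicate m false, by simp⟩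
  have hfix : ∀ i, ∀ y ∈ (P i).support, (fixLen y).1 = y := fun i y hy => by
    simp [fixLen, hP i y hy]
  have h := bind (Γ := Γ) (κ := fun _ => {l : List Bool // l.length = m})
    (P := fun i => (P i).map fixLen) (e := fun _ l => l.1) (he := fun _ l => l.2)
    (G := fun i l => G i l.1) (s₁ := s₁) (h₁.congr fun i => ?_) h₂
  · refine h.congr fun i => ?_
    rw [PMF.bind_map]
    exact PMF.bind_congr_support _ fun y hy => by simp [hfix i y hy]
  · rw [PMF.map_comp]
    exact ((PMF.map_congr_support (P i) (g := fun y => y) (hfix i)).trans (PMF.map_id_fun _)).symm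

/-- The table of an oracle, given by functions of the hidden index. -/
def _root_.tableAt (T : List ((ι → List Bool) × (ι → List Bool))) (i : ι) :
    List (List Bool × List Bool) := T.map fun p => (p.1 i, p.2 i)

/-- One equality test and one multiplexer per table entry. The summand 5 is the 3 of the test plus
two compositions. -/
theorem lookupOr {n m : ℕ} {T : List ((ι → List Bool) × (ι → List Bool))}
    (hT : ∀ p ∈ T, Reads Γ p.1 ∧ Reads Γ p.2 ∧ ∀ i, (p.2 i).length = n)
    (hy : Reads Γ y) (hz : Reads Γ z) (hym : ∀ i, (y i).length = m)
    (hzn : ∀ i, (z i).length = n) :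
    Impl Γ (fun i => PMF.pure (lookupOr (tableAt T i) (y i) (z i)))
      (T.length * (23 * m + 14 * n + 5) + n) := by
  induction T with
  | nil => exact ((ret hz hzn).mono (by simp)).congr fun i => by simp [tableAt, _root_.lookupOr]
  | cons p T ih =>
    have ih' := ih fun r hr => hT r (by simp [hr])
    obtain ⟨h1, h2, h3⟩ := hT p (by simp)
    -- The lengths of readable strings do not depend on the hidden index. An entry of another length
    -- therefore never matches, and no gate is spent on it.
    by_cases hm : ∀ i, (p.1 i).length = m
    · have hl : ∀ i, (_root_.lookupOr (tableAt T i) (y i) (z i)).length = n := fun i =>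
        length_lookupOr (fun r hr => by
          obtain ⟨r', hr', rfl⟩ := List.mem_map.1 hr
          exact (hT r' (by simp [hr'])).2.2 i) _ (hzn i)
      refine ((letE hl ih' (letE (m := 1) (by simp) (eqBits hy.snoc h1.snoc hym hm)
        (mux (Reads.last (z := fun i => [decide (y i = p.1 i)])) h2.snoc.snoc Reads.last.snoc
          h3 hl))).mono ?_).congr fun i => ?_
      · simp only [List.length_cons, add_mul]
        omega
      · simp [tableAt, _root_.lookupOr]
    · refine (ih'.mono ?_).congr fun i => ?_
      · simp only [List.length_cons, add_mul]
        omega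
      · have : y i ≠ p.1 i := fun h => hm fun j => by rw [h1.length_eq j i, ← h, hym]
        simp [tableAt, _root_.lookupOr, this]

theorem gate {N : ℕ} {O : List Bool → List Bool} {ℓ : ℕ} (hO : ∀ q, (O q).length = ℓ)
    (hy : Reads Γ y) (hN : ∀ i, (y i).length = N) (g : Gate)
    (hg : ∀ i, g.run (Γ.O i) (y i) = g.run O (y i)) :
    Impl Γ (fun i => g.run O (y i)) (g.size + g.width ℓ) := by
  refine ((ofCircuit ⟨[g], (List.range (g.width ℓ)).map (N + ·)⟩ hy).mono
    (by simp [Circuit.size])).congr fun i => ?_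
  simp only [Circuit.eval, runGates, PMF.map_bind, PMF.pure_map, hg]
  conv_rhs => rw [← PMF.bind_pure (g.run O (y i))]
  refine PMF.bind_congr_support _ fun new hnew => ?_
  congr 1
  rw [← Gate.length_run hO hnew, ← hN i, List.map_map]
  simp only [Function.comp_def, wire_append_right]
  exact map_wire_range new

/-- The table is kept on wires: each entry is a pair of readable functions of the hidden index, and
the index grows by the coins of each gate. At most one entry is added per gate, so `L` bounds the
table throughout and each gate costs at most one scan of it. -/
theorem lazyRun {n : ℕ} {S : ℕ} (outs : List ℕ) (gs : List Gate) :
    ∀ {ι : Type} {Γ : Env ι} {w : ι → List Bool} {N : ℕ}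
      {T : List ((ι → List Bool) × (ι → List Bool))} {L : ℕ},
      Reads Γ w → (∀ i, (w i).length = N) →
      (∀ p ∈ T, Reads Γ p.1 ∧ Reads Γ p.2 ∧ ∀ i, (p.2 i).length = n) →
      (∀ g ∈ gs, g.size ≤ S) → T.length + gs.length ≤ L →
      Impl Γ (fun i => (lazyRun n gs (tableAt T i) (w i)).map fun w' => outs.map (wire w'))
        (gs.length * (L * (23 * S + 14 * n + 5) + 4 * n + 2 * S + 10) + outs.length) := by
  induction gs with
  | nil =>
    intro ι Γ w N T L hw hwN hT hS hL
    exact ((ofCircuit ⟨[], outs⟩ hw).mono (by simp [Circuit.size])).congr fun i => by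
      simp [Circuit.eval, runGates, _root_.lazyRun, PMF.pure_map]
  | cons g gs ih =>
    intro ι Γ w N T L hw hwN hT hS hL
    simp only [List.length_cons] at hL
    have hgS := hS g (by simp)
    -- All gates other than oracle gates are treated alike: they behave the same with any oracle, so
    -- their width may be computed for answers of length 0.
    have hother : (∀ T w, _root_.lazyRun n (g :: gs) T w =
        (g.run noOracle w).bind fun new => _root_.lazyRun n gs T (w ++ new)) →
        (∀ i, g.run (Γ.O i) (w i) = g.run noOracle (w i)) → g.width 0 ≤ g.size →
        Impl Γ (fun i => (_root_.lazyRun n (g :: gs) (tableAt T i) (w i)).map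
          fun w' => outs.map (wire w'))
        ((gs.length + 1) * (L * (23 * S + 14 * n + 5) + 4 * n + 2 * S + 10) + outs.length) := by
      intro h1 h2 h3
      refine ((bindBits (m := g.width 0) (fun i y hy => Gate.length_run (O := noOracle)
        (fun _ => rfl) hy) (gate (O := noOracle) (ℓ := 0) (fun _ => rfl) hw hwN g h2)
        (G := fun i new => (_root_.lazyRun n gs (tableAt T i) (w i ++ new)).map
          fun w' => outs.map (wire w')) ((ih (T := T.map fun p =>
            (fun j => p.1 j.1, fun j => p.2 j.1)) (N := N + g.width 0) (L := L)
            (hw.ext.append Reads.extLast) ?_ ?_ (fun g' hg' => hS g' (by simp [hg']))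
            (by simp; omega)).congr fun j => ?_)).mono ?_).congr fun i => ?_
      · intro j
        simp [hwN, j.2.2]
      · intro p hp
        obtain ⟨r, hr, rfl⟩ := List.mem_map.1 hp
        obtain ⟨h4, h5, h6⟩ := hT r hr
        exact ⟨h4.ext, h5.ext, fun j => h6 j.1⟩
      · simp [tableAt, Function.comp_def]
      · rw [add_mul]
        omega
      · rw [h1, PMF.map_bind]
    cases g with
    | oracle ws =>
      clear hother
      simp only [Gate.size] at hgS
      have hq : Impl Γ (fun i => PMF.pure (ws.map (wire (w i)))) S :=
        ((ofCircuit ⟨[], ws⟩ hw).mono (by simp [Circuit.size]; omega)).congr fun i => by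
          simp [Circuit.eval, runGates, PMF.pure_map]
      have hT2 : ∀ (i : ι), ∀ p ∈ tableAt T i, p.2.length = n := fun i p hp => by
        obtain ⟨r, hr, rfl⟩ := List.mem_map.1 hp
        exact (hT r hr).2.2 i
      refine ((letE (m := ws.length) (by simp) hq (bind (m := n) (coins _ n) (he := fun _ _ => by simp)
        (G := fun i a => (_root_.lazyRun n gs ((ws.map (wire (w i)),
          _root_.lookupOr (tableAt T i) (ws.map (wire (w i))) (List.ofFn a)) :: tableAt T i)
          (w i ++ _root_.lookupOr (tableAt T i) (ws.map (wire (w i))) (List.ofFn a))).map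
          fun w' => outs.map (wire w'))
        (letE (y := fun j => _root_.lookupOr (tableAt T j.1) (ws.map (wire (w j.1))) (List.ofFn j.2))
          (m := n) (fun j => length_lookupOr (hT2 j.1) _ (by simp))
          ((lookupOr (n := n) (T := T.map fun p => (fun j => p.1 j.1, fun j => p.2 j.1)) (m := ws.length)
            ?_ Reads.last.ext Reads.extLast (by simp) (by simp)).congr fun j => ?_)
          ((ih (T := (fun j => ws.map (wire (w j.1)), fun j => _root_.lookupOr (tableAt T j.1)
            (ws.map (wire (w j.1))) (List.ofFn j.2)) ::
              T.map fun p => (fun j => p.1 j.1, fun j => p.2 j.1)) (N := N + n) (L := L)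
            (hw.snoc.ext.snoc.append Reads.last) ?_ ?_
            (fun g' hg' => hS g' (by simp [hg'])) (by simp; omega)).congr fun j => ?_)))).mono
          ?_).congr fun i => ?_
      · intro p hp
        obtain ⟨r, hr, rfl⟩ := List.mem_map.1 hp
        obtain ⟨h4, h5, h6⟩ := hT r hr
        exact ⟨h4.snoc.ext, h5.snoc.ext, fun j => h6 j.1⟩
      · simp [tableAt, Function.comp_def]
      · intro j
        simp [hwN, length_lookupOr (hT2 j.1)]
      · intro p hp
        rcases List.mem_cons.1 hp with rfl | hp
        · exact ⟨Reads.last.ext.snoc, Reads.last, fun j => length_lookupOr (hT2 j.1) _ (by simp)⟩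
        · obtain ⟨r, hr, rfl⟩ := List.mem_map.1 hp
          obtain ⟨h4, h5, h6⟩ := hT r hr
          exact ⟨h4.snoc.ext.snoc, h5.snoc.ext.snoc, fun j => h6 j.1⟩
      · simp [tableAt, Function.comp_def]
      · have h1 : T.length * (23 * ws.length + 14 * n + 5) ≤ L * (23 * S + 14 * n + 5) :=
          Nat.mul_le_mul (by omega) (by omega)
        simp only [List.length_cons, List.length_map, add_mul] at h1 ⊢
        omega
      · simp only [_root_.lazyRun, PMF.map_bind]
    | const b => exact hother (fun _ _ => rfl) (fun _ => rfl) (by simp [Gate.width, Gate.size])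
    | nand a b => exact hother (fun _ _ => rfl) (fun _ => rfl) (by simp [Gate.width, Gate.size])
    | coin => exact hother (fun _ _ => rfl) (fun _ => rfl) (by simp [Gate.width, Gate.size])
    | sample ws => exact hother (fun _ _ => rfl) (fun _ => rfl) (by simp [Gate.width, Gate.size])

end Impl

theorem Gate.one_le_size (g : Gate) : 1 ≤ g.size := by
  cases g <;> simp [Gate.size]

theorem length_le_sum_size (gs : List Gate) : gs.length ≤ (gs.map Gate.size).sum := by
  induction gs with
  | nil => simp
  | cons g gs ih => have := g.one_le_size; simp; omega

theorem size_le_sum_size {gs : List Gate} {g : Gate} (hg : g ∈ gs) :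
    g.size ≤ (gs.map Gate.size).sum :=
  List.le_sum_of_mem (List.mem_map.2 ⟨g, hg, rfl⟩)

/-- A bound on the cost of the simulation of a circuit of size `S` together with its oracle. -/
def lazySize (n S : ℕ) : ℕ := S * (S * (23 * S + 14 * n + 5) + 4 * n + 2 * S + 10) + S

theorem Impl.lazyEval {ι : Type} {Γ : Env ι} {y : ι → List Bool} {N n S : ℕ} (hy : Reads Γ y)
    (hN : ∀ i, (y i).length = N) (c : Circuit) (hc : c.size ≤ S) :
    Impl Γ (fun i => c.lazyEval n (y i)) (lazySize n S) := by
  have h1 := length_le_sum_size c.gates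
  have h2 : ∀ g ∈ c.gates, g.size ≤ S := fun g hg =>
    (size_le_sum_size hg).trans (by simp only [Circuit.size] at hc; omega)
  simp only [Circuit.size] at hc
  refine ((Impl.lazyRun (n := n) (S := S) c.outs c.gates (T := []) (L := S) hy hN (by simp) h2
    (by simp; omega)).mono ?_).congr fun i => rfl
  exact Nat.add_le_add (Nat.mul_le_mul_right _ (by omega)) (by omega)

/-! ## The random oracle -/

section RandomOracle

open scoped ENNReal

variable {sig : ℕ}

instance isProbabilityMeasure_randomOracle : IsProbabilityMeasure (randomOracle sig) := by
  unfold randomOracle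
  infer_instance

/-- Resampling the value of a random oracle at one point gives a random oracle. -/
theorem randomOracle_map_update (q : List Bool) :
    ((randomOracle sig).prod (PMF.uniformOfFintype (Str sig)).toMeasure).map
      (fun p => Function.update p.1 q p.2) = randomOracle sig := by
  refine Measure.eq_infinitePi _ fun s t ht => ?_
  have hbox : ∀ s : Finset (List Bool), MeasurableSet (Set.pi s t) := fun s =>
    MeasurableSet.pi s.countable_toSet fun i _ => ht i
  rw [Measure.map_apply measurable_update' (hbox s)]
  have hpi : ∀ s : Finset (List Bool), randomOracle sig (Set.pi s t) =
      ∏ i ∈ s, (PMF.uniformOfFintype (Str sig)).toMeasure (t i) := fun s =>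
    Measure.infinitePi_pi _ fun i _ => ht i
  -- The measure of a box is a product over its finitely many coordinates. If `q` is among them, its
  -- factor is supplied by the fresh value; otherwise the fresh value has no influence.
  by_cases hq : q ∈ s
  · have : (fun p : Hash sig × Str sig => Function.update p.1 q p.2) ⁻¹' Set.pi s t =
        Set.pi (s.erase q : Finset (List Bool)) t ×ˢ t q := by
      ext ⟨H, a⟩
      simp only [Set.mem_preimage, Set.mem_pi, Set.mem_prod, Finset.coe_erase, Set.mem_sdiff,
        Finset.mem_coe, Set.mem_singleton_iff, and_imp]
      constructor
      · intro h
        exact ⟨fun i hi hiq => by simpa [hiq] using h i hi, by simpa using h q hq⟩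
      · rintro ⟨h1, h2⟩ i hi
        by_cases hiq : i = q
        · subst hiq; simpa using h2
        · simpa [hiq] using h1 i hi hiq
    rw [this, Measure.prod_prod, hpi, Finset.prod_erase_mul _ _ hq]
  · have : (fun p : Hash sig × Str sig => Function.update p.1 q p.2) ⁻¹' Set.pi s t =
        Set.pi s t ×ˢ Set.univ := by
      ext ⟨H, a⟩
      simp only [Set.mem_preimage, Set.mem_pi, Set.mem_prod, Finset.mem_coe, Set.mem_univ, and_true]
      refine forall₂_congr fun i hi => ?_
      rw [Function.update_of_ne fun h : i = q => hq (h ▸ hi)]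
    rw [this, Measure.prod_prod, hpi]
    simp

theorem lintegral_update_randomOracle (q : List Bool) {f : Hash sig → ℝ≥0∞} (hf : Measurable f) :
    ∫⁻ H, f H ∂(randomOracle sig) = ∑' a, PMF.uniformOfFintype (Str sig) a *
      ∫⁻ H, f (Function.update H q a) ∂(randomOracle sig) := by
  conv_lhs => rw [← randomOracle_map_update q]
  have hf' : Measurable fun p : Hash sig × Str sig => f (Function.update p.1 q p.2) :=
    hf.comp measurable_update'
  rw [lintegral_map hf measurable_update', lintegral_prod_symm' _ hf', lintegral_countable']
  simp [mul_comm]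

/-- The value at `q` ranges over a finite set, so measurability in the oracle may be checked for
each value separately. This is what makes runs with adaptive queries measurable. -/
theorem measurable_eval_hash (q : List Bool) {f : Str sig → Hash sig → ℝ≥0∞}
    (hf : ∀ a, Measurable (f a)) : Measurable fun H : Hash sig => f (H q) H := by
  have : Measurable fun p : Hash sig × Str sig => f p.2 p.1 :=
    measurable_from_prod_countable_left hf
  exact this.comp (measurable_id.prodMk (measurable_pi_apply q))

theorem measurable_bind_apply {α β Ω : Type} [MeasurableSpace Ω] [Countable α] (p : PMF α)
    {f : Ω → α → PMF β} {b : β} (hf : ∀ a, Measurable fun H => f H a b) :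
    Measurable fun H => (p.bind (f H)) b := by
  simp only [PMF.bind_apply]
  exact Measurable.tsum fun a => (hf a).const_mul _

theorem lintegral_bind_apply {α β Ω : Type} [MeasurableSpace Ω] [Countable α] (μ : Measure Ω)
    (p : PMF α) {f : Ω → α → PMF β} {b : β} (hf : ∀ a, Measurable fun H => f H a b) :
    ∫⁻ H, (p.bind (f H)) b ∂μ = ∑' a, p a * ∫⁻ H, f H a b ∂μ := by
  simp only [PMF.bind_apply]
  rw [lintegral_tsum fun a => ((hf a).const_mul _).aemeasurable]
  exact tsum_congr fun a => lintegral_const_mul _ (hf a)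

/-- The hash function as an oracle, with the values in the table `T` replaced. -/
def Hash.override (T : List (List Bool × List Bool)) (H : Hash sig) : List Bool → List Bool :=
  fun q => lookupOr T q (H.oracle q)

theorem Gate.run_eq_noOracle {g : Gate} (hg : ∀ ws, g ≠ .oracle ws)
    (O : List Bool → List Bool) (w : List Bool) : g.run O w = g.run noOracle w := by
  cases g with
  | oracle ws => exact absurd rfl (hg ws)
  | _ => rfl

theorem lazyRun_cons {n : ℕ} {g : Gate} (hg : ∀ ws, g ≠ .oracle ws) (gs : List Gate)
    (T : List (List Bool × List Bool)) (w : List Bool) :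
    lazyRun n (g :: gs) T w = (g.run noOracle w).bind fun new => lazyRun n gs T (w ++ new) := by
  cases g with
  | oracle ws => exact absurd rfl (hg ws)
  | _ => rfl

theorem measurable_runGates_override (gs : List Gate) (T : List (List Bool × List Bool))
    (w v : List Bool) : Measurable fun H : Hash sig => runGates (H.override T) gs w v := by
  induction gs generalizing w with
  | nil => exact measurable_const
  | cons g gs ih =>
    by_cases hg : ∃ ws, g = .oracle ws
    · obtain ⟨ws, rfl⟩ := hg
      simp only [runGates, Gate.run, PMF.pure_bind]
      exact measurable_eval_hash (ws.map (wire w))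
        (f := fun a H => runGates (H.override T) gs
          (w ++ lookupOr T (ws.map (wire w)) (List.ofFn a)) v) fun a => ih _
    · push Not at hg
      simp only [runGates, Gate.run_eq_noOracle hg (Hash.override T _)]
      exact measurable_bind_apply _ fun new => ih _

/-- Entries already in `T` take precedence, so the new value counts only if `q` has not been asked
before. This is exactly the update rule of lazy sampling. -/
theorem Hash.override_update (T : List (List Bool × List Bool)) (H : Hash sig) (q : List Bool)
    (a : Str sig) : Hash.override T (Function.update H q a) =
      Hash.override ((q, lookupOr T q (List.ofFn a)) :: T) H := by
  funext q'
  simp only [Hash.override, lookupOr, Hash.oracle]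
  by_cases h : q' = q
  · subst h; simp
  · simp [h]

/-- Running gates with a random oracle amounts to lazy sampling. -/
theorem lintegral_runGates_override (gs : List Gate) (T : List (List Bool × List Bool))
    (w v : List Bool) :
    ∫⁻ H : Hash sig, runGates (H.override T) gs w v ∂(randomOracle sig) = lazyRun sig gs T w v := by
  induction gs generalizing w T with
  | nil => simp [runGates, lazyRun]
  | cons g gs ih =>
    by_cases hg : ∃ ws, g = .oracle ws
    · obtain ⟨ws, rfl⟩ := hg
      -- The oracle is resampled at the present query just before it is read. The fresh value plays
      -- the part of the lazily drawn answer, and the remaining gates see it as a table entry.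
      rw [lintegral_update_randomOracle (ws.map (wire w)) (measurable_runGates_override _ _ _ _)]
      simp only [runGates, Gate.run, PMF.pure_bind, lazyRun, PMF.bind_apply]
      refine tsum_congr fun a => ?_
      rw [← ih]
      simp only [Hash.override_update]
      simp [Hash.override, lookupOr]
    · push Not at hg
      rw [lazyRun_cons hg]
      simp only [runGates, Gate.run_eq_noOracle hg (Hash.override T _)]
      rw [lintegral_bind_apply _ _ fun new => measurable_runGates_override _ _ _ _, PMF.bind_apply]
      simp only [ih]

theorem Hash.override_nil (H : Hash sig) : H.override [] = H.oracle := rfl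

theorem measurable_eval (c : Circuit) (x v : List Bool) :
    Measurable fun H : Hash sig => c.eval H.oracle x v := by
  simp only [Circuit.eval, ← PMF.bind_pure_comp, PMF.bind_apply]
  exact Measurable.tsum fun w =>
    (measurable_runGates_override c.gates [] x w).mul_const _

theorem lintegral_eval (c : Circuit) (x v : List Bool) :
    ∫⁻ H : Hash sig, c.eval H.oracle x v ∂(randomOracle sig) = c.lazyEval sig x v := by
  simp only [Circuit.eval, Circuit.lazyEval, ← PMF.bind_pure_comp, PMF.bind_apply,
    ← Hash.override_nil]
  rw [lintegral_tsum fun w =>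
    ((measurable_runGates_override c.gates [] x w).mul_const _).aemeasurable]
  refine tsum_congr fun w => ?_
  rw [← lintegral_runGates_override, ← lintegral_mul_const _
    (measurable_runGates_override c.gates [] x w)]

/-! ## Oracle queries -/

/-- The oracle query of a gate, as a circuit. -/
def Gate.queries : Gate → List Circuit
  | .oracle ws => [⟨[], ws⟩]
  | _ => []

/-- The circuits that compute the successive oracle queries of a list of gates. -/
def queryCircuits : List Gate → List Circuit
  | [] => []
  | g :: gs => g.queries ++
      (queryCircuits gs).map fun c => ⟨g :: c.gates, c.outs⟩

/-- The expected number of queries to `q`. -/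
def queryCount (O : List Bool → List Bool) (q : List Bool) (gs : List Gate) (w : List Bool) :
    ℝ≥0∞ := ((queryCircuits gs).map fun c => c.eval O w q).sum

theorem length_queryCircuits (gs : List Gate) : (queryCircuits gs).length ≤ gs.length := by
  induction gs with
  | nil => simp [queryCircuits]
  | cons g gs ih => cases g <;> simp [queryCircuits, Gate.queries] <;> omega

theorem size_queryCircuits {gs : List Gate} {c : Circuit} (hc : c ∈ queryCircuits gs) :
    c.size ≤ (gs.map Gate.size).sum := by
  induction gs generalizing c with
  | nil => simp [queryCircuits] at hc
  | cons g gs ih =>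
    simp only [queryCircuits, List.mem_append, List.mem_map] at hc
    rcases hc with hc | ⟨c, hc, rfl⟩
    · cases g <;> simp [Gate.queries] at hc
      subst hc
      simp [Circuit.size, Gate.size]
      omega
    · have := ih hc
      simp only [Circuit.size, List.map_cons, List.sum_cons] at this ⊢
      omega

theorem tsum_mul_list_sum {α κ : Type} (p : α → ℝ≥0∞) (l : List κ) (f : κ → α → ℝ≥0∞) :
    ∑' a, p a * (l.map fun c => f c a).sum = (l.map fun c => ∑' a, p a * f c a).sum := by
  induction l with
  | nil => simp
  | cons c l ih => simp only [List.map_cons, List.sum_cons, mul_add, ENNReal.tsum_add, ih]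

theorem queryCount_cons (O : List Bool → List Bool) (q : List Bool) (g : Gate) (gs : List Gate)
    (w : List Bool) : queryCount O q (g :: gs) w =
      (g.queries.map fun c => c.eval O w q).sum + ∑' new, g.run O w new *
        queryCount O q gs (w ++ new) := by
  simp only [queryCount, queryCircuits, List.map_append, List.sum_append, tsum_mul_list_sum,
    List.map_map]
  congr 3
  funext c
  simp only [Function.comp, Circuit.eval, runGates, PMF.map_bind, PMF.bind_apply]

/-- `a` and `b` differ by at most `δ`. -/
def Close (δ a b : ℝ≥0∞) : Prop := a ≤ b + δ ∧ b ≤ a + δ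

theorem Close.refl (a : ℝ≥0∞) : Close 0 a a := by simp [Close]

theorem Close.symm {δ a b : ℝ≥0∞} (h : Close δ a b) : Close δ b a := ⟨h.2, h.1⟩

theorem Close.mono {δ δ' a b : ℝ≥0∞} (h : Close δ a b) (hδ : δ ≤ δ') : Close δ' a b :=
  ⟨h.1.trans (by gcongr), h.2.trans (by gcongr)⟩

theorem Close.trans {δ δ' a b c : ℝ≥0∞} (h : Close δ a b) (h' : Close δ' b c) :
    Close (δ + δ') a c := by
  constructor
  · calc a ≤ b + δ := h.1
      _ ≤ (c + δ') + δ := by gcongr; exact h'.1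
      _ = c + (δ + δ') := by ring
  · calc c ≤ b + δ' := h'.2
      _ ≤ (a + δ) + δ' := by gcongr; exact h.2
      _ = a + (δ + δ') := by ring

theorem Close.tsum {α : Type} {p δ f g : α → ℝ≥0∞} (h : ∀ a, Close (δ a) (f a) (g a)) :
    Close (∑' a, p a * δ a) (∑' a, p a * f a) (∑' a, p a * g a) := by
  constructor
  · rw [← ENNReal.tsum_add]
    exact ENNReal.tsum_le_tsum fun a => by rw [← mul_add]; gcongr; exact (h a).1
  · rw [← ENNReal.tsum_add]
    exact ENNReal.tsum_le_tsum fun a => by rw [← mul_add]; gcongr; exact (h a).2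

theorem Close.lintegral {Ω : Type} [MeasurableSpace Ω] {μ : Measure Ω} {f g δ : Ω → ℝ≥0∞}
    (hf : Measurable f) (hg : Measurable g) (h : ∀ x, Close (δ x) (f x) (g x)) :
    Close (∫⁻ x, δ x ∂μ) (∫⁻ x, f x ∂μ) (∫⁻ x, g x ∂μ) := by
  constructor
  · rw [← lintegral_add_left hg]
    exact lintegral_mono fun x => (h x).1
  · rw [← lintegral_add_left hf]
    exact lintegral_mono fun x => (h x).2

theorem Close.of_le_one {δ a b : ℝ≥0∞} (ha : a ≤ 1) (hb : b ≤ 1) (hδ : 1 ≤ δ) : Close δ a b :=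
  ⟨(ha.trans hδ).trans le_add_self, (hb.trans hδ).trans le_add_self⟩

/-- Changing an oracle at one point changes output probabilities by at most the expected number
of queries to that point. -/
theorem close_runGates {O O' : List Bool → List Bool} {q : List Bool} (h : ∀ r, r ≠ q → O' r = O r)
    {β : Type} (φ : List Bool → β) (b : β) (gs : List Gate) (w : List Bool) :
    Close (queryCount O q gs w) ((runGates O' gs w).map φ b) ((runGates O gs w).map φ b) := by
  induction gs generalizing w with
  | nil => exact (Close.refl _).mono zero_le
  | cons g gs ih =>
    rw [queryCount_cons]
    have key : g.run O' w = g.run O w → Close (∑' new, g.run O w new * queryCount O q gs (w ++ new))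
        ((runGates O' (g :: gs) w).map φ b) ((runGates O (g :: gs) w).map φ b) := by
      intro hg
      simp only [runGates, PMF.map_bind, PMF.bind_apply, hg]
      exact Close.tsum fun new => ih (w ++ new)
    -- When the gate asks for `q`, the runs may part completely, but this query alone contributes 1
    -- to the count and that bounds any difference of probabilities. Any other gate behaves
    -- identically in both runs.
    by_cases hg : ∃ ws, g = .oracle ws ∧ ws.map (wire w) = q
    · obtain ⟨ws, rfl, hq⟩ := hg
      refine Close.of_le_one (PMF.coe_le_one _ _) (PMF.coe_le_one _ _) (le_add_right ?_)
      simp only [Gate.queries, Circuit.eval, runGates, PMF.pure_map, hq, List.map_cons,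
        List.map_nil, PMF.pure_apply]
      simp
    · refine (key ?_).mono le_add_self
      cases g with
      | oracle ws =>
        simp only [Gate.run]
        rw [h _ fun hq => hg ⟨ws, rfl, hq⟩]
      | _ => rfl

theorem close_eval {O O' : List Bool → List Bool} {q : List Bool} (h : ∀ r, r ≠ q → O' r = O r)
    (c : Circuit) (x v : List Bool) :
    Close (queryCount O q c.gates x) (c.eval O' x v) (c.eval O x v) :=
  close_runGates h _ _ _ _

/-- Masking with the value of a random oracle at `q` is as good as masking with a fresh random
string, up to the expected number of queries to `q`. -/
theorem close_hash_uniform (c : Circuit) (x q v : List Bool) :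
    Close (((queryCircuits c.gates).map fun c' => (PMF.uniformOfFintype (Str sig)).bind
        (fun u => c'.lazyEval sig (x ++ List.ofFn u)) q).sum)
      (∫⁻ H : Hash sig, c.eval H.oracle (x ++ List.ofFn (H q)) v ∂(randomOracle sig))
      (∫⁻ H : Hash sig, (PMF.uniformOfFintype (Str sig)).bind
        (fun u => c.eval H.oracle (x ++ List.ofFn u)) v ∂(randomOracle sig)) := by
  -- After resampling at `q`, both games show the same independent string `u`; the real one uses the
  -- oracle updated to `u` at `q`, the ideal one the original oracle.
  rw [lintegral_update_randomOracle q (measurable_eval_hash q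
    (f := fun a H => c.eval H.oracle (x ++ List.ofFn a) v) fun a => measurable_eval _ _ _),
    lintegral_bind_apply _ _ fun a => measurable_eval _ _ _]
  -- Queries are counted with the original oracle, which is independent of `u`. This is why they can
  -- be simulated by lazy sampling without knowledge of `q`.
  have hsum : ((queryCircuits c.gates).map fun c' => (PMF.uniformOfFintype (Str sig)).bind
        (fun u => c'.lazyEval sig (x ++ List.ofFn u)) q).sum =
      ∑' u, PMF.uniformOfFintype (Str sig) u * ∫⁻ H : Hash sig,
        queryCount H.oracle q c.gates (x ++ List.ofFn u) ∂(randomOracle sig) := by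
    simp only [PMF.bind_apply]
    rw [← tsum_mul_list_sum]
    refine tsum_congr fun u => ?_
    congr 1
    simp only [queryCount]
    induction queryCircuits c.gates with
    | nil => simp
    | cons c' l ih =>
      simp only [List.map_cons, List.sum_cons]
      rw [lintegral_add_left (measurable_eval _ _ _), lintegral_eval, ih]
  rw [hsum]
  refine Close.tsum fun u => Close.lintegral ?_ (measurable_eval _ _ _) fun H => ?_
  · have h1 : Measurable fun H : Hash sig => Function.update H q u :=
      measurable_update'.comp (measurable_id.prodMk measurable_const)
    simpa [Function.comp_def] using (measurable_eval c (x ++ List.ofFn u) v).comp h1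
  · simp only [Function.update_self]
    exact close_eval (fun r hr => by simp [Hash.oracle, hr]) _ _ _

end RandomOracle

/-! ## Binary numbers -/

theorem natToBits_succ (len k : ℕ) :
    natToBits (len + 1) k = k.testBit 0 :: natToBits len (k / 2) := by
  simp only [natToBits, List.ofFn_succ]
  congr 2
  funext i
  simp [Nat.testBit_succ]

theorem bitsToNat_natToBits (len k : ℕ) : bitsToNat (natToBits len k) = k % 2 ^ len := by
  induction len generalizing k with
  | zero => simp [natToBits, bitsToNat, Nat.mod_one]
  | succ len ih =>
    rw [natToBits_succ, bitsToNat, ih, pow_succ', Nat.mod_mul]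
    simp [Nat.testBit_zero]
    rcases Nat.mod_two_eq_zero_or_one k with h | h <;> simp [h]

@[simp]
theorem length_natToBits (len k : ℕ) : (natToBits len k).length = len := by simp [natToBits]

/-! ## Exponents -/

namespace GroupDesc

variable {d e : ℕ} (I : GroupDesc d e)

theorem orderOf_g : orderOf I.g = I.p := by
  rw [orderOf_eq_card_of_forall_mem_zpowers I.g_generates, Nat.card_eq_fintype_card, I.card_eq]

theorem pow_mod_p (x : I.Elt) (n : ℕ) : x ^ (n % I.p) = x ^ n := by
  rw [← I.card_eq, pow_mod_card]

theorem gpow_add (a b : ZMod I.p) : I.gpow (a + b) = I.gpow a * I.gpow b := by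
  simp only [gpow, ZMod.val_add, pow_mod_p, pow_add]

theorem gpow_mul (a b : ZMod I.p) : I.gpow (a * b) = I.gpow a ^ b.val := by
  simp only [gpow, ZMod.val_mul, pow_mod_p, pow_mul]

@[simp]
theorem gpow_zero : I.gpow 0 = 1 := by simp [gpow]

theorem gpow_neg (a : ZMod I.p) : I.gpow (-a) = (I.gpow a)⁻¹ := by
  rw [eq_inv_iff_mul_eq_one, ← gpow_add]
  simp

theorem gpow_sub (a b : ZMod I.p) : I.gpow (a - b) = I.gpow a / I.gpow b := by
  rw [sub_eq_add_neg, gpow_add, gpow_neg, div_eq_mul_inv]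

theorem gpow_bijective : Function.Bijective I.gpow := by
  rw [Fintype.bijective_iff_injective_and_card]
  refine ⟨fun a b hab => ?_, by rw [I.card_eq, ZMod.card]⟩
  refine ZMod.val_injective _ (pow_injOn_Iio_orderOf (x := I.g) ?_ ?_ hab) <;>
    simp [orderOf_g, ZMod.val_lt]

/-- The isomorphism between exponents and group elements. -/
def gpowEquiv : ZMod I.p ≃ I.Elt := Equiv.ofBijective I.gpow I.gpow_bijective

theorem uniform_bind_gpow {γ : Type} (f : I.Elt → PMF γ) :
    (PMF.uniformOfFintype I.Elt).bind f =
      (PMF.uniformOfFintype (ZMod I.p)).bind fun a => f (I.gpow a) :=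
  (uniform_bind_equiv I.gpowEquiv f).symm

@[simp]
theorem length_bits (x : I.Elt) : (I.bits x).length = e := by simp [bits]

@[simp]
theorem length_expBits (lam : ℕ) (r : ZMod I.p) : (I.expBits lam r).length = lam + 1 := by
  simp [expBits]

@[simp]
theorem length_pub (lam : ℕ) : (I.pub lam).length = d + (lam + 1) + e := by
  simp [pub, add_assoc]

end GroupDesc

/-! ## Group operations as circuits -/

/-- With the empty oracle an oracle gate appends no wire, so deleting all oracle gates changes no
numbering. The group algorithms, specified without oracle, can thus be run in contexts that have
one. -/
theorem runGates_filter_noOracle (O : List Bool → List Bool) (gs : List Gate) (w : List Bool) :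
    runGates O (gs.filter fun g => g matches .const _ | .nand _ _ | .coin | .sample _) w =
      runGates noOracle gs w := by
  induction gs generalizing w with
  | nil => rfl
  | cons g gs ih =>
    cases g <;> simp [runGates, ih, Gate.run, noOracle]

/-- A number that bounds the sizes of the circuits of the group-generator scheme and the lengths
of the bit strings that are involved. -/
def GroupScheme.unitSize (G : GroupScheme) (lam : ℕ) : ℕ :=
  (G.gen lam (G.coinLen lam)).size +
  (G.mul lam (G.descLen lam + (lam + 1) + G.eltLen lam + G.eltLen lam + G.eltLen lam)).size +
  (G.inv lam (G.descLen lam + (lam + 1) + G.eltLen lam + G.eltLen lam)).size +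
  G.coinLen lam + G.descLen lam + G.eltLen lam + lam + 1

namespace Impl

variable {ι κ : Type} {Γ : Env ι} {y z : ι → List Bool} {F : ι → PMF (List Bool)} {s s₁ s₂ : ℕ}

theorem ofCircuitNoOracle (c : Circuit) (hy : Reads Γ y) :
    Impl Γ (fun i => c.eval noOracle (y i)) c.size := by
  refine ((ofCircuit ⟨c.gates.filter fun g => g matches .const _ | .nand _ _ | .coin | .sample _,
    c.outs⟩ hy).mono ?_).congr fun i => ?_
  · simp only [Circuit.size]
    gcongr
    exact (List.filter_sublist.map _).sum_le_sum (by simp)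
  · simp only [Circuit.eval, runGates_filter_noOracle]

variable {G : GroupScheme} {lam : ℕ} {w : ι → Str (G.coinLen lam)}

theorem gen (hw : Reads Γ fun i => List.ofFn (w i)) :
    Impl Γ (fun i => PMF.pure ((G.inst lam (w i)).pub lam)) (G.unitSize lam) := by
  refine ((ofCircuitNoOracle (G.gen lam (G.coinLen lam)) hw).mono
    (by simp only [GroupScheme.unitSize]; omega)).congr fun i => ?_
  rw [← G.gen_run, Algorithm.run, List.length_ofFn]

theorem mul (hp : Reads Γ fun i => (G.inst lam (w i)).pub lam)
    {a b : ∀ i, (G.inst lam (w i)).Elt} (ha : Reads Γ fun i => (G.inst lam (w i)).bits (a i))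
    (hb : Reads Γ fun i => (G.inst lam (w i)).bits (b i)) :
    Impl Γ (fun i => PMF.pure ((G.inst lam (w i)).bits (a i * b i))) (G.unitSize lam) := by
  refine ((ofCircuitNoOracle (G.mul lam (G.descLen lam + (lam + 1) + G.eltLen lam + G.eltLen lam +
    G.eltLen lam)) ((hp.append ha).append hb)).mono
    (by simp only [GroupScheme.unitSize]; omega)).congr fun i => ?_
  rw [← G.mul_run, Algorithm.run]
  simp only [List.length_append, GroupDesc.length_pub, GroupDesc.length_bits]

theorem inv (hp : Reads Γ fun i => (G.inst lam (w i)).pub lam)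
    {a : ∀ i, (G.inst lam (w i)).Elt} (ha : Reads Γ fun i => (G.inst lam (w i)).bits (a i)) :
    Impl Γ (fun i => PMF.pure ((G.inst lam (w i)).bits (a i)⁻¹)) (G.unitSize lam) := by
  refine ((ofCircuitNoOracle (G.inv lam (G.descLen lam + (lam + 1) + G.eltLen lam + G.eltLen lam))
    (hp.append ha)).mono (by simp only [GroupScheme.unitSize]; omega)).congr fun i => ?_
  rw [← G.inv_run, Algorithm.run]
  simp

theorem _root_.GroupScheme.eltLen_le (G : GroupScheme) (lam : ℕ) :
    G.eltLen lam ≤ G.unitSize lam := by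
  simp only [GroupScheme.unitSize]; omega

theorem _root_.GroupScheme.lam_lt (G : GroupScheme) (lam : ℕ) : lam + 1 ≤ G.unitSize lam := by
  simp only [GroupScheme.unitSize]; omega

theorem div (hp : Reads Γ fun i => (G.inst lam (w i)).pub lam)
    {a b : ∀ i, (G.inst lam (w i)).Elt} (ha : Reads Γ fun i => (G.inst lam (w i)).bits (a i))
    (hb : Reads Γ fun i => (G.inst lam (w i)).bits (b i)) :
    Impl Γ (fun i => PMF.pure ((G.inst lam (w i)).bits (a i / b i))) (3 * G.unitSize lam) := by
  refine ((letE (m := G.eltLen lam) (by simp) (inv hp hb)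
    (mul hp.snoc ha.snoc (b := fun i => (b i)⁻¹) Reads.last)).mono ?_).congr
    fun i => by rw [div_eq_mul_inv]
  have := G.lam_lt lam
  omega

/-- Square and multiply along the little-endian expansion: the power for the tail is squared and
then multiplied by `a` or by 1, selected by the first bit. -/
theorem powBits (hp : Reads Γ fun i => (G.inst lam (w i)).pub lam)
    {a : ∀ i, (G.inst lam (w i)).Elt} (ha : Reads Γ fun i => (G.inst lam (w i)).bits (a i))
    (h1 : Reads Γ fun i => (G.inst lam (w i)).bits 1) (k : ℕ) {l : ι → List Bool}
    (hl : Reads Γ l) (hlk : ∀ i, (l i).length = k) :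
    Impl Γ (fun i => PMF.pure ((G.inst lam (w i)).bits (a i ^ bitsToNat (l i))))
      (k * (20 * G.unitSize lam) + G.unitSize lam) := by
  induction k generalizing l with
  | zero =>
    refine ((ret h1 (m := G.eltLen lam) (by simp)).mono (by have := G.eltLen_le lam; omega)).congr
      fun i => ?_
    rw [List.length_eq_zero_iff.1 (hlk i)]
    simp [bitsToNat]
  | succ k ih =>
    refine ((letE (m := G.eltLen lam) (by simp) (ih (hl.drop 1) (by simp [hlk]))
      (letE (m := G.eltLen lam) (by simp) (mul hp.snoc Reads.last Reads.last)
      (letE (m := G.eltLen lam) (y := fun i => if wire (l i) 0 then (G.inst lam (w i)).bits (a i)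
          else (G.inst lam (w i)).bits 1) (fun i => by split_ifs <;> simp)
        (mux (m := G.eltLen lam) (hl.bit (j := 0) (by simp [hlk])).snoc.snoc ha.snoc.snoc h1.snoc.snoc
          (by simp) (by simp))
        ((mul hp.snoc.snoc.snoc
          (b := fun i => if wire (l i) 0 then a i else 1)
          Reads.last.snoc (by
            convert Reads.last using 2 with i
            split_ifs <;> rfl)))))).mono ?_).congr fun i => ?_
    · have := G.eltLen_le lam
      have := G.lam_lt lam
      rw [add_mul]
      omega
    · obtain ⟨b, l', hl'⟩ : ∃ b l', l i = b :: l' := by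
        cases h : l i with
        | nil => simpa [h] using hlk i
        | cons b l' => exact ⟨b, l', rfl⟩
      rw [hl']
      cases b <;> simp [bitsToNat, wire, pow_add, pow_mul, mul_comm, ← pow_two]

theorem pow (hp : Reads Γ fun i => (G.inst lam (w i)).pub lam) (hlam : 0 < lam)
    {a : ∀ i, (G.inst lam (w i)).Elt} (ha : Reads Γ fun i => (G.inst lam (w i)).bits (a i))
    {r : ∀ i, ZMod (G.inst lam (w i)).p}
    (hr : Reads Γ fun i => (G.inst lam (w i)).expBits lam (r i)) :
    Impl Γ (fun i => PMF.pure ((G.inst lam (w i)).bits (a i ^ (r i).val)))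
      (30 * G.unitSize lam ^ 2) := by
  -- The encoding of the identity is not part of the public string; it is obtained as `a * a⁻¹`.
  refine ((letE (m := G.eltLen lam) (by simp) (inv hp ha)
    (letE (m := G.eltLen lam) (by simp) (mul hp.snoc ha.snoc (b := fun i => (a i)⁻¹) Reads.last)
    (powBits hp.snoc.snoc ha.snoc.snoc (by convert Reads.last using 3; simp) (lam + 1)
      hr.snoc.snoc (by simp)))).mono ?_).congr fun i => ?_
  · have := G.lam_lt lam
    nlinarith
  -- The exponent fits into `lam + 1` bits because `p < 2 ^ (lam + 1)`, which is guaranteed for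
  -- positive `lam` only.
  · rw [GroupDesc.expBits, bitsToNat_natToBits, Nat.mod_eq_of_lt]
    exact (ZMod.val_lt (r i)).trans (G.order_lt lam (w i) hlam)

theorem readsOrder (hp : Reads Γ fun i => (G.inst lam (w i)).pub lam) :
    Reads Γ fun i => natToBits (lam + 1) (G.inst lam (w i)).p := by
  convert (hp.drop (G.descLen lam)).take (lam + 1) using 2 with i
  rw [GroupDesc.pub, List.append_assoc, List.drop_left' (by simp), List.take_left' (by simp)]

theorem readsGenerator (hp : Reads Γ fun i => (G.inst lam (w i)).pub lam) :
    Reads Γ fun i => (G.inst lam (w i)).bits (G.inst lam (w i)).g := by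
  convert hp.drop (G.descLen lam + (lam + 1)) using 2 with i
  rw [GroupDesc.pub, List.drop_left' (by simp)]

theorem gpow (hp : Reads Γ fun i => (G.inst lam (w i)).pub lam) (hlam : 0 < lam)
    {r : ∀ i, ZMod (G.inst lam (w i)).p}
    (hr : Reads Γ fun i => (G.inst lam (w i)).expBits lam (r i)) :
    Impl Γ (fun i => PMF.pure ((G.inst lam (w i)).bits ((G.inst lam (w i)).gpow (r i))))
      (30 * G.unitSize lam ^ 2) :=
  pow hp hlam (readsGenerator hp) hr

theorem _root_.uniform_zmod_map_val {γ : Type} (n : ℕ) [NeZero n] [Fintype (ZMod n)] (f : ℕ → γ) :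
    (PMF.uniformOfFintype (ZMod n)).map (fun r => f r.val) =
      (PMF.uniformOfFintype (Fin n)).map fun r => f r.val := by
  cases n with
  | zero => exact absurd rfl (NeZero.ne 0)
  | succ n =>
    rw [← uniform_map_equiv (ZMod.finEquiv (n + 1)).toEquiv, PMF.map_comp]
    rfl

theorem sampleExp (hp : Reads Γ fun i => (G.inst lam (w i)).pub lam) (hlam : 0 < lam) :
    Impl Γ (fun i => (PMF.uniformOfFintype (ZMod (G.inst lam (w i)).p)).map
      fun r => (G.inst lam (w i)).expBits lam r) (3 * G.unitSize lam) := by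
  have : ∀ i, NeZero (G.inst lam (w i)).p := fun i => ⟨(G.inst lam (w i)).prime.out.ne_zero⟩
  refine ((sampleNat (p := fun i => (G.inst lam (w i)).p) (m := lam + 1) (readsOrder hp) (by simp)
    fun i => ?_).mono ?_).congr fun i => ?_
  · rw [bitsToNat_natToBits, Nat.mod_eq_of_lt (G.order_lt lam (w i) hlam)]
  · have := G.lam_lt lam
    omega
  · exact (uniform_zmod_map_val _ fun k => natToBits (lam + 1) k).symm

end Impl

theorem Impl.lazyEvalUniform {ι : Type} {Γ : Env ι} {y : ι → List Bool} {N n S : ℕ}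
    (hy : Reads Γ y) (hN : ∀ i, (y i).length = N) (c : Circuit) (hc : c.size ≤ S) :
    Impl Γ (fun i => (PMF.uniformOfFintype (Str n)).bind
      fun u => c.lazyEval n (y i ++ List.ofFn u)) (3 * n + lazySize n S + 1) :=
  Impl.bind (m := n) (he := by simp) (Impl.coins Γ n)
    (G := fun i u => c.lazyEval n (y i ++ List.ofFn u))
    (Impl.lazyEval (y := fun j : Σ _ : ι, Str n => y j.1 ++ List.ofFn j.2)
      (hy.ext.append Reads.extLast) (N := N + n)
      (fun j => by simp [hN]) c hc)

/-! ## The CDH assumption against all circuits of polynomial size -/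

open scoped ENNReal

theorem polynomial_eval_mono (P : Polynomial ℕ) {m n : ℕ} (h : m ≤ n) : P.eval m ≤ P.eval n := by
  simp only [Polynomial.eval_eq_sum_range]
  gcongr

namespace GroupScheme

variable (G : GroupScheme)

/-- The probability that the circuit `c` solves a CDH instance. -/
def cdhSucc (c : Circuit) (lam : ℕ) : ℝ≥0∞ := G.cdhExp (fun _ _ => c) lam true

variable {G}

/-- For each `lam` a circuit within the size bound is chosen whose success is at least half the
supremum; the factor 2 avoids asking whether the supremum is attained. The chosen circuits form one
non-uniform algorithm, to which the assumption applies. The resulting bound is independent of the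
parties' inputs, even when these are built into the circuits. -/
theorem CDHHard.exists_bound (h : G.CDHHard) {B : ℕ → ℕ} (hB : PolyBounded B) :
    ∃ μ : ℕ → ℝ, Negligible μ ∧ (∀ lam, 0 ≤ μ lam) ∧
      ∀ lam (c : Circuit), c.size ≤ B lam → G.cdhSucc c lam ≤ ENNReal.ofReal (μ lam) := by
  have hbest : ∀ lam, ∃ c : Circuit, c.size ≤ B lam ∧
      ∀ c' : Circuit, c'.size ≤ B lam → G.cdhSucc c' lam ≤ 2 * G.cdhSucc c lam := by
    intro lam
    set S : ℝ≥0∞ := ⨆ c : {c : Circuit // c.size ≤ B lam}, G.cdhSucc c.1 lam with hS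
    have hle : ∀ c' : Circuit, c'.size ≤ B lam → G.cdhSucc c' lam ≤ S := fun c' hc' =>
      le_iSup (fun c : {c : Circuit // c.size ≤ B lam} => G.cdhSucc c.1 lam) ⟨c', hc'⟩
    by_cases hS0 : S = 0
    · exact ⟨⟨[], []⟩, by simp [Circuit.size], fun c' hc' => by
        have := hle c' hc'
        rw [hS0] at this
        exact this.trans zero_le⟩
    · have hS1 : S ≤ 1 := iSup_le fun c => PMF.coe_le_one _ _
      have hlt : S / 2 < S := ENNReal.half_lt_self hS0 (ne_top_of_le_ne_top ENNReal.one_ne_top hS1)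
      obtain ⟨⟨c, hc⟩, hcS⟩ := lt_iSup_iff.1 (hlt.trans_eq hS)
      refine ⟨c, hc, fun c' hc' => (hle c' hc').trans ?_⟩
      calc S = 2 * (S / 2) := (ENNReal.mul_div_cancel (by simp) (by simp)).symm
        _ ≤ 2 * G.cdhSucc c lam := by gcongr
  choose c hc hmax using hbest
  obtain ⟨P, hP⟩ := hB
  have hA : Algorithm.PolyTime fun lam _ => c lam :=
    ⟨P, fun lam n => ((hc lam).trans (hP lam)).trans (polynomial_eval_mono P (by omega))⟩
  refine ⟨fun lam => 2 * (G.cdhSucc (c lam) lam).toReal, (h _ hA).const_mul 2,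
    fun lam => by positivity, fun lam c' hc' => (hmax lam c' hc').trans ?_⟩
  have htop : G.cdhSucc (c lam) lam ≠ ⊤ :=
    ne_top_of_le_ne_top ENNReal.one_ne_top (PMF.coe_le_one _ _)
  rw [ENNReal.ofReal_mul (by norm_num), ENNReal.ofReal_toReal htop]
  simp

end GroupScheme

/-- The exponents of a CDH instance, with the coins of the group generation. -/
abbrev CDHIndex (G : GroupScheme) (lam : ℕ) : Type :=
  Σ w : Str (G.coinLen lam), ZMod (G.inst lam w).p × ZMod (G.inst lam w).p

namespace CDHIndex

variable {G : GroupScheme} {lam : ℕ}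

/-- The CDH instance as a bit string. -/
def bits (k : CDHIndex G lam) : List Bool :=
  (G.inst lam k.1).pub lam ++ (G.inst lam k.1).bits ((G.inst lam k.1).gpow k.2.1) ++
    (G.inst lam k.1).bits ((G.inst lam k.1).gpow k.2.2)

/-- The solution of the CDH instance. -/
def sol (k : CDHIndex G lam) : List Bool :=
  (G.inst lam k.1).bits ((G.inst lam k.1).gpow (k.2.1 * k.2.2))

theorem length_bits (k : CDHIndex G lam) : k.bits.length =
    G.descLen lam + (lam + 1) + G.eltLen lam + G.eltLen lam + G.eltLen lam := by
  simp only [bits, List.length_append, GroupDesc.length_pub, GroupDesc.length_bits]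

/-- The law of the exponents of a random CDH instance. -/
def law (G : GroupScheme) (lam : ℕ) : PMF (CDHIndex G lam) :=
  (PMF.uniformOfFintype (Str (G.coinLen lam))).bind fun w =>
    (PMF.uniformOfFintype (ZMod (G.inst lam w).p)).bind fun a₁ =>
      (PMF.uniformOfFintype (ZMod (G.inst lam w).p)).map fun a₂ => ⟨w, a₁, a₂⟩

theorem law_bind {γ : Type} (f : CDHIndex G lam → PMF γ) : (law G lam).bind f =
    (PMF.uniformOfFintype (Str (G.coinLen lam))).bind fun w =>
    (PMF.uniformOfFintype (ZMod (G.inst lam w).p)).bind fun a₁ =>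
      (PMF.uniformOfFintype (ZMod (G.inst lam w).p)).bind fun a₂ => f ⟨w, a₁, a₂⟩ := by
  simp [law, PMF.bind_map, Function.comp_def]

open Classical in
theorem cdhSucc_eq (c : Circuit) :
    G.cdhSucc c lam = ∑' k, law G lam k * c.eval noOracle k.bits k.sol := by
  have h1 : G.cdhExp (fun _ _ => c) lam =
      (law G lam).bind fun k => (c.eval noOracle k.bits).map fun out => decide (out = k.sol) := by
    rw [law_bind]
    rfl
  rw [GroupScheme.cdhSucc, h1, PMF.bind_apply]
  refine tsum_congr fun k => ?_
  congr 1
  rw [PMF.map_apply, tsum_eq_single k.sol]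
  · simp
  · intro out hout
    simp [hout]

/-- The context of a circuit that solves CDH instances. -/
def env (G : GroupScheme) (lam : ℕ) : Env (CDHIndex G lam) where
  O _ := noOracle
  X := bits
  ansLen := 0
  len := _
  length_O _ _ := rfl
  length_X := length_bits

/-- Under CDH, the hash value of the solution of a random instance is as good as a random string. -/
theorem close_mask {sig : ℕ} {ε : ℝ≥0∞} {B : ℕ} (c : Circuit)
    (hB : 3 * sig + lazySize sig c.size + 1 ≤ B)
    (hε : ∀ c' : Circuit, c'.size ≤ B → G.cdhSucc c' lam ≤ ε) (v : List Bool) :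
    Close (c.size * ε)
      (∫⁻ H : Hash sig, (law G lam).bind
        (fun k => c.eval H.oracle (k.bits ++ List.ofFn (H k.sol))) v ∂(randomOracle sig))
      (∫⁻ H : Hash sig, (law G lam).bind
        (fun k => (PMF.uniformOfFintype (Str sig)).bind
          fun u => c.eval H.oracle (k.bits ++ List.ofFn u)) v ∂(randomOracle sig)) := by
  rw [lintegral_bind_apply, lintegral_bind_apply]
  rotate_left
  · exact fun k => measurable_bind_apply _ fun u => measurable_eval _ _ _
  · exact fun k => measurable_eval_hash k.sol
      (f := fun a H => c.eval H.oracle (k.bits ++ List.ofFn a) v) fun a => measurable_eval _ _ _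
  have hclose := fun k : CDHIndex G lam => close_hash_uniform (sig := sig) c k.bits k.sol v
  refine (Close.tsum (p := fun k => law G lam k) hclose).mono ?_
  rw [tsum_mul_list_sum]
  have hlen : (queryCircuits c.gates).length ≤ c.size :=
    ((length_queryCircuits _).trans (length_le_sum_size _)).trans (by simp [Circuit.size])
  -- A query circuit with a fresh string as mask and a lazily sampled oracle is an oracle-free CDH
  -- solver: it succeeds exactly when the query is the solution. Summation over all query circuits
  -- replaces the guess of the right query.
  have hterm : ∀ c' ∈ queryCircuits c.gates, ∑' k : CDHIndex G lam, law G lam k *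
      (PMF.uniformOfFintype (Str sig)).bind
        (fun u => c'.lazyEval sig (k.bits ++ List.ofFn u)) k.sol ≤ ε := by
    intro c' hc'
    have hsize : c'.size ≤ c.size := (size_queryCircuits hc').trans (by simp [Circuit.size])
    have himpl := Impl.lazyEvalUniform (n := sig) (Reads.self (env G lam)) length_bits c' hsize
    obtain ⟨c'', hc'', h⟩ := himpl
    refine le_trans (le_of_eq ?_) (hε c'' (hc''.trans hB))
    rw [cdhSucc_eq]
    exact tsum_congr fun k => congrArg (fun p : PMF (List Bool) => law G lam k * p k.sol) (h k).symm
  calc _ ≤ ((queryCircuits c.gates).map fun _ => ε).sum := List.sum_le_sum hterm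
    _ = (queryCircuits c.gates).length * ε := by simp
    _ ≤ c.size * ε := by gcongr

end CDHIndex

/-! ## The laws of the views -/

theorem seqBits_flatten (l : List (List (PMF (List Bool)))) :
    seqBits l.flatten = seqBits (l.map seqBits) := by
  induction l with
  | nil => rfl
  | cons a l ih => rw [List.flatten_cons, seqBits_append, ih]; rfl

/-- By independence, the randomness of one block may be drawn before that of all others. This
exposes the exponent and the mask of the ciphertext that is being replaced. -/
theorem seqBits_append_bind {α : Type} (l l' : List (PMF (List Bool))) (P : PMF α)
    (Q : α → PMF (List Bool)) :
    seqBits (l ++ P.bind Q :: l') = P.bind fun a => seqBits (l ++ Q a :: l') := by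
  simp only [seqBits_append, seqBits, PMF.bind_bind, PMF.map_bind]
  rw [PMF.bind_comm]

theorem seqBits_length {l : List (PMF (List Bool))} {n : ℕ}
    (h : ∀ p ∈ l, ∀ y ∈ p.support, y.length = n) :
    ∀ y ∈ (seqBits l).support, y.length = l.length * n := by
  induction l with
  | nil => simp [seqBits]
  | cons p l ih =>
    intro y hy
    simp only [seqBits, PMF.mem_support_bind_iff, PMF.support_map, Set.mem_image] at hy
    obtain ⟨a, ha, b, hb, rfl⟩ := hy
    rw [List.length_append, h p (by simp) a ha, ih (fun q hq => h q (by simp [hq])) b hb]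
    simp; ring

theorem GroupDesc.gpow_pow_comm {d e : ℕ} (I : GroupDesc d e) (a b : ZMod I.p) :
    I.gpow a ^ b.val = I.gpow b ^ a.val := by
  rw [← gpow_mul, mul_comm, gpow_mul]

/-! ### Algebra of the queries and of the ciphertexts -/

namespace DQMR

variable {d e : ℕ} (I : GroupDesc d e) {sig : ℕ}

/-- The second server splits `C` into two factors. The first server at most swaps them and moves `g
^ r₁` from one to the other, so the product is unchanged and the sender never aborts. -/
theorem genQuery1_mul (C : I.Elt) (s b : Bool) (r₁ r₂ : ZMod I.p) :
    genQuery1 I (share s b).1 r₁ (genQuery2 I C (share s b).2 r₂) false *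
      genQuery1 I (share s b).1 r₁ (genQuery2 I C (share s b).2 r₂) true = C := by
  have h : ∀ a c : I.Elt, a * c * (c⁻¹ * a⁻¹) = 1 := fun a c => by simp
  cases s <;> cases b <;> simp [genQuery1, genQuery2, share, div_eq_mul_inv] <;>
    simp [mul_comm, mul_left_comm] <;> rw [mul_comm (I.gpow r₁)⁻¹, h]

/-- The exponent of the public key of the receiver for the message that it requests. -/
def recvExp (s b : Bool) (r₁ r₂ : ZMod I.p) : ZMod I.p := r₂ + r₁ * (-1) ^ (share s b).2.toNat

/-- The element `g ^ r₂` sits at position `s₂` of `δ` and ends at position `s₁ ⊕ s₂ = s` of `β`. It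
is multiplied by `g ^ r₁` if `s₂ = 0` and divided by it if `s₂ = 1`, whence the sign in `recvExp`.
-/
theorem genQuery1_self (C : I.Elt) (s b : Bool) (r₁ r₂ : ZMod I.p) :
    genQuery1 I (share s b).1 r₁ (genQuery2 I C (share s b).2 r₂) s =
      I.gpow (recvExp I s b r₁ r₂) := by
  cases s <;> cases b <;>
    simp [genQuery1, genQuery2, share, recvExp, I.gpow_add, I.gpow_neg, div_eq_mul_inv]

theorem genQuery1_not (C : I.Elt) (s b : Bool) (r₁ r₂ : ZMod I.p) :
    genQuery1 I (share s b).1 r₁ (genQuery2 I C (share s b).2 r₂) (!s) =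
      C / I.gpow (recvExp I s b r₁ r₂) := by
  rw [eq_div_iff_mul_eq', mul_comm, ← genQuery1_self I C]
  have := genQuery1_mul I C s b r₁ r₂
  cases s
  · exact this
  · exact (mul_comm _ _).trans this

theorem genQuery2_false (C : I.Elt) (s₁ s₂ : Bool) (r₁ r₂ : ZMod I.p) :
    genQuery2 I C s₂ r₂ false = genQuery1 I s₁ r₁ (genQuery2 I C s₂ r₂) s₁ / I.gpow r₁ := by
  simp [genQuery1]

theorem genQuery2_true (C : I.Elt) (s₁ s₂ : Bool) (r₁ r₂ : ZMod I.p) :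
    genQuery2 I C s₂ r₂ true = genQuery1 I s₁ r₁ (genQuery2 I C s₂ r₂) (!s₁) * I.gpow r₁ := by
  simp [genQuery1]

/-- The exponent of the requested key is a translate of `r₂`, and that of the other key is `c` minus
it. In either case a uniform `r₂` makes the exponent of the first key uniform. -/
theorem exists_equiv_query (c : ZMod I.p) (s b : Bool) (r₁ : ZMod I.p) :
    ∃ f : ZMod I.p ≃ ZMod I.p, ∀ r₂,
      genQuery1 I (share s b).1 r₁ (genQuery2 I (I.gpow c) (share s b).2 r₂) false =
        I.gpow (f r₂) := by
  cases s
  · refine ⟨Equiv.addRight (r₁ * (-1) ^ (share false b).2.toNat), fun r₂ => ?_⟩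
    rw [genQuery1_self]
    rfl
  · refine ⟨Equiv.subLeft (c - r₁ * (-1) ^ (share true b).2.toNat), fun r₂ => ?_⟩
    have := genQuery1_not I (I.gpow c) true b r₁ r₂
    rw [Bool.not_true] at this
    rw [this, ← I.gpow_sub]
    congr 1
    simp [recvExp]
    ring

theorem genRes_eq (H : Hash sig) {z : ℕ} (m : Fin z → Bool → Str sig)
    (y : Fin z → Bool → ZMod I.p) (C : I.Elt) (s b : Bool) (r₁ r₂ : ZMod I.p) :
    genRes I H C m y (genQuery1 I (share s b).1 r₁ (genQuery2 I C (share s b).2 r₂)) =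
      some (List.ofFn fun t i => (I.gpow (y t i), (H (I.bits
        (genQuery1 I (share s b).1 r₁ (genQuery2 I C (share s b).2 r₂) i ^ (y t i).val))).xor
          (m t i))) := by
  rw [genRes, if_neg]
  rw [genQuery1_mul]
  exact fun h => h rfl

/-- The protocol never aborts, and all parties obtain their outputs. -/
theorem execution_output (G : GroupScheme) (lam : ℕ) (x : Input sig) (H : Hash sig)
    (w : Str (G.coinLen lam)) (C : (G.inst lam w).Elt) (b : Bool)
    (r₁ r₂ : ZMod (G.inst lam w).p) (y : Fin x.z → Bool → ZMod (G.inst lam w).p) :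
    (execution G lam x H w C b r₁ r₂ y).output = some x.functionality := by
  -- Sender and receiver hash the same element since powers of `g` commute in the exponent; the two
  -- masks then cancel.
  simp only [execution, genRes_eq, Option.bind_some, oblFilter, List.getElem?_ofFn,
    Option.pure_def, Option.bind_eq_bind, Input.functionality, List.length_ofFn, Fin.is_lt,
    dif_pos, retrieve, genQuery1_self, recvExp, GroupDesc.gpow_pow_comm _ (y _ _)]
  congr 4
  funext j
  simp [Str.xor]

theorem protocol_eq (G : GroupScheme) (sig : ℕ → ℕ) (lam : ℕ) (x : Input (sig lam))
    (H : Hash (sig lam)) : protocol G sig lam x H =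
      (PMF.uniformOfFintype (Str (G.coinLen lam))).bind fun w =>
      (PMF.uniformOfFintype (G.inst lam w).Elt).bind fun C =>
      (PMF.uniformOfFintype Bool).bind fun b =>
      (PMF.uniformOfFintype (ZMod (G.inst lam w).p)).bind fun r₁ =>
      (PMF.uniformOfFintype (ZMod (G.inst lam w).p)).bind fun r₂ =>
      (PMF.uniformOfFintype (Fin x.z → Bool → ZMod (G.inst lam w).p)).map fun y =>
      execution G lam x H w C b r₁ r₂ y := rfl

/-- A ciphertext of `m` under the public key `β` and with randomness `y`, as a bit string. -/
def slot (H : Hash sig) (β : I.Elt) (m : Str sig) (y : ZMod I.p) : List Bool :=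
  I.bits (I.gpow y) ++ List.ofFn ((H (I.bits (β ^ y.val))).xor m)

/-- A random ciphertext of `m` under the public key `β`. -/
def realSlot (H : Hash sig) (β : I.Elt) (m : Str sig) : PMF (List Bool) :=
  (PMF.uniformOfFintype (ZMod I.p)).map (slot I H β m)

/-- A random group element and a random string. -/
def idealSlot (sig : ℕ) : PMF (List Bool) :=
  (PMF.uniformOfFintype (ZMod I.p)).bind fun y =>
    (PMF.uniformOfFintype (Str sig)).map fun u => I.bits (I.gpow y) ++ List.ofFn u

theorem length_slot (H : Hash sig) (β : I.Elt) (m : Str sig) (y : ZMod I.p) :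
    (slot I H β m y).length = e + sig := by
  simp [slot]

theorem length_realSlot {H : Hash sig} {β : I.Elt} {m : Str sig} {l : List Bool}
    (h : l ∈ (realSlot I H β m).support) : l.length = e + sig := by
  simp only [realSlot, PMF.support_map, Set.mem_image] at h
  obtain ⟨y, -, rfl⟩ := h
  exact length_slot I H β m y

theorem length_idealSlot {l : List Bool} (h : l ∈ (idealSlot I sig).support) :
    l.length = e + sig := by
  simp only [idealSlot, PMF.mem_support_bind_iff, PMF.support_map, Set.mem_image] at h
  obtain ⟨y, -, u, -, rfl⟩ := h
  simp

end DQMR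

/-! ### The list of ciphertexts as independent blocks -/

open DQMR

/-- The messages in the order in which they are encrypted, with their position in the pair. -/
def Input.slots {sig : ℕ} (x : Input sig) : List (Bool × Str sig) :=
  (List.ofFn fun t => [(false, x.m t false), (true, x.m t true)]).flatten

theorem Input.length_slots {sig : ℕ} (x : Input sig) : x.slots.length = x.z * 2 := by
  simp [Input.slots, List.length_flatten, List.map_ofFn, Function.comp_def]

namespace DQMR

variable {sig : ℕ}

/-- Each exponent is used in one ciphertext only, so for fixed keys the ciphertexts are independent.
The flat list of slots is the line along which the hybrid argument moves. -/
theorem map_slots (I : GroupDesc d e) (H : Hash sig) (β : Bool → I.Elt) (x : Input sig) :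
    (PMF.uniformOfFintype (Fin x.z → Bool → ZMod I.p)).map (fun y =>
        ((List.ofFn fun (t : Fin x.z) (i : Bool) => (I.gpow (y t i),
          (H (I.bits (β i ^ (y t i).val))).xor (x.m t i))).map (pairBits I)).flatten) =
      seqBits (x.slots.map fun p => realSlot I H (β p.1) p.2) := by
  have h1 := uniform_map_flatten x.z (α := Bool → ZMod I.p) fun t y =>
    slot I H (β false) (x.m t false) (y false) ++ slot I H (β true) (x.m t true) (y true)
  rw [Input.slots, List.map_flatten, seqBits_flatten, List.map_map, List.map_ofFn]
  have h2 : ∀ t : Fin x.z, (PMF.uniformOfFintype (Bool → ZMod I.p)).map (fun y =>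
      slot I H (β false) (x.m t false) (y false) ++ slot I H (β true) (x.m t true) (y true)) =
      seqBits [realSlot I H (β false) (x.m t false), realSlot I H (β true) (x.m t true)] := by
    intro t
    have := uniform_bool_pi_bind (α := ZMod I.p) fun y => PMF.pure
      (slot I H (β false) (x.m t false) (y false) ++ slot I H (β true) (x.m t true) (y true))
    refine Eq.trans this ?_
    simp [seqBits, realSlot, PMF.bind_map, PMF.map_comp, Function.comp_def, PMF.pure_map]
    rfl
  simp only [h2] at h1
  refine Eq.trans ?_ (h1.trans ?_)
  · congr 1
    funext y
    rw [List.map_ofFn]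
    congr 2
    funext t
    simp [pairBits, slot]
  · congr 1

end DQMR

theorem PMF.bind_rotate {α β γ δ : Type} (p : PMF α) (q : PMF β) (r : PMF γ)
    (f : α → β → γ → PMF δ) :
    (p.bind fun a => q.bind fun b => r.bind fun c => f a b c) =
      r.bind fun c => p.bind fun a => q.bind fun b => f a b c := by
  rw [PMF.bind_comm r p]
  congr 1
  funext a
  rw [PMF.bind_comm]

namespace DQMR

variable {G : GroupScheme} {lam sig : ℕ}

/-! ### The sender -/

/-- Two random exponents as a bit string. -/
def expPair {d e : ℕ} (I : GroupDesc d e) (lam : ℕ) : PMF (List Bool) :=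
  (PMF.uniformOfFintype (ZMod I.p)).bind fun y₀ =>
    (PMF.uniformOfFintype (ZMod I.p)).map fun y₁ => I.expBits lam y₀ ++ I.expBits lam y₁

/-- The law of the sender's view, in terms of its own input only. -/
def senderLaw (G : GroupScheme) (lam z : ℕ) (msg : List Bool) : PMF (List Bool) :=
  (PMF.uniformOfFintype (Str (G.coinLen lam))).bind fun w =>
  (PMF.uniformOfFintype (ZMod (G.inst lam w).p)).bind fun c =>
  (PMF.uniformOfFintype (ZMod (G.inst lam w).p)).bind fun a =>
  (seqBits (List.replicate z (expPair (G.inst lam w) lam))).map fun ys =>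
    msg ++ (List.ofFn w ++ (G.inst lam w).bits ((G.inst lam w).gpow c) ++ ys) ++
      ((G.inst lam w).bits ((G.inst lam w).gpow a) ++
        (G.inst lam w).bits ((G.inst lam w).gpow c / (G.inst lam w).gpow a))

theorem genQuery1_true {d e : ℕ} (I : GroupDesc d e) (C : I.Elt) (s b : Bool) (r₁ r₂ : ZMod I.p) :
    genQuery1 I (share s b).1 r₁ (genQuery2 I C (share s b).2 r₂) true =
      C / genQuery1 I (share s b).1 r₁ (genQuery2 I C (share s b).2 r₂) false := by
  rw [eq_div_iff_mul_eq', mul_comm, genQuery1_mul]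

theorem execution_viewS (x : Input sig) (H : Hash sig) (w : Str (G.coinLen lam))
    (C : (G.inst lam w).Elt) (b : Bool) (r₁ r₂ : ZMod (G.inst lam w).p)
    (y : Fin x.z → Bool → ZMod (G.inst lam w).p) :
    (execution G lam x H w C b r₁ r₂ y).viewS =
      x.msgBits ++ (List.ofFn w ++ (G.inst lam w).bits C ++ (List.ofFn fun t =>
        (G.inst lam w).expBits lam (y t false) ++ (G.inst lam w).expBits lam (y t true)).flatten) ++
      ((G.inst lam w).bits (genQuery1 (G.inst lam w) (share x.s b).1 r₁
          (genQuery2 (G.inst lam w) C (share x.s b).2 r₂) false) ++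
        (G.inst lam w).bits (C / genQuery1 (G.inst lam w) (share x.s b).1 r₁
          (genQuery2 (G.inst lam w) C (share x.s b).2 r₂) false)) := by
  rw [← genQuery1_true]
  rfl

theorem map_expPairs {d e : ℕ} (I : GroupDesc d e) (lam z : ℕ) :
    (PMF.uniformOfFintype (Fin z → Bool → ZMod I.p)).map (fun y => (List.ofFn fun t =>
      I.expBits lam (y t false) ++ I.expBits lam (y t true)).flatten) =
      seqBits (List.replicate z (expPair I lam)) := by
  have h := uniform_map_flatten z (α := Bool → ZMod I.p) fun _ y =>
    I.expBits lam (y false) ++ I.expBits lam (y true)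
  have hpair : (PMF.uniformOfFintype (Bool → ZMod I.p)).map (fun y =>
      I.expBits lam (y false) ++ I.expBits lam (y true)) = expPair I lam :=
    uniform_bool_pi_bind (α := ZMod I.p) fun y => PMF.pure
      (I.expBits lam (y false) ++ I.expBits lam (y true))
  rw [h, hpair, List.ofFn_const]

/-- The second key is `C` divided by the first, and the first is uniform for any given `C`, `b` and
`r₁`. No trace of `v`, `s` or the oracle is left. -/
theorem viewS_law (sig : ℕ → ℕ) (x : Input (sig lam)) (H : Hash (sig lam)) :
    (protocol G sig lam x H).map Execution.viewS = senderLaw G lam x.z x.msgBits := by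
  rw [protocol_eq, senderLaw, PMF.map_bind]
  congr 1
  funext w
  rw [GroupDesc.uniform_bind_gpow, PMF.map_bind]
  congr 1
  funext c
  rw [PMF.map_bind]
  -- The coins `b` and `r₁` do not occur on the right: averaging over `r₂` gives the same law for
  -- each of their values.
  refine Eq.trans ?_ (PMF.bind_const (PMF.uniformOfFintype Bool) _)
  congr 1
  funext b
  rw [PMF.map_bind]
  refine Eq.trans ?_ (PMF.bind_const (PMF.uniformOfFintype (ZMod (G.inst lam w).p)) _)
  congr 1
  funext r₁
  obtain ⟨f, hf⟩ := exists_equiv_query (G.inst lam w) c x.s b r₁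
  rw [PMF.map_bind]
  refine Eq.trans ?_ (uniform_bind_equiv f _)
  congr 1
  funext r₂
  rw [← map_expPairs, PMF.map_comp, PMF.map_comp]
  congr 1
  funext y
  simp only [Function.comp, execution_viewS, hf]

/-! ### The first server -/

/-- The part of the view of the first server that precedes the ciphertexts. -/
def serverHeader {d e : ℕ} (I : GroupDesc d e) (lam : ℕ) (idx : List Bool) (β : Bool → I.Elt)
    (b : Bool) (r₁ : ZMod I.p) : List Bool :=
  idx ++ (I.pub lam ++ I.bits (β false * β true)) ++ ([b] ++ I.expBits lam r₁) ++
    (I.bits (β b / I.gpow r₁) ++ I.bits (β (!b) * I.gpow r₁))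

/-- A view of the first server, for given public keys `β` of the receiver and given ciphertexts. -/
def serverView {d e : ℕ} (I : GroupDesc d e) (lam : ℕ) (idx : List Bool) (β : Bool → I.Elt)
    (body : PMF (List Bool)) : PMF (List Bool) :=
  (PMF.uniformOfFintype Bool).bind fun b =>
  (PMF.uniformOfFintype (ZMod I.p)).bind fun r₁ =>
  body.map fun l => serverHeader I lam idx β b r₁ ++ l

/-- For fixed `s`, `b` and `r₁`, the pair `(c, r₂)` corresponds bijectively to the pair of exponents
of the two keys. Hence the keys are uniform, independent of each other and of everything else that
the first server holds. -/
theorem queries_law {d e : ℕ} (I : GroupDesc d e) {γ : Type} (s b : Bool) (r₁ : ZMod I.p)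
    (Ψ : (Bool → I.Elt) → PMF γ) :
    ((PMF.uniformOfFintype (ZMod I.p)).bind fun c => (PMF.uniformOfFintype (ZMod I.p)).bind
      fun r₂ => Ψ (genQuery1 I (share s b).1 r₁ (genQuery2 I (I.gpow c) (share s b).2 r₂))) =
    (PMF.uniformOfFintype (ZMod I.p)).bind fun a₀ => (PMF.uniformOfFintype (ZMod I.p)).bind
      fun a₁ => Ψ fun i => I.gpow (bif i then a₁ else a₀) := by
  have h : ∀ c, ((PMF.uniformOfFintype (ZMod I.p)).bind
      fun r₂ => Ψ (genQuery1 I (share s b).1 r₁ (genQuery2 I (I.gpow c) (share s b).2 r₂))) =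
      (PMF.uniformOfFintype (ZMod I.p)).bind fun a => Ψ fun i =>
        I.gpow (bif i then c - a else a) := by
    intro c
    obtain ⟨f, hf⟩ := exists_equiv_query I c s b r₁
    refine Eq.trans ?_ (uniform_bind_equiv f _)
    congr 1
    funext r₂
    congr 1
    funext i
    cases i
    · exact hf r₂
    · rw [genQuery1_true, hf]
      exact (I.gpow_sub _ _).symm
  simp only [h]
  rw [PMF.bind_comm]
  congr 1
  funext a
  -- The second exponent is `c - a`, which is uniform for fixed `a`.
  exact uniform_bind_equiv (Equiv.subRight a) fun a₁ => Ψ fun i => I.gpow (bif i then a₁ else a)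

/-- Everything the first server sees is determined by the keys, its own coins and the ciphertexts:
`C` is the product of the keys, and `δ` is recovered by undoing its own step. -/
theorem execution_viewP1 (x : Input sig) (H : Hash sig) (w : Str (G.coinLen lam))
    (C : (G.inst lam w).Elt) (b : Bool) (r₁ r₂ : ZMod (G.inst lam w).p)
    (y : Fin x.z → Bool → ZMod (G.inst lam w).p) {β : Bool → (G.inst lam w).Elt}
    (hβ : genQuery1 (G.inst lam w) (share x.s b).1 r₁
      (genQuery2 (G.inst lam w) C (share x.s b).2 r₂) = β) :
    (execution G lam x H w C b r₁ r₂ y).viewP1 =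
      serverHeader (G.inst lam w) lam (indexBits x.v x.z) β b r₁ ++
      ((List.ofFn fun (t : Fin x.z) (i : Bool) => ((G.inst lam w).gpow (y t i),
          (H ((G.inst lam w).bits (β i ^ (y t i).val))).xor (x.m t i))).map
        (pairBits (G.inst lam w))).flatten := by
  have hC : β false * β true = C := by rw [← hβ, genQuery1_mul]
  have h1 := genQuery2_false (G.inst lam w) C (share x.s b).1 (share x.s b).2 r₁ r₂
  have h2 := genQuery2_true (G.inst lam w) C (share x.s b).1 (share x.s b).2 r₁ r₂
  have h3 := genRes_eq (G.inst lam w) H x.m y C x.s b r₁ r₂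
  rw [hβ] at h1 h2 h3
  rw [serverHeader, hC, execution]
  simp only [hβ, h1, h2, h3, Option.elim_some]
  rfl

theorem viewP1_law (sig : ℕ → ℕ) (x : Input (sig lam)) (H : Hash (sig lam)) :
    (protocol G sig lam x H).map Execution.viewP1 =
      (PMF.uniformOfFintype (Str (G.coinLen lam))).bind fun w =>
      (PMF.uniformOfFintype (ZMod (G.inst lam w).p)).bind fun a₀ =>
      (PMF.uniformOfFintype (ZMod (G.inst lam w).p)).bind fun a₁ =>
      serverView (G.inst lam w) lam (indexBits x.v x.z)
        (fun i => (G.inst lam w).gpow (bif i then a₁ else a₀))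
        (seqBits (x.slots.map fun p => realSlot (G.inst lam w) H
          ((G.inst lam w).gpow (bif p.1 then a₁ else a₀)) p.2)) := by
  rw [protocol_eq, PMF.map_bind]
  congr 1
  funext w
  rw [GroupDesc.uniform_bind_gpow]
  simp only [PMF.map_bind, PMF.map_comp, Function.comp_def]
  let Ψ : Bool → ZMod (G.inst lam w).p → (Bool → (G.inst lam w).Elt) → PMF (List Bool) :=
    fun b r₁ β => (seqBits (x.slots.map fun p => realSlot (G.inst lam w) H (β p.1) p.2)).map
      fun l => serverHeader (G.inst lam w) lam (indexBits x.v x.z) β b r₁ ++ l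
  have hy : ∀ c b r₁ r₂, (PMF.uniformOfFintype (Fin x.z → Bool → ZMod (G.inst lam w).p)).map
      (fun y => (execution G lam x H w ((G.inst lam w).gpow c) b r₁ r₂ y).viewP1) =
      Ψ b r₁ (genQuery1 (G.inst lam w) (share x.s b).1 r₁
        (genQuery2 (G.inst lam w) ((G.inst lam w).gpow c) (share x.s b).2 r₂)) := by
    intro c b r₁ r₂
    simp only [Ψ]
    rw [← map_slots, PMF.map_comp]
    congr 1
    funext y
    exact execution_viewP1 x H w _ b r₁ r₂ y rfl
  simp only [hy]
  rw [PMF.bind_comm]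
  refine Eq.trans ?_ (PMF.bind_rotate _ _ (PMF.uniformOfFintype Bool) _).symm
  congr 1
  funext b
  rw [PMF.bind_comm]
  refine Eq.trans ?_ (PMF.bind_rotate _ _ (PMF.uniformOfFintype (ZMod (G.inst lam w).p)) _).symm
  congr 1
  funext r₁
  exact queries_law _ _ _ _ _

/-! ### The second server -/

/-- The law of the second server's view. -/
def server2Law (G : GroupScheme) (lam : ℕ) : PMF (List Bool) :=
  (PMF.uniformOfFintype (Str (G.coinLen lam))).bind fun w =>
  (PMF.uniformOfFintype (ZMod (G.inst lam w).p)).bind fun c =>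
  (PMF.uniformOfFintype Bool).bind fun b =>
  (PMF.uniformOfFintype (ZMod (G.inst lam w).p)).map fun r =>
    (G.inst lam w).pub lam ++ (G.inst lam w).bits ((G.inst lam w).gpow c) ++
      ([b] ++ (G.inst lam w).expBits lam r)

theorem viewP2_law (sig : ℕ → ℕ) (x : Input (sig lam)) (H : Hash (sig lam)) :
    (protocol G sig lam x H).map Execution.viewP2 = server2Law G lam := by
  rw [protocol_eq, server2Law, PMF.map_bind]
  congr 1
  funext w
  rw [GroupDesc.uniform_bind_gpow, PMF.map_bind]
  congr 1
  funext c
  -- The share `s₂ = b ⊕ s` is a one-time pad encryption of `s`.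
  let f : Bool ≃ Bool := ⟨fun b => Bool.xor b x.s, fun b => Bool.xor b x.s, fun b => by simp,
    fun b => by simp⟩
  rw [PMF.map_bind]
  refine Eq.trans ?_ (uniform_bind_equiv f _)
  congr 1
  funext b
  rw [PMF.map_bind]
  refine Eq.trans ?_ (PMF.bind_const (PMF.uniformOfFintype (ZMod (G.inst lam w).p)) _)
  congr 1
  funext r₁
  rw [PMF.map_bind]
  refine Eq.trans ?_ (PMF.bind_pure_comp _ _)
  congr 1
  funext r₂
  rw [PMF.map_comp]
  exact PMF.map_const _ _

/-! ### The receiver -/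

/-- A view of the receiver, for given coins, given public key `A` for the message that it does not
request, and given ciphertext `o` of that message. -/
def recvView {d e : ℕ} (I : GroupDesc d e) (lam : ℕ) (H : Hash sig) (s : Bool) (m : Str sig)
    (A : I.Elt) (o : List Bool) (b : Bool) (r₁ r₂ y : ZMod I.p) : List Bool :=
  [s] ++ ([b] ++ I.expBits lam r₁ ++ I.expBits lam r₂) ++
    (I.pub lam ++ I.bits (A * I.gpow (recvExp I s b r₁ r₂))) ++
    (if s then o ++ slot I H (I.gpow (recvExp I s b r₁ r₂)) m y
      else slot I H (I.gpow (recvExp I s b r₁ r₂)) m y ++ o)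

/-- The law of the receiver's view, for given public key `A` and ciphertext `o`. -/
def recvLaw {d e : ℕ} (I : GroupDesc d e) (lam : ℕ) (H : Hash sig) (s : Bool) (m : Str sig)
    (A : I.Elt) (o : List Bool) : PMF (List Bool) :=
  (PMF.uniformOfFintype Bool).bind fun b =>
  (PMF.uniformOfFintype (ZMod I.p)).bind fun r₁ =>
  (PMF.uniformOfFintype (ZMod I.p)).bind fun r₂ =>
  (PMF.uniformOfFintype (ZMod I.p)).map fun y => recvView I lam H s m A o b r₁ r₂ y

/-- With `C` written as `g ^ (a + x)`, where `x` is the receiver's exponent, the unrequested key is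
`g ^ a`. The reduction can then put a challenge in its place and choose all coins of the receiver
itself. -/
theorem execution_viewR (x : Input sig) (H : Hash sig) (w : Str (G.coinLen lam))
    (a : ZMod (G.inst lam w).p) (b : Bool) (r₁ r₂ : ZMod (G.inst lam w).p)
    (y : Fin x.z → Bool → ZMod (G.inst lam w).p) :
    (execution G lam x H w ((G.inst lam w).gpow (a + recvExp (G.inst lam w) x.s b r₁ r₂))
      b r₁ r₂ y).viewR =
      recvView (G.inst lam w) lam H x.s (x.m x.v x.s) ((G.inst lam w).gpow a)
        (slot (G.inst lam w) H ((G.inst lam w).gpow a) (x.m x.v (!x.s)) (y x.v (!x.s)))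
        b r₁ r₂ (y x.v x.s) := by
  have hs := genQuery1_self (G.inst lam w) ((G.inst lam w).gpow
    (a + recvExp (G.inst lam w) x.s b r₁ r₂)) x.s b r₁ r₂
  have hn := genQuery1_not (G.inst lam w) ((G.inst lam w).gpow
    (a + recvExp (G.inst lam w) x.s b r₁ r₂)) x.s b r₁ r₂
  rw [← GroupDesc.gpow_sub, add_sub_cancel_right] at hn
  rw [recvView, ← GroupDesc.gpow_add]
  simp only [execution, genRes_eq, Option.bind_some, oblFilter,
    List.getElem?_ofFn, Fin.is_lt, dif_pos, Option.elim_some, pairBits, slot, ← hs, ← hn]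
  congr 1
  cases x.s <;> simp [share]

theorem map_viewR (x : Input sig) (H : Hash sig) (w : Str (G.coinLen lam))
    (a : ZMod (G.inst lam w).p) (b : Bool) (r₁ r₂ : ZMod (G.inst lam w).p) :
    (PMF.uniformOfFintype (Fin x.z → Bool → ZMod (G.inst lam w).p)).map (fun y =>
      (execution G lam x H w ((G.inst lam w).gpow (a + recvExp (G.inst lam w) x.s b r₁ r₂))
        b r₁ r₂ y).viewR) =
      (PMF.uniformOfFintype (ZMod (G.inst lam w).p)).bind fun y' =>
      (PMF.uniformOfFintype (ZMod (G.inst lam w).p)).map fun y =>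
      recvView (G.inst lam w) lam H x.s (x.m x.v x.s) ((G.inst lam w).gpow a)
        (slot (G.inst lam w) H ((G.inst lam w).gpow a) (x.m x.v (!x.s)) y') b r₁ r₂ y := by
  simp only [execution_viewR]
  -- Only the exponents of the `v`-th pair enter the view; integrating out the others removes `z`.
  refine Eq.trans (uniform_eval_bind (α := Bool → ZMod (G.inst lam w).p) x.v fun y => PMF.pure
      (recvView (G.inst lam w) lam H x.s (x.m x.v x.s) ((G.inst lam w).gpow a)
        (slot (G.inst lam w) H ((G.inst lam w).gpow a) (x.m x.v (!x.s)) (y (!x.s)))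
          b r₁ r₂ (y x.s))) ?_
  rw [uniform_bool_pi_bind]
  cases x.s
  · rw [PMF.bind_comm]
    rfl
  · rfl

theorem viewR_law (sig : ℕ → ℕ) (x : Input (sig lam)) (H : Hash (sig lam)) :
    (protocol G sig lam x H).map Execution.viewR =
      (PMF.uniformOfFintype (Str (G.coinLen lam))).bind fun w =>
      (PMF.uniformOfFintype (ZMod (G.inst lam w).p)).bind fun a =>
      (PMF.uniformOfFintype (ZMod (G.inst lam w).p)).bind fun y' =>
      recvLaw (G.inst lam w) lam H x.s (x.m x.v x.s) ((G.inst lam w).gpow a)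
        (slot (G.inst lam w) H ((G.inst lam w).gpow a) (x.m x.v (!x.s)) y') := by
  rw [protocol_eq, PMF.map_bind]
  congr 1
  funext w
  rw [GroupDesc.uniform_bind_gpow]
  simp only [PMF.map_bind, PMF.map_comp, Function.comp_def, recvLaw]
  rw [PMF.bind_comm]
  refine Eq.trans ?_ (PMF.bind_rotate _ _ (PMF.uniformOfFintype Bool) _).symm
  congr 1
  funext b
  rw [PMF.bind_comm]
  refine Eq.trans ?_ (PMF.bind_rotate _ _ (PMF.uniformOfFintype (ZMod (G.inst lam w).p)) _).symm
  congr 1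
  funext r₁
  rw [PMF.bind_comm]
  refine Eq.trans ?_ (PMF.bind_rotate _ _ (PMF.uniformOfFintype (ZMod (G.inst lam w).p)) _).symm
  congr 1
  funext r₂
  -- For fixed coins of the receiver, the exponent of `C` is shifted by the receiver's exponent.
  refine Eq.trans (uniform_bind_equiv (Equiv.addRight (recvExp (G.inst lam w) x.s b r₁ r₂))
    _).symm ?_
  congr 1
  funext a
  exact map_viewR x H w a b r₁ r₂

end DQMR

/-! ## The views as circuits -/

namespace Impl

variable {ι : Type} {Γ : Env ι} {y z : ι → List Bool} {G : GroupScheme} {lam sig : ℕ}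
  {w : ι → Str (G.coinLen lam)}

theorem runAlgorithm (D : Algorithm) {n : ℕ} (hy : Reads Γ y) (hn : ∀ i, (y i).length = n) :
    Impl Γ (fun i => D.run (Γ.O i) lam (y i)) (D lam n).size :=
  (ofCircuit (D lam n) hy).congr fun i => by rw [Algorithm.run, hn i]

/-- Run an algorithm on the output of a circuit. -/
theorem bindAlgorithm (D : Algorithm) {n s : ℕ} {P : ι → PMF (List Bool)}
    (hP : ∀ i, ∀ l ∈ (P i).support, l.length = n) (h : Impl Γ P s) :
    Impl Γ (fun i => (P i).bind (D.run (Γ.O i) lam)) (s + (D lam n).size + 1) :=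
  bindBits hP h (G := fun i => D.run (Γ.O i) lam) (runAlgorithm (lam := lam)
    (y := fun j : Σ _ : ι, {l : List Bool // l.length = n} => j.2.1) D Reads.extLast fun j => j.2.2)

theorem encrypt {H : ι → Hash sig} (hO : ∀ i, Γ.O i = (H i).oracle) (hℓ : Γ.ansLen = sig)
    (hlam : 0 < lam) (hp : Reads Γ fun i => (G.inst lam (w i)).pub lam)
    {β : ∀ i, (G.inst lam (w i)).Elt} (hβ : Reads Γ fun i => (G.inst lam (w i)).bits (β i))
    {m : ι → Str sig} (hm : Reads Γ fun i => List.ofFn (m i))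
    {r : ∀ i, ZMod (G.inst lam (w i)).p}
    (hr : Reads Γ fun i => (G.inst lam (w i)).expBits lam (r i)) :
    Impl Γ (fun i => PMF.pure (slot (G.inst lam (w i)) (H i) (β i) (m i) (r i)))
      (70 * G.unitSize lam ^ 2 + 20 * sig) := by
  refine ((letE (m := G.eltLen lam) (by simp) (gpow hp hlam hr)
    (letE (m := G.eltLen lam) (by simp) (pow hp.snoc hlam hβ.snoc hr.snoc)
    (letE (m := sig) (y := fun i => List.ofFn (H i ((G.inst lam (w i)).bits (β i ^ (r i).val))))
      (by simp) ((oracleCall (m := G.eltLen lam) Reads.last (by simp)).congr fun i =>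
        congrArg PMF.pure (congrFun (hO i) _))
    (letE (m := sig) (by simp) (xorStr Reads.last hm.snoc.snoc.snoc)
    (ret (m := G.eltLen lam + sig) (Reads.last.snoc.snoc.snoc.append Reads.last)
      (by simp)))))).mono ?_).congr fun i => rfl
  have h1 := G.lam_lt lam
  have h2 := G.eltLen_le lam
  simp only [Env.snoc, hℓ]
  nlinarith

theorem realSlot {H : ι → Hash sig} (hO : ∀ i, Γ.O i = (H i).oracle) (hℓ : Γ.ansLen = sig)
    (hlam : 0 < lam) (hp : Reads Γ fun i => (G.inst lam (w i)).pub lam)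
    {β : ∀ i, (G.inst lam (w i)).Elt} (hβ : Reads Γ fun i => (G.inst lam (w i)).bits (β i))
    (m : Str sig) :
    Impl Γ (fun i => realSlot (G.inst lam (w i)) (H i) (β i) m)
      (80 * G.unitSize lam ^ 2 + 30 * sig) := by
  refine ((bind (κ := fun i => ZMod (G.inst lam (w i)).p) (m := lam + 1) (he := by simp)
    (G := fun i r => PMF.pure (slot (G.inst lam (w i)) (H i) (β i) m r)) (sampleExp hp hlam)
    (letE (y := fun _ => List.ofFn m) (m := sig) (by simp) (constBits _ (List.ofFn m))
    (encrypt (H := fun j : Σ i, ZMod (G.inst lam (w i)).p => H j.1) (fun j => hO j.1) hℓ hlam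
      (w := fun j : Σ i, ZMod (G.inst lam (w i)).p => w j.1) hp.ext.snoc
      (β := fun j : Σ i, ZMod (G.inst lam (w i)).p => β j.1) hβ.ext.snoc
      (m := fun _ => m) Reads.last (r := fun j => j.2) Reads.extLast.snoc))).mono ?_).congr
      fun i => rfl
  have h1 := G.lam_lt lam
  simp only [List.length_ofFn]
  nlinarith

theorem idealSlot (sig : ℕ) (hlam : 0 < lam) (hp : Reads Γ fun i => (G.inst lam (w i)).pub lam) :
    Impl Γ (fun i => idealSlot (G.inst lam (w i)) sig) (80 * G.unitSize lam ^ 2 + 30 * sig) := by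
  refine ((bind (κ := fun i => ZMod (G.inst lam (w i)).p) (m := lam + 1) (he := by simp)
    (G := fun i r => (PMF.pure ((G.inst lam (w i)).bits ((G.inst lam (w i)).gpow r))).bind
      fun l => ((PMF.uniformOfFintype (Str sig)).map fun u => List.ofFn u).map (l ++ ·))
    (sampleExp hp hlam)
    (append (P := fun j : Σ i, ZMod (G.inst lam (w i)).p =>
        PMF.pure ((G.inst lam (w j.1)).bits ((G.inst lam (w j.1)).gpow j.2)))
      (m := G.eltLen lam) (by simp)
      (gpow (w := fun j : Σ i, ZMod (G.inst lam (w i)).p => w j.1) hp.ext hlam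
        (r := fun j => j.2) Reads.extLast)
      (coins _ sig))).mono ?_).congr fun i => ?_
  · have h1 := G.lam_lt lam
    nlinarith
  · simp [DQMR.idealSlot, PMF.map_comp, Function.comp_def]

theorem serverView {n s : ℕ} (hlam : 0 < lam) (hp : Reads Γ fun i => (G.inst lam (w i)).pub lam)
    (hy : Reads Γ y) (hn : ∀ i, (y i).length = n) {β : ∀ i, Bool → (G.inst lam (w i)).Elt}
    (h0 : Reads Γ fun i => (G.inst lam (w i)).bits (β i false))
    (h1 : Reads Γ fun i => (G.inst lam (w i)).bits (β i true))
    {body : ι → PMF (List Bool)} (hbody : Impl Γ body s) :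
    Impl Γ (fun i => serverView (G.inst lam (w i)) lam (y i) (β i) (body i))
      (s + 150 * G.unitSize lam ^ 2 + n) := by
  let κ₁ := Σ _ : ι, Bool
  let κ₂ := Σ j : κ₁, ZMod (G.inst lam (w j.1)).p
  let w' : κ₂ → Str (G.coinLen lam) := fun j => w j.1.1
  have hb : ∀ (j : κ₂) (c : Bool),
      (if c then (G.inst lam (w' j)).bits (β j.1.1 true) else
        (G.inst lam (w' j)).bits (β j.1.1 false)) = (G.inst lam (w' j)).bits (β j.1.1 c) := by
    intro j c
    cases c <;> rfl
  refine ((bind (κ := fun _ => Bool) (m := 1) (he := by simp)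
    (G := fun i b => (PMF.uniformOfFintype (ZMod (G.inst lam (w i)).p)).bind fun r =>
      (PMF.pure (serverHeader (G.inst lam (w i)) lam (y i) (β i) b r)).bind
        fun l => (body i).map (l ++ ·)) (coin Γ)
    (bind (κ := fun j : κ₁ => ZMod (G.inst lam (w j.1)).p) (m := lam + 1) (he := by simp)
    (G := fun j r => (PMF.pure (serverHeader (G.inst lam (w j.1)) lam (y j.1) (β j.1) j.2 r)).bind
        fun l => (body j.1).map (l ++ ·))
    (sampleExp (w := fun j : κ₁ => w j.1) hp.ext hlam)
    (letE (m := G.eltLen lam) (by simp) (mul (w := w') hp.ext.ext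
      (a := fun j : κ₂ => β j.1.1 false) (b := fun j => β j.1.1 true) h0.ext.ext h1.ext.ext)
    (letE (m := G.eltLen lam) (by simp) (gpow (w := w') hp.ext.ext.snoc hlam
      (r := fun j : κ₂ => j.2) Reads.extLast.snoc)
    (letE (m := G.eltLen lam) (y := fun j : κ₂ => (G.inst lam (w' j)).bits (β j.1.1 j.1.2))
      (by simp)
      ((mux (m := G.eltLen lam) (c := fun j : κ₂ => j.1.2) Reads.extLast.ext.snoc.snoc
        h1.ext.ext.snoc.snoc h0.ext.ext.snoc.snoc (by simp) (by simp)).congr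
        fun j => congrArg PMF.pure (hb j j.1.2))
    (letE (m := G.eltLen lam) (y := fun j : κ₂ => (G.inst lam (w' j)).bits (β j.1.1 (!j.1.2)))
      (by simp)
      ((mux (m := G.eltLen lam) (c := fun j : κ₂ => j.1.2) Reads.extLast.ext.snoc.snoc.snoc
        h0.ext.ext.snoc.snoc.snoc h1.ext.ext.snoc.snoc.snoc (by simp) (by simp)).congr
        fun j => by rw [← hb j (!j.1.2)]; cases j.1.2 <;> rfl)
    (letE (m := G.eltLen lam) (by simp) (div (w := w') hp.ext.ext.snoc.snoc.snoc.snoc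
      (a := fun j : κ₂ => β j.1.1 j.1.2) Reads.last.snoc
      (b := fun j => (G.inst lam (w' j)).gpow j.2) Reads.last.snoc.snoc)
    (letE (m := G.eltLen lam) (by simp) (mul (w := w') hp.ext.ext.snoc.snoc.snoc.snoc.snoc
      (a := fun j : κ₂ => β j.1.1 (!j.1.2)) Reads.last.snoc
      (b := fun j => (G.inst lam (w' j)).gpow j.2) Reads.last.snoc.snoc.snoc)
    (append (m := n + (G.descLen lam + (lam + 1) + G.eltLen lam + G.eltLen lam) + (1 + (lam + 1)) +
        (G.eltLen lam + G.eltLen lam))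
      (P := fun j : κ₂ => PMF.pure (serverHeader (G.inst lam (w j.1.1)) lam (y j.1.1) (β j.1.1)
        j.1.2 j.2)) ?_
      (ret (m := n + (G.descLen lam + (lam + 1) + G.eltLen lam + G.eltLen lam) + (1 + (lam + 1)) +
        (G.eltLen lam + G.eltLen lam)) (((hy.ext.ext.snoc.snoc.snoc.snoc.snoc.snoc.append
        (hp.ext.ext.snoc.snoc.snoc.snoc.snoc.snoc.append Reads.last.snoc.snoc.snoc.snoc.snoc)).append
        (Reads.extLast.ext.snoc.snoc.snoc.snoc.snoc.snoc.append
          Reads.extLast.snoc.snoc.snoc.snoc.snoc.snoc)).append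
        (Reads.last.snoc.append Reads.last)) ?_)
      hbody.weakenExt.weakenExt.weaken.weaken.weaken.weaken.weaken.weaken))))))))).mono ?_).congr
      fun i => ?_
  · intro j l hl
    simp only [PMF.support_pure, Set.mem_singleton_iff] at hl
    subst hl
    simp [serverHeader, hn]
    ring
  · intro j
    simp [hn]
    ring
  · have h1 := G.lam_lt lam
    have h2 := G.eltLen_le lam
    have h3 : G.descLen lam ≤ G.unitSize lam := by simp only [GroupScheme.unitSize]; omega
    nlinarith
  · simp [DQMR.serverView]

theorem recvLaw {H : ι → Hash sig} (hO : ∀ i, Γ.O i = (H i).oracle) (hℓ : Γ.ansLen = sig)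
    (hlam : 0 < lam) (hp : Reads Γ fun i => (G.inst lam (w i)).pub lam)
    {sel : ι → Bool} (hsel : Reads Γ fun i => [sel i])
    {m : ι → Str sig} (hm : Reads Γ fun i => List.ofFn (m i))
    {A : ∀ i, (G.inst lam (w i)).Elt} (hA : Reads Γ fun i => (G.inst lam (w i)).bits (A i))
    (hy : Reads Γ y) (hn : ∀ i, (y i).length = G.eltLen lam + sig) :
    Impl Γ (fun i => recvLaw (G.inst lam (w i)) lam (H i) (sel i) (m i) (A i) (y i))
      (300 * G.unitSize lam ^ 2 + 60 * sig) := by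
  let κ₁ := Σ _ : ι, Bool
  let κ₂ := Σ j : κ₁, ZMod (G.inst lam (w j.1)).p
  let κ₃ := Σ j : κ₂, ZMod (G.inst lam (w j.1.1)).p
  let κ₄ := Σ j : κ₃, ZMod (G.inst lam (w j.1.1.1)).p
  let w' : κ₄ → Str (G.coinLen lam) := fun j => w j.1.1.1.1
  let X : ∀ j : κ₄, (G.inst lam (w' j)).Elt := fun j =>
    (G.inst lam (w' j)).gpow (recvExp (G.inst lam (w' j)) (sel j.1.1.1.1) j.1.1.1.2 j.1.1.2 j.1.2)
  -- The factor `g ^ (±r₁)`: the inverse is selected when the second share is 1.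
  let t : ∀ j : κ₄, (G.inst lam (w' j)).Elt := fun j =>
    if Bool.xor j.1.1.1.2 (sel j.1.1.1.1) then ((G.inst lam (w' j)).gpow j.1.1.2)⁻¹ else
      (G.inst lam (w' j)).gpow j.1.1.2
  let sl : κ₄ → List Bool := fun j =>
    slot (G.inst lam (w' j)) (H j.1.1.1.1) (X j) (m j.1.1.1.1) j.2
  have hX : ∀ j, (G.inst lam (w' j)).gpow j.1.2 * t j = X j := by
    intro j
    simp only [X, t, recvExp, share]
    rw [GroupDesc.gpow_add]
    cases Bool.xor j.1.1.1.2 (sel j.1.1.1.1) <;> simp [GroupDesc.gpow_neg]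
  have hsl : ∀ j, (sl j).length = G.eltLen lam + sig := fun j => length_slot _ _ _ _ _
  have hp4 := hp.ext (κ := fun _ => Bool) (e := fun _ b => [b]) (m := 1) (he := by simp)
    |>.ext (κ := fun j => ZMod (G.inst lam (w j.1)).p)
      (e := fun j r => (G.inst lam (w j.1)).expBits lam r) (m := lam + 1) (he := by simp)
    |>.ext (κ := fun j => ZMod (G.inst lam (w j.1.1)).p)
      (e := fun j r => (G.inst lam (w j.1.1)).expBits lam r) (m := lam + 1) (he := by simp)
    |>.ext (κ := fun j => ZMod (G.inst lam (w j.1.1.1)).p)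
      (e := fun j r => (G.inst lam (w j.1.1.1)).expBits lam r) (m := lam + 1) (he := by simp)
  refine ((bind (κ := fun _ => Bool) (m := 1) (he := by simp)
    (G := fun i b => (PMF.uniformOfFintype (ZMod (G.inst lam (w i)).p)).bind fun r₁ =>
      (PMF.uniformOfFintype (ZMod (G.inst lam (w i)).p)).bind fun r₂ =>
      (PMF.uniformOfFintype (ZMod (G.inst lam (w i)).p)).bind fun r =>
      PMF.pure (recvView (G.inst lam (w i)) lam (H i) (sel i) (m i) (A i) (y i) b r₁ r₂ r)) (coin Γ)
    (bind (κ := fun j : κ₁ => ZMod (G.inst lam (w j.1)).p) (m := lam + 1) (he := by simp)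
    (G := fun j r₁ => (PMF.uniformOfFintype (ZMod (G.inst lam (w j.1)).p)).bind fun r₂ =>
      (PMF.uniformOfFintype (ZMod (G.inst lam (w j.1)).p)).bind fun r =>
      PMF.pure (recvView (G.inst lam (w j.1)) lam (H j.1) (sel j.1) (m j.1) (A j.1) (y j.1)
        j.2 r₁ r₂ r))
    (sampleExp (w := fun j : κ₁ => w j.1) hp.ext hlam)
    (bind (κ := fun j : κ₂ => ZMod (G.inst lam (w j.1.1)).p) (m := lam + 1) (he := by simp)
    (G := fun j r₂ => (PMF.uniformOfFintype (ZMod (G.inst lam (w j.1.1)).p)).bind fun r =>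
      PMF.pure (recvView (G.inst lam (w j.1.1)) lam (H j.1.1) (sel j.1.1) (m j.1.1) (A j.1.1)
        (y j.1.1) j.1.2 j.2 r₂ r))
    (sampleExp (w := fun j : κ₂ => w j.1.1) hp.ext.ext hlam)
    (bind (κ := fun j : κ₃ => ZMod (G.inst lam (w j.1.1.1)).p) (m := lam + 1) (he := by simp)
    (G := fun j r =>
      PMF.pure (recvView (G.inst lam (w j.1.1.1)) lam (H j.1.1.1) (sel j.1.1.1) (m j.1.1.1)
        (A j.1.1.1) (y j.1.1.1) j.1.1.2 j.1.2 j.2 r))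
    (sampleExp (w := fun j : κ₃ => w j.1.1.1) hp.ext.ext.ext hlam)
    (letE (m := G.eltLen lam) (by simp) (gpow (w := w') hp4 hlam
      (r := fun j : κ₄ => j.1.1.2) Reads.extLast.ext.ext)
    (letE (m := G.eltLen lam) (by simp) (inv (w := w') hp4.snoc
      (a := fun j : κ₄ => (G.inst lam (w' j)).gpow j.1.1.2) Reads.last)
    (letE (m := G.eltLen lam) (by simp) (gpow (w := w') hp4.snoc.snoc hlam
      (r := fun j : κ₄ => j.1.2) Reads.extLast.ext.snoc.snoc)
    (letE (m := 1) (by simp) (xorBit (a := fun j : κ₄ => j.1.1.1.2) (b := fun j => sel j.1.1.1.1)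
      Reads.extLast.ext.ext.ext.snoc.snoc.snoc hsel.ext.ext.ext.ext.snoc.snoc.snoc)
    (letE (m := G.eltLen lam) (y := fun j : κ₄ => (G.inst lam (w' j)).bits (t j)) (by simp)
      ((mux (m := G.eltLen lam) (c := fun j : κ₄ => Bool.xor j.1.1.1.2 (sel j.1.1.1.1)) Reads.last
        Reads.last.snoc.snoc Reads.last.snoc.snoc.snoc (by simp) (by simp)).congr fun j => by
        simp only [t]; split_ifs <;> rfl)
    (letE (m := G.eltLen lam) (y := fun j : κ₄ => (G.inst lam (w' j)).bits (X j)) (by simp)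
      ((mul (w := w') hp4.snoc.snoc.snoc.snoc.snoc
        (a := fun j : κ₄ => (G.inst lam (w' j)).gpow j.1.2) Reads.last.snoc.snoc
        (b := t) Reads.last).congr fun j => by rw [hX])
    (letE (m := G.eltLen lam) (by simp) (mul (w := w') hp4.snoc.snoc.snoc.snoc.snoc.snoc
      (a := fun j : κ₄ => A j.1.1.1.1) hA.ext.ext.ext.ext.snoc.snoc.snoc.snoc.snoc.snoc
      (b := X) Reads.last)
    (letE (m := G.eltLen lam + sig) (y := sl) hsl
      (encrypt (H := fun j : κ₄ => H j.1.1.1.1) (fun j => hO j.1.1.1.1) hℓ hlam (w := w')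
        hp4.snoc.snoc.snoc.snoc.snoc.snoc.snoc (β := X) Reads.last.snoc
        (m := fun j : κ₄ => m j.1.1.1.1) hm.ext.ext.ext.ext.snoc.snoc.snoc.snoc.snoc.snoc.snoc
        (r := fun j : κ₄ => j.2) Reads.extLast.snoc.snoc.snoc.snoc.snoc.snoc.snoc)
    (letE (m := 2 * (G.eltLen lam + sig)) (y := fun j : κ₄ => if sel j.1.1.1.1 then
        y j.1.1.1.1 ++ sl j else sl j ++ y j.1.1.1.1)
      (fun j => by split_ifs <;> simp [hsl, hn] <;> ring)
      (mux (m := 2 * (G.eltLen lam + sig)) (c := fun j : κ₄ => sel j.1.1.1.1)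
        hsel.ext.ext.ext.ext.snoc.snoc.snoc.snoc.snoc.snoc.snoc.snoc
        (hy.ext.ext.ext.ext.snoc.snoc.snoc.snoc.snoc.snoc.snoc.snoc.append Reads.last)
        (Reads.last.append hy.ext.ext.ext.ext.snoc.snoc.snoc.snoc.snoc.snoc.snoc.snoc)
        (fun j => by simp [hsl, hn]; ring) (fun j => by simp [hsl, hn]; ring))
    (ret (m := (1 + (1 + (lam + 1) + (lam + 1))) +
        (G.descLen lam + (lam + 1) + G.eltLen lam + G.eltLen lam) + 2 * (G.eltLen lam + sig))
      (((hsel.ext.ext.ext.ext.snoc.snoc.snoc.snoc.snoc.snoc.snoc.snoc.snoc.append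
        ((Reads.extLast.ext.ext.ext.snoc.snoc.snoc.snoc.snoc.snoc.snoc.snoc.snoc.append
          Reads.extLast.ext.ext.snoc.snoc.snoc.snoc.snoc.snoc.snoc.snoc.snoc).append
          Reads.extLast.ext.snoc.snoc.snoc.snoc.snoc.snoc.snoc.snoc.snoc)).append
        (hp4.snoc.snoc.snoc.snoc.snoc.snoc.snoc.snoc.snoc.append
          Reads.last.snoc.snoc)).append Reads.last) ?_)))))))))))))).mono ?_).congr fun i => ?_
  · intro j
    simp only [List.length_append, GroupDesc.length_pub, GroupDesc.length_bits,
      GroupDesc.length_expBits, List.length_singleton]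
    split_ifs <;> simp [hsl, hn] <;> ring
  · have h1 := G.lam_lt lam
    have h2 := G.eltLen_le lam
    have h3 : G.descLen lam ≤ G.unitSize lam := by simp only [GroupScheme.unitSize]; omega
    nlinarith
  · rfl

end Impl

/-! ## Replacing hash values by random strings -/

theorem lazySize_mono (n : ℕ) {S T : ℕ} (h : S ≤ T) : lazySize n S ≤ lazySize n T := by
  unfold lazySize
  gcongr

namespace CDHIndex

variable {G : GroupScheme} {lam sig : ℕ}

/-- The index of the context `maskEnv`. -/
abbrev MaskIndex (G : GroupScheme) (lam sig : ℕ) : Type := CDHIndex G lam × Str sig × Hash sig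

/-- A CDH instance, a string, and oracle access to a hash function. -/
def maskEnv (G : GroupScheme) (lam sig : ℕ) : Env (MaskIndex G lam sig) where
  O i := i.2.2.oracle
  X i := i.1.bits ++ List.ofFn i.2.1
  ansLen := sig
  len := G.descLen lam + (lam + 1) + G.eltLen lam + G.eltLen lam + G.eltLen lam + sig
  length_O i q := by simp [Hash.oracle]
  length_X i := by rw [List.length_append, length_bits, List.length_ofFn]

/-- `F` describes a game as a function of a CDH instance and of the string used as mask. If one
circuit runs the game with the instance and the mask on its wires, then the mask given by the hash
of the solution may be exchanged for a random one. -/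
theorem close_of_impl {F : CDHIndex G lam → Str sig → Hash sig → PMF (List Bool)} {ε : ℝ≥0∞}
    {S B : ℕ} {X Y : Hash sig → PMF (List Bool)}
    (h : Impl (maskEnv G lam sig) (fun i => F i.1 i.2.1 i.2.2) S)
    (hX : ∀ H, X H = (law G lam).bind fun k => F k (H k.sol) H)
    (hY : ∀ H, Y H = (law G lam).bind fun k => (PMF.uniformOfFintype (Str sig)).bind
        fun u => F k u H)
    (hB : 3 * sig + lazySize sig S + 1 ≤ B)
    (hε : ∀ c' : Circuit, c'.size ≤ B → G.cdhSucc c' lam ≤ ε) (v : List Bool) :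
    Close (S * ε) (∫⁻ H, X H v ∂(randomOracle sig)) (∫⁻ H, Y H v ∂(randomOracle sig)) := by
  obtain ⟨c, hc, hF⟩ := h
  have hc' : 3 * sig + lazySize sig c.size + 1 ≤ B :=
    le_trans (by have := lazySize_mono sig hc; omega) hB
  have hF' : ∀ k u (H : Hash sig), F k u H = c.eval H.oracle (k.bits ++ List.ofFn u) :=
    fun k u H => (hF (k, u, H)).symm
  simp only [hX, hY, hF']
  exact (close_mask c hc' hε v).mono (by gcongr)

theorem reads_pub : Reads (maskEnv G lam sig) fun i => (G.inst lam i.1.1).pub lam := by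
  refine Eq.subst (motive := Reads _) ?_
    ((Reads.self (maskEnv G lam sig)).take (G.descLen lam + (lam + 1) + G.eltLen lam))
  funext i
  simp only [maskEnv, bits, List.append_assoc]
  exact List.take_left' (GroupDesc.length_pub _ _)

theorem reads_drop_pub : Reads (maskEnv G lam sig) fun i =>
    (G.inst lam i.1.1).bits ((G.inst lam i.1.1).gpow i.1.2.1) ++
      ((G.inst lam i.1.1).bits ((G.inst lam i.1.1).gpow i.1.2.2) ++ List.ofFn i.2.1) := by
  refine Eq.subst (motive := Reads _) ?_
    ((Reads.self (maskEnv G lam sig)).drop (G.descLen lam + (lam + 1) + G.eltLen lam))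
  funext i
  simp only [maskEnv, bits, List.append_assoc]
  exact List.drop_left' (GroupDesc.length_pub _ _)

theorem reads_left : Reads (maskEnv G lam sig) fun i =>
    (G.inst lam i.1.1).bits ((G.inst lam i.1.1).gpow i.1.2.1) := by
  refine Eq.subst (motive := Reads _) ?_ (reads_drop_pub.take (G.eltLen lam))
  funext i
  exact List.take_left' (GroupDesc.length_bits _ _)

theorem reads_right : Reads (maskEnv G lam sig) fun i =>
    (G.inst lam i.1.1).bits ((G.inst lam i.1.1).gpow i.1.2.2) := by
  refine Eq.subst (motive := Reads _) ?_
    ((reads_drop_pub.drop (G.eltLen lam)).take (G.eltLen lam))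
  funext i
  rw [List.drop_left' (GroupDesc.length_bits _ _)]
  exact List.take_left' (GroupDesc.length_bits _ _)

theorem reads_mask : Reads (maskEnv G lam sig) fun i => List.ofFn i.2.1 := by
  refine Eq.subst (motive := Reads _) ?_
    ((reads_drop_pub.drop (G.eltLen lam)).drop (G.eltLen lam))
  funext i
  rw [List.drop_left' (GroupDesc.length_bits _ _), List.drop_left' (GroupDesc.length_bits _ _)]

end CDHIndex

/-- Exclusive or with `m` is an involution; this is the one-time pad that hides a message once its
mask is random. -/
theorem Str.xor_bind {sig : ℕ} {γ : Type} (m : Str sig) (f : Str sig → PMF γ) :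
    ((PMF.uniformOfFintype (Str sig)).bind fun u => f (u.xor m)) =
      (PMF.uniformOfFintype (Str sig)).bind f :=
  uniform_bind_equiv (⟨fun u => u.xor m, fun u => u.xor m,
    fun u => by funext i; simp [Str.xor], fun u => by funext i; simp [Str.xor]⟩ :
      Str sig ≃ Str sig) f

namespace DQMR

variable {G : GroupScheme} {lam sig : ℕ}

/-! ### The receiver -/

/-- The law of the receiver's view when the message that it does not request is masked by a random
string. -/
def idealRecvLaw (G : GroupScheme) (lam : ℕ) (H : Hash sig) (s : Bool) (m : Str sig) :
    PMF (List Bool) :=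
  (PMF.uniformOfFintype (Str (G.coinLen lam))).bind fun w =>
  (PMF.uniformOfFintype (ZMod (G.inst lam w).p)).bind fun a =>
  (PMF.uniformOfFintype (ZMod (G.inst lam w).p)).bind fun y' =>
  (PMF.uniformOfFintype (Str sig)).bind fun u =>
  recvLaw (G.inst lam w) lam H s m ((G.inst lam w).gpow a)
    ((G.inst lam w).bits ((G.inst lam w).gpow y') ++ List.ofFn u)

/-- The length of the receiver's view. -/
def recvLen (G : GroupScheme) (lam sig : ℕ) : ℕ :=
  1 + (1 + (lam + 1) + (lam + 1)) +
    (G.descLen lam + (lam + 1) + G.eltLen lam + G.eltLen lam) + 2 * (G.eltLen lam + sig)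

theorem length_recvLaw {w : Str (G.coinLen lam)} {H : Hash sig} {s : Bool} {m : Str sig}
    {A : (G.inst lam w).Elt} {o : List Bool} (ho : o.length = G.eltLen lam + sig) {l : List Bool}
    (hl : l ∈ (recvLaw (G.inst lam w) lam H s m A o).support) : l.length = recvLen G lam sig := by
  simp only [recvLaw, PMF.mem_support_bind_iff, PMF.support_map, Set.mem_image] at hl
  obtain ⟨b, -, r₁, -, r₂, -, y, -, rfl⟩ := hl
  simp only [recvView, recvLen, List.length_append, GroupDesc.length_pub, GroupDesc.length_bits,
    GroupDesc.length_expBits, List.length_singleton]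
  split_ifs <;> simp [ho, length_slot] <;> ring

/-- The CDH instance supplies the unrequested key `g ^ a` and the first component `g ^ y'` of the
ciphertext under it. All else is computable from public data, the receiver's coins and hard-wired
messages, so that one application of `close_of_impl` suffices. -/
theorem close_recv (D : Algorithm) (hlam : 0 < lam) (x : Input sig) {B : ℕ} {ε : ℝ≥0∞} {S : ℕ}
    (hS : 400 * G.unitSize lam ^ 2 + 100 * sig + (D lam (recvLen G lam sig)).size ≤ S)
    (hB : 3 * sig + lazySize sig S + 1 ≤ B)
    (hε : ∀ c' : Circuit, c'.size ≤ B → G.cdhSucc c' lam ≤ ε) (v : List Bool) :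
    Close (S * ε)
      (∫⁻ H, (((PMF.uniformOfFintype (Str (G.coinLen lam))).bind fun w =>
        (PMF.uniformOfFintype (ZMod (G.inst lam w).p)).bind fun a =>
        (PMF.uniformOfFintype (ZMod (G.inst lam w).p)).bind fun y' =>
        recvLaw (G.inst lam w) lam H x.s (x.m x.v x.s) ((G.inst lam w).gpow a)
          (slot (G.inst lam w) H ((G.inst lam w).gpow a) (x.m x.v (!x.s)) y')).bind
          (D.run H.oracle lam)) v ∂(randomOracle sig))
      (∫⁻ H, ((idealRecvLaw G lam H x.s (x.m x.v x.s)).bind (D.run H.oracle lam)) v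
        ∂(randomOracle sig)) := by
  let F : CDHIndex G lam → Str sig → Hash sig → PMF (List Bool) := fun k u H =>
    (recvLaw (G.inst lam k.1) lam H x.s (x.m x.v x.s) ((G.inst lam k.1).gpow k.2.1)
      ((G.inst lam k.1).bits ((G.inst lam k.1).gpow k.2.2) ++
        List.ofFn (u.xor (x.m x.v (!x.s))))).bind (D.run H.oracle lam)
  have hview : Impl (CDHIndex.maskEnv G lam sig) (fun i => recvLaw (G.inst lam i.1.1) lam i.2.2
      x.s (x.m x.v x.s) ((G.inst lam i.1.1).gpow i.1.2.1)
      ((G.inst lam i.1.1).bits ((G.inst lam i.1.1).gpow i.1.2.2) ++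
        List.ofFn (i.2.1.xor (x.m x.v (!x.s))))) (320 * G.unitSize lam ^ 2 + 90 * sig) := by
    refine Impl.mono (Impl.letE (Γ := CDHIndex.maskEnv G lam sig) (m := 1)
      (y := fun _ => [x.s]) (by simp) (Impl.constBits _ [x.s])
      (Impl.letE (m := sig) (y := fun _ => List.ofFn (x.m x.v x.s)) (by simp)
        (Impl.constBits _ (List.ofFn (x.m x.v x.s)))
      (Impl.letE (m := sig) (y := fun _ => List.ofFn (x.m x.v (!x.s))) (by simp)
        (Impl.constBits _ (List.ofFn (x.m x.v (!x.s))))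
      (Impl.letE (m := sig) (y := fun i => List.ofFn (i.2.1.xor (x.m x.v (!x.s)))) (by simp)
        (Impl.xorStr CDHIndex.reads_mask.snoc.snoc.snoc Reads.last)
      (Impl.recvLaw (sig := sig) (w := fun i => i.1.1) (H := fun i => i.2.2) (fun i => rfl) rfl hlam
        CDHIndex.reads_pub.snoc.snoc.snoc.snoc
        (sel := fun _ => x.s) Reads.last.snoc.snoc.snoc
        (m := fun _ => x.m x.v x.s) Reads.last.snoc.snoc
        (A := fun i => (G.inst lam i.1.1).gpow i.1.2.1) CDHIndex.reads_left.snoc.snoc.snoc.snoc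
        (CDHIndex.reads_right.snoc.snoc.snoc.snoc.append Reads.last)
        (fun i => by simp)))))) ?_
    have h1 := G.lam_lt lam
    simp only [List.length_ofFn, List.length_singleton]
    nlinarith
  have himpl : Impl (CDHIndex.maskEnv G lam sig) (fun i => F i.1 i.2.1 i.2.2) S := by
    have hrun := Impl.bindAlgorithm (lam := lam) D (n := recvLen G lam sig)
      (fun i l hl => length_recvLaw (by simp) hl) hview
    have h1 := G.lam_lt lam
    have h2 : 320 * G.unitSize lam ^ 2 + 90 * sig + (D lam (recvLen G lam sig)).size + 1 ≤ S :=
      le_trans (by nlinarith) hS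
    exact (hrun.mono h2).congr fun i => rfl
  refine CDHIndex.close_of_impl himpl (fun H => ?_) (fun H => ?_) hB hε v
  -- The hashed element `(g ^ a) ^ y'` is the solution `g ^ (a * y')` of the instance.
  · simp only [F, CDHIndex.law_bind, PMF.bind_bind, slot, CDHIndex.sol, GroupDesc.gpow_mul]
  · simp only [F, CDHIndex.law_bind, idealRecvLaw, PMF.bind_bind]
    refine congrArg _ (funext fun w => congrArg _ (funext fun a => congrArg _ (funext fun y => ?_)))
    exact (Str.xor_bind (x.m x.v (!x.s)) fun u => (recvLaw (G.inst lam w) lam H x.s (x.m x.v x.s)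
      ((G.inst lam w).gpow a) ((G.inst lam w).bits ((G.inst lam w).gpow y) ++
        List.ofFn u)).bind (D.run H.oracle lam)).symm

/-! ### The first server -/

theorem serverView_bind {d e : ℕ} (I : GroupDesc d e) (lam : ℕ) (idx : List Bool)
    (β : Bool → I.Elt) {α : Type} (P : PMF α) (Q : α → PMF (List Bool)) :
    serverView I lam idx β (P.bind Q) = P.bind fun a => serverView I lam idx β (Q a) := by
  simp only [serverView, PMF.map_bind]
  rw [PMF.bind_comm P]
  congr 1
  funext b
  rw [PMF.bind_comm P]

/-- The view of the first server when `n` ciphertexts hide random strings and the remaining ones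
hide the messages of the list `L`. -/
def mixedLaw (G : GroupScheme) (lam : ℕ) (idx : List Bool) (n : ℕ) (L : List (Bool × Str sig))
    (H : Hash sig) : PMF (List Bool) :=
  (PMF.uniformOfFintype (Str (G.coinLen lam))).bind fun w =>
  (PMF.uniformOfFintype (ZMod (G.inst lam w).p)).bind fun a₀ =>
  (PMF.uniformOfFintype (ZMod (G.inst lam w).p)).bind fun a₁ =>
  serverView (G.inst lam w) lam idx (fun i => (G.inst lam w).gpow (bif i then a₁ else a₀))
    (seqBits (List.replicate n (idealSlot (G.inst lam w) sig) ++ L.map fun p =>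
      realSlot (G.inst lam w) H ((G.inst lam w).gpow (bif p.1 then a₁ else a₀)) p.2))

/-- A random pair of public keys may be drawn with the key at a given position first. -/
theorem serverView_keys {d e : ℕ} (I : GroupDesc d e) (lam : ℕ) (idx : List Bool) (c : Bool)
    (B : (Bool → I.Elt) → ZMod I.p → PMF (List Bool)) :
    ((PMF.uniformOfFintype (ZMod I.p)).bind fun a => (PMF.uniformOfFintype (ZMod I.p)).bind fun y =>
      (PMF.uniformOfFintype (ZMod I.p)).bind fun a' =>
        serverView I lam idx (fun i => I.gpow (if i = c then a else a'))
          (B (fun i => I.gpow (if i = c then a else a')) y)) =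
    (PMF.uniformOfFintype (ZMod I.p)).bind fun a₀ => (PMF.uniformOfFintype (ZMod I.p)).bind fun a₁ =>
        serverView I lam idx (fun i => I.gpow (bif i then a₁ else a₀))
          ((PMF.uniformOfFintype (ZMod I.p)).bind (B fun i => I.gpow (bif i then a₁ else a₀))) := by
  simp only [serverView_bind]
  have hkeys : ∀ a a' : ZMod I.p, (fun i => I.gpow (if i = c then a else a')) =
      fun i => I.gpow (bif i then (bif c then a else a') else (bif c then a' else a)) := by
    intro a a'
    funext i
    cases i <;> cases c <;> rfl
  simp only [hkeys]
  have hswap : ∀ a : ZMod I.p, _ = _ := fun a => PMF.bind_comm (PMF.uniformOfFintype (ZMod I.p))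
    (PMF.uniformOfFintype (ZMod I.p)) fun y a' => serverView I lam idx
      (fun i => I.gpow (bif i then (bif c then a else a') else (bif c then a' else a)))
      (B (fun i => I.gpow (bif i then (bif c then a else a') else (bif c then a' else a))) y)
  simp only [hswap]
  -- For `c = false` the key drawn first is already the first one of the pair; for `c = true` the
  -- two draws are exchanged.
  cases c
  · rfl
  · exact PMF.bind_comm _ _ _

/-- The length of the first server's view, for an index of length `k` and `n` ciphertexts. -/
def serverLen (G : GroupScheme) (lam sig k n : ℕ) : ℕ :=
  k + (G.descLen lam + (lam + 1) + G.eltLen lam + G.eltLen lam) + (1 + (lam + 1)) +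
    (G.eltLen lam + G.eltLen lam) + n * (G.eltLen lam + sig)

theorem length_serverView {w : Str (G.coinLen lam)} {idx : List Bool}
    {β : Bool → (G.inst lam w).Elt} {P : List (PMF (List Bool))}
    (hP : ∀ p ∈ P, ∀ y ∈ p.support, y.length = G.eltLen lam + sig) {l : List Bool}
    (hl : l ∈ (serverView (G.inst lam w) lam idx β (seqBits P)).support) :
    l.length = serverLen G lam sig idx.length P.length := by
  simp only [serverView, PMF.mem_support_bind_iff, PMF.support_map, Set.mem_image] at hl
  obtain ⟨b, -, r₁, -, y, hy, rfl⟩ := hl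
  simp only [serverHeader, serverLen, List.length_append, GroupDesc.length_pub,
    GroupDesc.length_bits, GroupDesc.length_expBits, List.length_singleton, seqBits_length hP y hy]

/-- A bound on the circuits that produce the view of the first server from its keys. -/
def serverSize (G : GroupScheme) (lam sig k n : ℕ) : ℕ :=
  n * (80 * G.unitSize lam ^ 2 + 30 * sig + 1) + 300 * G.unitSize lam ^ 2 + 60 * sig + 5 * k

/-- The laws of the ciphertexts, for public keys `β`: `n` of them hide random strings, the next
one is `o`, and the remaining ones hide the messages of the list `L`. -/
def mixedBody {d e : ℕ} (I : GroupDesc d e) (H : Hash sig) (β : Bool → I.Elt) (n : ℕ)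
    (o : List Bool) (L : List (Bool × Str sig)) : List (PMF (List Bool)) :=
  List.replicate n (idealSlot I sig) ++ PMF.pure o :: L.map fun q => realSlot I H (β q.1) q.2

theorem length_mixedBody {d e : ℕ} (I : GroupDesc d e) (H : Hash sig) (β : Bool → I.Elt) (n : ℕ)
    (o : List Bool) (L : List (Bool × Str sig)) :
    (mixedBody I H β n o L).length = n + 1 + L.length := by
  simp only [mixedBody, List.length_append, List.length_replicate, List.length_cons,
    List.length_map]
  ring

theorem length_of_mem_mixedBody {d e : ℕ} {I : GroupDesc d e} {H : Hash sig} {β : Bool → I.Elt}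
    {n : ℕ} {o : List Bool} {L : List (Bool × Str sig)} (ho : o.length = e + sig) :
    ∀ q ∈ mixedBody I H β n o L, ∀ y ∈ q.support, y.length = e + sig := by
  intro q hq y hy
  simp only [mixedBody, List.mem_append, List.mem_replicate, List.mem_cons, List.mem_map] at hq
  rcases hq with ⟨-, rfl⟩ | rfl | ⟨q, -, rfl⟩
  · exact length_idealSlot _ hy
  · simp only [PMF.support_pure, Set.mem_singleton_iff] at hy
    rw [hy, ho]
  · exact length_realSlot _ hy

theorem _root_.Impl.ciphertexts {ι : Type} {Γ : Env ι} {w : ι → Str (G.coinLen lam)}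
    {H : ι → Hash sig} (hO : ∀ i, Γ.O i = (H i).oracle) (hℓ : Γ.ansLen = sig)
    (hlam : 0 < lam) (hp : Reads Γ fun i => (G.inst lam (w i)).pub lam)
    {β : ∀ i, Bool → (G.inst lam (w i)).Elt}
    (hβ : ∀ c, Reads Γ fun i => (G.inst lam (w i)).bits (β i c))
    {o : ι → List Bool} (ho : Reads Γ o) (hlen : ∀ i, (o i).length = G.eltLen lam + sig) (n : ℕ)
    (L : List (Bool × Str sig)) :
    Impl Γ (fun i => seqBits (mixedBody (G.inst lam (w i)) (H i) (β i) n (o i) L))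
      ((n + 1 + L.length) * (80 * G.unitSize lam ^ 2 + 30 * sig + 1)) := by
  have h1 := G.eltLen_le lam
  have h2 := G.lam_lt lam
  refine ((Impl.seq (P := List.replicate n
      ((fun i => idealSlot (G.inst lam (w i)) sig : ι → PMF (List Bool)), G.eltLen lam + sig) ++
      (fun i => PMF.pure (o i), G.eltLen lam + sig) ::
      L.map fun q => (fun i => realSlot (G.inst lam (w i)) (H i) (β i q.1) q.2,
        G.eltLen lam + sig)) (k := 80 * G.unitSize lam ^ 2 + 30 * sig) ?_ ?_).mono
      (le_of_eq ?_)).congr fun i => ?_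
  · intro p hp i y hy
    simp only [List.mem_append, List.mem_replicate, List.mem_cons, List.mem_map] at hp
    rcases hp with ⟨-, rfl⟩ | rfl | ⟨q, -, rfl⟩
    · exact length_idealSlot _ hy
    · simp only [PMF.support_pure, Set.mem_singleton_iff] at hy
      rw [hy, hlen]
    · exact length_realSlot _ hy
  · intro p hmem
    simp only [List.mem_append, List.mem_replicate, List.mem_cons, List.mem_map] at hmem
    rcases hmem with ⟨-, rfl⟩ | rfl | ⟨q, -, rfl⟩
    · exact Impl.idealSlot sig hlam hp
    · exact (Impl.ret ho hlen).mono (by nlinarith)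
    · exact Impl.realSlot hO hℓ hlam hp (hβ q.1) q.2
  · simp only [List.length_append, List.length_replicate, List.length_cons, List.length_map]
    ring
  · simp [mixedBody, Function.comp_def]

theorem _root_.Impl.mixedView {ι : Type} {Γ : Env ι} {w : ι → Str (G.coinLen lam)}
    {H : ι → Hash sig} (hO : ∀ i, Γ.O i = (H i).oracle) (hℓ : Γ.ansLen = sig)
    (hlam : 0 < lam) (hp : Reads Γ fun i => (G.inst lam (w i)).pub lam) {idx : List Bool}
    (hidx : Reads Γ fun _ => idx) {β : ∀ i, Bool → (G.inst lam (w i)).Elt}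
    (hβ : ∀ c, Reads Γ fun i => (G.inst lam (w i)).bits (β i c))
    {o : ι → List Bool} (ho : Reads Γ o) (hlen : ∀ i, (o i).length = G.eltLen lam + sig) (n : ℕ)
    (L : List (Bool × Str sig)) :
    Impl Γ (fun i => serverView (G.inst lam (w i)) lam idx (β i)
        (seqBits (mixedBody (G.inst lam (w i)) (H i) (β i) n (o i) L)))
      ((n + 1 + L.length) * (80 * G.unitSize lam ^ 2 + 30 * sig + 1) +
        150 * G.unitSize lam ^ 2 + idx.length) :=
  Impl.serverView hlam hp hidx (fun _ => rfl) (hβ false) (hβ true)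
    (Impl.ciphertexts hO hℓ hlam hp hβ ho hlen n L)

/-- The CDH instance supplies the key at position `p.1` and the first component of the ciphertext at
the current position. The exponent `a'` of the other key is drawn by the reduction. The later
ciphertexts need the public keys only, not their exponents, and the earlier ones are already random.
-/
theorem close_mixed_step (D : Algorithm) (hlam : 0 < lam) (idx : List Bool) (n : ℕ)
    (p : Bool × Str sig) (L : List (Bool × Str sig)) {B : ℕ} {ε : ℝ≥0∞} {S : ℕ}
    (hS : serverSize G lam sig idx.length (n + 1 + L.length) +
      (D lam (serverLen G lam sig idx.length (n + 1 + L.length))).size ≤ S)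
    (hB : 3 * sig + lazySize sig S + 1 ≤ B)
    (hε : ∀ c' : Circuit, c'.size ≤ B → G.cdhSucc c' lam ≤ ε) (v : List Bool) :
    Close (S * ε)
      (∫⁻ H, ((mixedLaw G lam idx n (p :: L) H).bind (D.run H.oracle lam)) v ∂(randomOracle sig))
      (∫⁻ H, ((mixedLaw G lam idx (n + 1) L H).bind (D.run H.oracle lam)) v
        ∂(randomOracle sig)) := by
  let F : CDHIndex G lam → Str sig → Hash sig → PMF (List Bool) := fun k u H =>
    ((PMF.uniformOfFintype (ZMod (G.inst lam k.1).p)).bind fun a' =>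
      serverView (G.inst lam k.1) lam idx
        (fun i => (G.inst lam k.1).gpow (if i = p.1 then k.2.1 else a'))
        (seqBits (mixedBody (G.inst lam k.1) H
          (fun i => (G.inst lam k.1).gpow (if i = p.1 then k.2.1 else a')) n
          ((G.inst lam k.1).bits ((G.inst lam k.1).gpow k.2.2) ++
            List.ofFn (u.xor p.2)) L))).bind (D.run H.oracle lam)
  have hview : Impl (CDHIndex.maskEnv G lam sig)
      (fun i => (PMF.uniformOfFintype (ZMod (G.inst lam i.1.1).p)).bind fun a' =>
        serverView (G.inst lam i.1.1) lam idx
          (fun c => (G.inst lam i.1.1).gpow (if c = p.1 then i.1.2.1 else a'))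
          (seqBits (mixedBody (G.inst lam i.1.1) i.2.2
            (fun c => (G.inst lam i.1.1).gpow (if c = p.1 then i.1.2.1 else a')) n
            ((G.inst lam i.1.1).bits ((G.inst lam i.1.1).gpow i.1.2.2) ++
              List.ofFn (i.2.1.xor p.2)) L)))
      ((n + 1 + L.length) * (80 * G.unitSize lam ^ 2 + 30 * sig + 1) +
        250 * G.unitSize lam ^ 2 + 30 * sig + 4 * idx.length) := by
    have hK := G.lam_lt lam
    -- The position `p.1` is hard-wired, so the choice between challenge key and own key costs no
    -- gate.
    have hread : ∀ {Γ : Env (Σ i : CDHIndex.MaskIndex G lam sig, ZMod (G.inst lam i.1.1).p)},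
        Reads Γ (fun j => (G.inst lam j.1.1.1).bits ((G.inst lam j.1.1.1).gpow j.1.1.2.1)) →
        Reads Γ (fun j => (G.inst lam j.1.1.1).bits ((G.inst lam j.1.1.1).gpow j.2)) →
        ∀ c, Reads Γ fun j => (G.inst lam j.1.1.1).bits
          ((G.inst lam j.1.1.1).gpow (if c = p.1 then j.1.1.2.1 else j.2)) := by
      intro Γ h1 h2 c
      by_cases hc : c = p.1
      · simpa only [if_pos hc] using h1
      · simpa only [if_neg hc] using h2
    refine Impl.mono (Impl.letE (Γ := CDHIndex.maskEnv G lam sig) (m := idx.length)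
      (y := fun _ => idx) (by simp) (Impl.constBits _ idx)
      (Impl.letE (m := sig) (y := fun _ => List.ofFn p.2) (by simp)
        (Impl.constBits _ (List.ofFn p.2))
      (Impl.letE (m := sig) (y := fun i => List.ofFn (i.2.1.xor p.2)) (by simp)
        (Impl.xorStr CDHIndex.reads_mask.snoc.snoc Reads.last)
      (Impl.bind (κ := fun i : CDHIndex.MaskIndex G lam sig => ZMod (G.inst lam i.1.1).p)
        (m := lam + 1) (he := by simp)
        (Impl.sampleExp (w := fun i : CDHIndex.MaskIndex G lam sig => i.1.1)
          CDHIndex.reads_pub.snoc.snoc.snoc hlam)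
      (Impl.letE (m := G.eltLen lam) (y := fun j => (G.inst lam j.1.1.1).bits
          ((G.inst lam j.1.1.1).gpow j.2)) (by simp)
        (Impl.gpow (w := fun j : Σ i : CDHIndex.MaskIndex G lam sig,
          ZMod (G.inst lam i.1.1).p => j.1.1.1) CDHIndex.reads_pub.snoc.snoc.snoc.ext hlam
          (r := fun j => j.2) Reads.extLast)
      (Impl.mixedView (sig := sig) (w := fun j : Σ i : CDHIndex.MaskIndex G lam sig,
          ZMod (G.inst lam i.1.1).p => j.1.1.1) (H := fun j => j.1.2.2) (fun _ => rfl) rfl hlam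
        CDHIndex.reads_pub.snoc.snoc.snoc.ext.snoc Reads.last.snoc.snoc.ext.snoc
        (β := fun j c => (G.inst lam j.1.1.1).gpow (if c = p.1 then j.1.1.2.1 else j.2))
        (hread CDHIndex.reads_left.snoc.snoc.snoc.ext.snoc Reads.last)
        (o := fun j => (G.inst lam j.1.1.1).bits ((G.inst lam j.1.1.1).gpow j.1.1.2.2) ++
            List.ofFn (j.1.2.1.xor p.2))
        (CDHIndex.reads_right.snoc.snoc.snoc.ext.snoc.append Reads.last.ext.snoc) (by simp)
        n L)))))) ?_
    · simp only [List.length_ofFn]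
      nlinarith
  have himpl : Impl (CDHIndex.maskEnv G lam sig) (fun i => F i.1 i.2.1 i.2.2) S := by
    have hrun := Impl.bindAlgorithm (lam := lam) D
      (n := serverLen G lam sig idx.length (n + 1 + L.length)) (fun i l hl => ?_) hview
    · have h1 := G.lam_lt lam
      have h2 : (n + 1 + L.length) * (80 * G.unitSize lam ^ 2 + 30 * sig + 1) +
          250 * G.unitSize lam ^ 2 + 30 * sig + 4 * idx.length +
          (D lam (serverLen G lam sig idx.length (n + 1 + L.length))).size + 1 ≤ S := by
        refine le_trans ?_ hS
        unfold serverSize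
        nlinarith
      exact (hrun.mono h2).congr fun i => rfl
    · rw [PMF.mem_support_bind_iff] at hl
      obtain ⟨a', -, hl⟩ := hl
      exact (length_serverView (length_of_mem_mixedBody (by simp)) hl).trans
        (by rw [length_mixedBody])
  refine CDHIndex.close_of_impl himpl (fun H => ?_) (fun H => ?_) hB hε v
  · rw [mixedLaw, CDHIndex.law_bind, PMF.bind_bind]
    congr 1
    funext w
    -- The exponents are drawn in the order of the reduction: challenge key, challenge ciphertext,
    -- other key.
    have hk := serverView_keys (G.inst lam w) lam idx p.1 fun β y =>
      seqBits (mixedBody (G.inst lam w) H β n (slot (G.inst lam w) H (β p.1) p.2 y) L)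
    simp only [F, ← PMF.bind_bind]
    congr 1
    refine Eq.trans ?_ (hk.symm.trans ?_)
    · congr 1; funext a₀; congr 1; funext a₁
      congr 1
      simp only [mixedBody, List.map_cons]
      rw [← seqBits_append_bind]
      rfl
    · congr 1; funext a; congr 1; funext y
      simp only [slot, CDHIndex.sol, GroupDesc.gpow_mul, if_pos]
  · rw [mixedLaw, CDHIndex.law_bind, PMF.bind_bind]
    congr 1
    funext w
    have hk := serverView_keys (G.inst lam w) lam idx p.1 fun β y =>
      (PMF.uniformOfFintype (Str sig)).bind fun u => seqBits (mixedBody (G.inst lam w) H β n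
        ((G.inst lam w).bits ((G.inst lam w).gpow y) ++ List.ofFn u) L)
    simp only [F, ← PMF.bind_bind]
    congr 1
    refine Eq.trans ?_ (hk.symm.trans ?_)
    · congr 1; funext a₀; congr 1; funext a₁
      congr 1
      -- With a random mask the current block is an ideal one, and it is counted as the last of `n +
      -- 1` ideal blocks.
      simp only [mixedBody, ← seqBits_append_bind, List.replicate_succ', List.append_assoc]
      rfl
    · congr 1; funext a; congr 1; funext y
      simp only [serverView_bind]
      rw [PMF.bind_comm]
      exact (Str.xor_bind p.2 fun u => (PMF.uniformOfFintype (ZMod (G.inst lam w).p)).bind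
        fun a' => serverView (G.inst lam w) lam idx
          (fun i => (G.inst lam w).gpow (if i = p.1 then a else a'))
          (seqBits (mixedBody (G.inst lam w) H
            (fun i => (G.inst lam w).gpow (if i = p.1 then a else a')) n
            ((G.inst lam w).bits ((G.inst lam w).gpow y) ++ List.ofFn u) L))).symm

/-- Telescoping over the ciphertexts, each of which costs `S * ε`. -/
theorem close_mixed (D : Algorithm) (hlam : 0 < lam) (idx : List Bool) (n : ℕ)
    (L : List (Bool × Str sig)) {B : ℕ} {ε : ℝ≥0∞} {S : ℕ}
    (hS : serverSize G lam sig idx.length (n + L.length) +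
      (D lam (serverLen G lam sig idx.length (n + L.length))).size ≤ S)
    (hB : 3 * sig + lazySize sig S + 1 ≤ B)
    (hε : ∀ c' : Circuit, c'.size ≤ B → G.cdhSucc c' lam ≤ ε) (v : List Bool) :
    Close (L.length * (S * ε))
      (∫⁻ H, ((mixedLaw G lam idx n L H).bind (D.run H.oracle lam)) v ∂(randomOracle sig))
      (∫⁻ H, ((mixedLaw G lam idx (n + L.length) [] H).bind (D.run H.oracle lam)) v
        ∂(randomOracle sig)) := by
  induction L generalizing n with
  | nil => exact (Close.refl _).mono zero_le
  | cons p L ih =>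
    -- The total number of ciphertexts stays the same along the hybrids, hence one size bound `S`
    -- serves all steps.
    rw [List.length_cons, show n + (L.length + 1) = n + 1 + L.length by ring] at *
    refine ((close_mixed_step D hlam idx n p L hS hB hε v).trans (ih (n + 1) hS)).mono
      (le_of_eq ?_)
    push_cast
    ring

theorem viewP1_eq_mixedLaw (sig : ℕ → ℕ) (x : Input (sig lam)) (H : Hash (sig lam)) :
    (protocol G sig lam x H).map Execution.viewP1 =
      mixedLaw G lam (indexBits x.v x.z) 0 x.slots H := by
  rw [viewP1_law, mixedLaw]
  simp only [List.replicate_zero, List.nil_append]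

end DQMR

/-! ## The simulators as circuits -/

namespace Impl

variable {ι : Type} {Γ : Env ι} {G : GroupScheme} {lam sig : ℕ}

/-- Generate a group and go on. -/
theorem withGroup {F : ι → Str (G.coinLen lam) → PMF (List Bool)} {s : ℕ}
    (h : Impl ((Γ.ext (κ := fun _ => Str (G.coinLen lam)) (fun _ w => List.ofFn w)
      (G.coinLen lam) fun _ w => by simp).snoc (fun j => (G.inst lam j.2).pub lam)
      (G.descLen lam + (lam + 1) + G.eltLen lam) fun j => by simp)
      (fun j => F j.1 j.2) s) :
    Impl Γ (fun i => (PMF.uniformOfFintype (Str (G.coinLen lam))).bind (F i))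
      (s + 6 * G.unitSize lam) := by
  refine (bind (coins Γ (G.coinLen lam)) (letE (fun j => by simp)
    (gen (w := fun j : Σ _ : ι, Str (G.coinLen lam) => j.2) Reads.extLast) h)).mono ?_
  have h1 : G.coinLen lam + 1 ≤ G.unitSize lam := by simp only [GroupScheme.unitSize]; omega
  omega

theorem expPair {w : ι → Str (G.coinLen lam)} (hlam : 0 < lam)
    (hp : Reads Γ fun i => (G.inst lam (w i)).pub lam) :
    Impl Γ (fun i => expPair (G.inst lam (w i)) lam) (10 * G.unitSize lam) := by
  refine ((bind (κ := fun i => ZMod (G.inst lam (w i)).p) (m := lam + 1) (he := by simp)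
    (sampleExp hp hlam)
    (bind (κ := fun j : Σ i, ZMod (G.inst lam (w i)).p => ZMod (G.inst lam (w j.1)).p)
      (m := lam + 1) (he := by simp)
      (sampleExp (w := fun j : Σ i, ZMod (G.inst lam (w i)).p => w j.1) hp.ext hlam)
      (ret (m := 2 * (lam + 1)) (Reads.extLast.ext.append Reads.extLast)
        fun j => by simp; ring))).mono ?_).congr fun i => rfl
  have := G.lam_lt lam
  omega

theorem length_expPair {d e : ℕ} (I : GroupDesc d e) {l : List Bool}
    (hl : l ∈ (DQMR.expPair I lam).support) : l.length = 2 * (lam + 1) := by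
  simp only [DQMR.expPair, PMF.mem_support_bind_iff, PMF.support_map, Set.mem_image] at hl
  obtain ⟨a, -, b, -, rfl⟩ := hl
  simp
  ring

theorem senderLaw (hlam : 0 < lam) {msg : ι → List Bool} (hmsg : Reads Γ msg) {n : ℕ}
    (hn : ∀ i, (msg i).length = n) (z : ℕ) :
    Impl Γ (fun i => senderLaw G lam z (msg i))
      (n + 100 * G.unitSize lam ^ 2 + z * (20 * G.unitSize lam)) := by
  let κ₁ := Σ _ : ι, Str (G.coinLen lam)
  let κ₂ := Σ j : κ₁, ZMod (G.inst lam j.2).p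
  let κ₃ := Σ j : κ₂, ZMod (G.inst lam j.1.2).p
  let κ₄ := Σ _ : κ₃, {l : List Bool // l.length = z * (2 * (lam + 1))}
  let w' : κ₄ → Str (G.coinLen lam) := fun j => j.1.1.1.2
  refine ((withGroup
    (bind (κ := fun j : κ₁ => ZMod (G.inst lam j.2).p) (m := lam + 1) (he := by simp)
      (sampleExp (w := fun j : κ₁ => j.2) Reads.last hlam)
    (bind (κ := fun j : κ₂ => ZMod (G.inst lam j.1.2).p) (m := lam + 1) (he := by simp)
      (G := fun j a => (seqBits (List.replicate z (DQMR.expPair (G.inst lam j.1.2) lam))).map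
        fun ys => msg j.1.1 ++ (List.ofFn j.1.2 ++ (G.inst lam j.1.2).bits
            ((G.inst lam j.1.2).gpow j.2) ++ ys) ++
          ((G.inst lam j.1.2).bits ((G.inst lam j.1.2).gpow a) ++
            (G.inst lam j.1.2).bits ((G.inst lam j.1.2).gpow j.2 / (G.inst lam j.1.2).gpow a)))
      (sampleExp (w := fun j : κ₂ => j.1.2) Reads.last.ext hlam)
    (bindBits (P := fun j : κ₃ => seqBits (List.replicate z
        (DQMR.expPair (G.inst lam j.1.1.2) lam))) (m := z * (2 * (lam + 1)))
      (G := fun j ys => PMF.pure (msg j.1.1.1 ++ (List.ofFn j.1.1.2 ++ (G.inst lam j.1.1.2).bits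
            ((G.inst lam j.1.1.2).gpow j.1.2) ++ ys) ++
          ((G.inst lam j.1.1.2).bits ((G.inst lam j.1.1.2).gpow j.2) ++
            (G.inst lam j.1.1.2).bits
              ((G.inst lam j.1.1.2).gpow j.1.2 / (G.inst lam j.1.1.2).gpow j.2))))
      ?_
      ((seq (P := List.replicate z ((fun j : κ₃ => DQMR.expPair (G.inst lam j.1.1.2) lam :
          κ₃ → PMF (List Bool)), 2 * (lam + 1))) (k := 10 * G.unitSize lam) ?_ ?_).congr
        fun j => by rw [List.map_replicate])
    (letE (m := G.eltLen lam) (by simp)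
      (gpow (w := w') Reads.last.ext.ext.ext hlam (r := fun j : κ₄ => j.1.1.2)
        Reads.extLast.ext.ext)
    (letE (m := G.eltLen lam) (by simp)
      (gpow (w := w') Reads.last.ext.ext.ext.snoc hlam (r := fun j : κ₄ => j.1.2)
        Reads.extLast.ext.snoc)
    (letE (m := G.eltLen lam) (by simp)
      (div (w := w') Reads.last.ext.ext.ext.snoc.snoc
        (a := fun j : κ₄ => (G.inst lam (w' j)).gpow j.1.1.2) Reads.last.snoc
        (b := fun j : κ₄ => (G.inst lam (w' j)).gpow j.1.2) Reads.last)
    (ret (m := n + (G.coinLen lam + G.eltLen lam + z * (2 * (lam + 1))) +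
        (G.eltLen lam + G.eltLen lam))
      ((hmsg.ext.snoc.ext.ext.ext.snoc.snoc.snoc.append
        ((Reads.extLast.snoc.ext.ext.ext.snoc.snoc.snoc.append Reads.last.snoc.snoc).append
          Reads.extLast.snoc.snoc.snoc)).append (Reads.last.snoc.append Reads.last))
        ?_)))))))).mono ?_).congr fun i => rfl
  · intro j l hl
    have := seqBits_length (n := 2 * (lam + 1)) (fun p hp y hy => by
      rw [List.eq_of_mem_replicate hp] at hy
      exact length_expPair _ hy) l hl
    simpa using this
  · intro p hp j y hy
    rw [List.eq_of_mem_replicate hp] at hy ⊢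
    exact length_expPair _ hy
  · intro p hp
    rw [List.eq_of_mem_replicate hp]
    exact expPair (w := fun j : κ₃ => j.1.1.2) hlam Reads.last.ext.ext
  · intro j
    simp [hn, j.2.2]
    ring
  · have h1 := G.lam_lt lam
    have h2 := G.eltLen_le lam
    have h3 : G.coinLen lam ≤ G.unitSize lam := by simp only [GroupScheme.unitSize]; omega
    have h4 : z * (lam + 1) ≤ z * G.unitSize lam := by gcongr
    simp only [List.length_replicate]
    nlinarith

theorem server2Law (Γ : Env ι) (G : GroupScheme) (hlam : 0 < lam) :
    Impl Γ (fun _ => server2Law G lam) (100 * G.unitSize lam ^ 2) := by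
  let κ₁ := Σ _ : ι, Str (G.coinLen lam)
  let κ₂ := Σ j : κ₁, ZMod (G.inst lam j.2).p
  let κ₃ := Σ _ : κ₂, Bool
  let κ₄ := Σ j : κ₃, ZMod (G.inst lam j.1.1.2).p
  refine ((withGroup
    (bind (κ := fun j : κ₁ => ZMod (G.inst lam j.2).p) (m := lam + 1) (he := by simp)
      (sampleExp (w := fun j : κ₁ => j.2) Reads.last hlam)
    (bind (κ := fun _ : κ₂ => Bool) (m := 1) (he := by simp) (coin _)
    (bind (κ := fun j : κ₃ => ZMod (G.inst lam j.1.1.2).p) (m := lam + 1) (he := by simp)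
      (G := fun j r => PMF.pure ((G.inst lam j.1.1.2).pub lam ++
        (G.inst lam j.1.1.2).bits ((G.inst lam j.1.1.2).gpow j.1.2) ++
        ([j.2] ++ (G.inst lam j.1.1.2).expBits lam r)))
      (sampleExp (w := fun j : κ₃ => j.1.1.2) Reads.last.ext.ext hlam)
    (letE (m := G.eltLen lam) (by simp)
      (gpow (w := fun j : κ₄ => j.1.1.1.2) Reads.last.ext.ext.ext hlam
        (r := fun j : κ₄ => j.1.1.2) Reads.extLast.ext.ext)
    (ret (m := (G.descLen lam + (lam + 1) + G.eltLen lam) + G.eltLen lam + (1 + (lam + 1)))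
      ((Reads.last.ext.ext.ext.snoc.append Reads.last).append
        (Reads.extLast.ext.snoc.append Reads.extLast.snoc)) ?_)))))).mono ?_).congr fun i => rfl
  · intro j
    simp
    ring
  · have h1 := G.lam_lt lam
    have h2 := G.eltLen_le lam
    have h3 : G.descLen lam ≤ G.unitSize lam := by simp only [GroupScheme.unitSize]; omega
    nlinarith

theorem mixedLaw (Γ : Env ι) (G : GroupScheme) (sig : ℕ) (hlam : 0 < lam) {idx : ι → List Bool}
    (hidx : Reads Γ idx) {n : ℕ} (hn : ∀ i, (idx i).length = n) (H : ι → Hash sig) (k : ℕ) :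
    Impl Γ (fun i => mixedLaw G lam (idx i) k [] (H i))
      (n + 300 * G.unitSize lam ^ 2 + k * (80 * G.unitSize lam ^ 2 + 30 * sig + 1)) := by
  let κ₁ := Σ _ : ι, Str (G.coinLen lam)
  let κ₂ := Σ j : κ₁, ZMod (G.inst lam j.2).p
  let κ₃ := Σ j : κ₂, ZMod (G.inst lam j.1.2).p
  let w' : κ₃ → Str (G.coinLen lam) := fun j => j.1.1.2
  refine ((withGroup (G := G) (lam := lam)
    (F := fun i w => (PMF.uniformOfFintype (ZMod (G.inst lam w).p)).bind fun a₀ =>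
      (PMF.uniformOfFintype (ZMod (G.inst lam w).p)).bind fun a₁ =>
      DQMR.serverView (G.inst lam w) lam (idx i)
        (fun i => (G.inst lam w).gpow (bif i then a₁ else a₀))
        (seqBits (List.replicate k (DQMR.idealSlot (G.inst lam w) sig))))
    (bind (κ := fun j : κ₁ => ZMod (G.inst lam j.2).p) (m := lam + 1) (he := by simp)
      (sampleExp (w := fun j : κ₁ => j.2) Reads.last hlam)
    (bind (κ := fun j : κ₂ => ZMod (G.inst lam j.1.2).p) (m := lam + 1) (he := by simp)
      (G := fun j a₁ => DQMR.serverView (G.inst lam j.1.2) lam (idx j.1.1)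
        (fun i => (G.inst lam j.1.2).gpow (bif i then a₁ else j.2))
        (seqBits (List.replicate k (DQMR.idealSlot (G.inst lam j.1.2) sig))))
      (sampleExp (w := fun j : κ₂ => j.1.2) Reads.last.ext hlam)
    (letE (m := G.eltLen lam) (by simp)
      (gpow (w := w') Reads.last.ext.ext hlam (r := fun j : κ₃ => j.1.2) Reads.extLast.ext)
    (letE (m := G.eltLen lam) (by simp)
      (gpow (w := w') Reads.last.ext.ext.snoc hlam (r := fun j : κ₃ => j.2) Reads.extLast.snoc)
    (serverView (w := w') hlam Reads.last.ext.ext.snoc.snoc hidx.ext.snoc.ext.ext.snoc.snoc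
      (fun j => hn j.1.1.1)
      (β := fun j i => (G.inst lam (w' j)).gpow (bif i then j.2 else j.1.2))
      Reads.last.snoc Reads.last
      ((seq (P := List.replicate k ((fun j : κ₃ => DQMR.idealSlot (G.inst lam (w' j)) sig :
          κ₃ → PMF (List Bool)), G.eltLen lam + sig))
        (k := 80 * G.unitSize lam ^ 2 + 30 * sig) ?_ ?_).congr
        fun j => by rw [List.map_replicate]))))))).mono ?_).congr fun i => ?_
  · intro p hp j y hy
    rw [List.eq_of_mem_replicate hp] at hy ⊢
    exact length_idealSlot _ hy
  · intro p hp
    rw [List.eq_of_mem_replicate hp]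
    exact idealSlot sig (w := w') hlam Reads.last.ext.ext.snoc.snoc
  · have h1 := G.lam_lt lam
    simp only [List.length_replicate]
    nlinarith
  · simp only [DQMR.mixedLaw, List.map_nil, List.append_nil]

theorem idealRecvLaw {H : ι → Hash sig} (hO : ∀ i, Γ.O i = (H i).oracle) (hℓ : Γ.ansLen = sig)
    (hlam : 0 < lam) {sel : ι → Bool} (hsel : Reads Γ fun i => [sel i])
    {m : ι → Str sig} (hm : Reads Γ fun i => List.ofFn (m i)) :
    Impl Γ (fun i => idealRecvLaw G lam (H i) (sel i) (m i))
      (400 * G.unitSize lam ^ 2 + 70 * sig) := by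
  let κ₁ := Σ _ : ι, Str (G.coinLen lam)
  let κ₂ := Σ j : κ₁, ZMod (G.inst lam j.2).p
  let κ₃ := Σ j : κ₂, ZMod (G.inst lam j.1.2).p
  let κ₄ := Σ _ : κ₃, Str sig
  let w' : κ₄ → Str (G.coinLen lam) := fun j => j.1.1.1.2
  refine ((withGroup
    (bind (κ := fun j : κ₁ => ZMod (G.inst lam j.2).p) (m := lam + 1) (he := by simp)
      (sampleExp (w := fun j : κ₁ => j.2) Reads.last hlam)
    (bind (κ := fun j : κ₂ => ZMod (G.inst lam j.1.2).p) (m := lam + 1) (he := by simp)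
      (sampleExp (w := fun j : κ₂ => j.1.2) Reads.last.ext hlam)
    (bind (κ := fun _ : κ₃ => Str sig) (m := sig) (he := by simp)
      (G := fun j u => DQMR.recvLaw (G.inst lam j.1.1.2) lam (H j.1.1.1) (sel j.1.1.1) (m j.1.1.1)
        ((G.inst lam j.1.1.2).gpow j.1.2)
        ((G.inst lam j.1.1.2).bits ((G.inst lam j.1.1.2).gpow j.2) ++ List.ofFn u))
      (coins _ sig)
    (letE (m := G.eltLen lam) (by simp)
      (gpow (w := w') Reads.last.ext.ext.ext hlam (r := fun j : κ₄ => j.1.1.2)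
        Reads.extLast.ext.ext)
    (letE (m := G.eltLen lam) (by simp)
      (gpow (w := w') Reads.last.ext.ext.ext.snoc hlam (r := fun j : κ₄ => j.1.2)
        Reads.extLast.ext.snoc)
    (recvLaw (sig := sig) (w := w') (H := fun j : κ₄ => H j.1.1.1.1) (fun j => hO j.1.1.1.1) hℓ hlam
      Reads.last.ext.ext.ext.snoc.snoc
      (sel := fun j : κ₄ => sel j.1.1.1.1) hsel.ext.snoc.ext.ext.ext.snoc.snoc
      (m := fun j : κ₄ => m j.1.1.1.1) hm.ext.snoc.ext.ext.ext.snoc.snoc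
      (A := fun j : κ₄ => (G.inst lam (w' j)).gpow j.1.1.2) Reads.last.snoc
      (Reads.last.append Reads.extLast.snoc.snoc) (fun j => by simp)))))))).mono ?_).congr
      fun i => rfl
  have h1 := G.lam_lt lam
  nlinarith

end Impl

/-! ## Polynomial bounds -/

/-- The function `f` is bounded by a polynomial in `sz`. -/
def PolyGrowth {Λ : Type} (sz f : Λ → ℕ) : Prop := ∃ P : Polynomial ℕ, ∀ a, f a ≤ P.eval (sz a)

namespace PolyGrowth

variable {Λ : Type} {sz f g : Λ → ℕ}

theorem mono (hg : PolyGrowth sz g) (h : ∀ a, f a ≤ g a) : PolyGrowth sz f := by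
  obtain ⟨P, hP⟩ := hg
  exact ⟨P, fun a => (h a).trans (hP a)⟩

theorem const (sz : Λ → ℕ) (c : ℕ) : PolyGrowth sz fun _ => c := ⟨.C c, by simp⟩

theorem self (sz : Λ → ℕ) : PolyGrowth sz sz := ⟨.X, by simp⟩

theorem add (hf : PolyGrowth sz f) (hg : PolyGrowth sz g) : PolyGrowth sz fun a => f a + g a := by
  obtain ⟨P, hP⟩ := hf
  obtain ⟨Q, hQ⟩ := hg
  exact ⟨P + Q, fun a => by rw [Polynomial.eval_add]; exact add_le_add (hP a) (hQ a)⟩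

theorem mul (hf : PolyGrowth sz f) (hg : PolyGrowth sz g) : PolyGrowth sz fun a => f a * g a := by
  obtain ⟨P, hP⟩ := hf
  obtain ⟨Q, hQ⟩ := hg
  exact ⟨P * Q, fun a => by rw [Polynomial.eval_mul]; exact Nat.mul_le_mul (hP a) (hQ a)⟩

theorem pow (hf : PolyGrowth sz f) (k : ℕ) : PolyGrowth sz fun a => f a ^ k := by
  obtain ⟨P, hP⟩ := hf
  exact ⟨P ^ k, fun a => by rw [Polynomial.eval_pow]; exact Nat.pow_le_pow_left (hP a) k⟩

theorem eval (P : Polynomial ℕ) (hf : PolyGrowth sz f) : PolyGrowth sz fun a => P.eval (f a) := by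
  obtain ⟨Q, hQ⟩ := hf
  exact ⟨P.comp Q, fun a => by rw [Polynomial.eval_comp]; exact polynomial_eval_mono P (hQ a)⟩

theorem comp {F : ℕ → ℕ} (hF : PolyBounded F) (hf : PolyGrowth sz f) :
    PolyGrowth sz fun a => F (f a) := by
  obtain ⟨P, hP⟩ := hF
  exact (hf.eval P).mono fun a => hP _

theorem size {A : Algorithm} (hA : A.PolyTime) (hf : PolyGrowth sz f) (hg : PolyGrowth sz g) :
    PolyGrowth sz fun a => (A (f a) (g a)).size := by
  obtain ⟨P, hP⟩ := hA
  exact ((hf.add hg).eval P).mono fun a => hP _ _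

theorem lazySize (hf : PolyGrowth sz f) (hg : PolyGrowth sz g) :
    PolyGrowth sz fun a => lazySize (f a) (g a) :=
  (hg.mul ((((hg.mul ((((const sz 23).mul hg).add ((const sz 14).mul hf)).add (const sz 5))).add
    ((const sz 4).mul hf)).add ((const sz 2).mul hg)).add (const sz 10))).add hg

end PolyGrowth

theorem length_of_mem_support_eval {O : List Bool → List Bool} {c : Circuit} {x l : List Bool}
    (hl : l ∈ (c.eval O x).support) : l.length = c.outs.length := by
  simp only [Circuit.eval, PMF.support_map, Set.mem_image] at hl
  obtain ⟨w, -, rfl⟩ := hl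
  simp

/-- The generation algorithm has to write out the whole public string, and each output bit counts
towards its size. This bounds the lengths of descriptions and encodings, for which the scheme states
no bound of its own. -/
theorem GroupScheme.length_pub_le (G : GroupScheme) (lam : ℕ) :
    G.descLen lam + (lam + 1) + G.eltLen lam ≤ (G.gen lam (G.coinLen lam)).size := by
  have h := G.gen_run lam fun _ => false
  have hmem : (G.inst lam fun _ => false).pub lam ∈
      ((G.gen lam (G.coinLen lam)).eval noOracle (List.ofFn fun _ : Fin (G.coinLen lam) =>
        false)).support := by
    rw [Algorithm.run, List.length_ofFn] at h
    rw [h]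
    simp
  rw [← GroupDesc.length_pub (G.inst lam fun _ => false), length_of_mem_support_eval hmem]
  simp [Circuit.size]

theorem GroupScheme.unitSize_poly (G : GroupScheme) : PolyBounded G.unitSize := by
  have hid := PolyGrowth.self (Λ := ℕ) id
  have hc : PolyGrowth id G.coinLen := G.coinLen_poly
  have hg := PolyGrowth.size G.gen_poly hid hc
  have hd : PolyGrowth id G.descLen :=
    hg.mono fun lam => le_trans (by omega) (G.length_pub_le lam)
  have he : PolyGrowth id G.eltLen :=
    hg.mono fun lam => le_trans (by omega) (G.length_pub_le lam)
  have hp := (hd.add (hid.add (.const _ 1))).add he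
  exact ((((((hg.add (PolyGrowth.size G.mul_poly hid ((hp.add he).add he))).add
    (PolyGrowth.size G.inv_poly hid (hp.add he))).add hc).add hd).add he).add hid).add (.const _ 1)

/-! ## Simulators as algorithms -/

/-- Inputs of length `n`, and oracle access to a hash function. -/
def inputEnv {κ : Type} (inp : κ → List Bool) (n sig : ℕ) :
    Env ({k : κ // (inp k).length = n} × Hash sig) where
  O i := i.2.oracle
  X i := inp i.1
  ansLen := sig
  len := n
  length_O i q := by simp [Hash.oracle]
  length_X i := i.1.2

/-- Non-uniformity permits an arbitrary choice of a circuit for each `lam` and each input length. At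
`lam = 0`, where the bounds on the group order are not available, an empty circuit is taken. -/
theorem exists_algorithm {sig : ℕ → ℕ} {κ : ℕ → Type} (inp : ∀ lam, κ lam → List Bool)
    (F : ∀ lam, κ lam → Hash (sig lam) → PMF (List Bool)) {S : ℕ × ℕ → ℕ}
    (hS : PolyGrowth (fun a => a.1 + a.2) S)
    (h : ∀ lam, 0 < lam → ∀ n, Impl (inputEnv (inp lam) n (sig lam))
      (fun i => F lam i.1 i.2) (S (lam, n))) :
    ∃ Sim : Algorithm, Sim.PolyTime ∧ ∀ lam, 0 < lam → ∀ k H,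
      Sim.run H.oracle lam (inp lam k) = F lam k H := by
  have hc : ∀ lam n, ∃ c : Circuit, c.size ≤ S (lam, n) ∧ (0 < lam →
      ∀ i : {k : κ lam // (inp lam k).length = n} × Hash (sig lam),
        c.eval i.2.oracle (inp lam i.1) = F lam i.1 i.2) := by
    intro lam n
    rcases Nat.eq_zero_or_pos lam with rfl | hlam
    · exact ⟨⟨[], []⟩, by simp [Circuit.size], fun h => absurd h (lt_irrefl 0)⟩
    · obtain ⟨c, hc, hF⟩ := h lam hlam n
      exact ⟨c, hc, fun _ => hF⟩
  choose c hc hF using hc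
  obtain ⟨P, hP⟩ := hS
  exact ⟨c, ⟨P, fun lam n => (hc lam n).trans (hP (lam, n))⟩,
    fun lam hlam k H => hF lam _ hlam (⟨k, rfl⟩, H)⟩

namespace DQMR

variable (G : GroupScheme) {sig : ℕ → ℕ}

theorem exists_senderSim (hpos : ∀ lam, 0 < sig lam) :
    ∃ Sim : Algorithm, Sim.PolyTime ∧ ∀ lam, 0 < lam → ∀ (x : Input (sig lam)) (H : Hash (sig lam)),
      Sim.run H.oracle lam x.msgBits = senderLaw G lam x.z x.msgBits := by
  have hK : PolyGrowth (fun a : ℕ × ℕ => a.1 + a.2) fun a => G.unitSize a.1 :=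
    PolyGrowth.comp G.unitSize_poly ((PolyGrowth.self _).mono fun a => Nat.le_add_right _ _)
  have hn : PolyGrowth (fun a : ℕ × ℕ => a.1 + a.2) fun a => a.2 :=
    (PolyGrowth.self _).mono fun a => Nat.le_add_left _ _
  obtain ⟨Sim, hSim, h⟩ := exists_algorithm (sig := sig) (κ := fun _ => List Bool)
    -- The number `z` is read off the length of the message string, which consists of `2 * sig lam`
    -- bits per pair. Here the positivity of `sig` is needed.
    (fun _ l => l) (fun lam l _ => senderLaw G lam (l.length / (2 * sig lam)) l)
    ((hn.add ((PolyGrowth.const _ 100).mul (hK.pow 2))).add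
      (hn.mul ((PolyGrowth.const _ 20).mul hK)))
    fun lam hlam n => ((Impl.senderLaw (G := G) hlam (Reads.self _) (n := n) (fun i => i.1.2)
      (n / (2 * sig lam))).mono (by gcongr; exact Nat.div_le_self _ _)).congr
        fun i => by rw [i.1.2]; rfl
  refine ⟨Sim, hSim, fun lam hlam x H => (h lam hlam x.msgBits H).trans ?_⟩
  have hlen : x.msgBits.length = x.z * (2 * sig lam) := by
    simp [Input.msgBits, List.length_flatten, List.map_ofFn, Function.comp_def, two_mul]
  simp only [hlen, Nat.mul_div_cancel _ (show 0 < 2 * sig lam by have := hpos lam; omega)]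

theorem exists_server1Sim (hsig : PolyBounded sig) :
    ∃ Sim : Algorithm, Sim.PolyTime ∧ ∀ lam, 0 < lam → ∀ (x : Input (sig lam)) (H : Hash (sig lam)),
      Sim.run H.oracle lam (indexBits x.v x.z) =
        mixedLaw G lam (indexBits x.v x.z) (x.z * 2) [] H := by
  have hlam : PolyGrowth (fun a : ℕ × ℕ => a.1 + a.2) fun a => a.1 :=
    (PolyGrowth.self _).mono fun a => Nat.le_add_right _ _
  have hK := PolyGrowth.comp G.unitSize_poly hlam
  have hs := PolyGrowth.comp hsig hlam
  have hn : PolyGrowth (fun a : ℕ × ℕ => a.1 + a.2) fun a => a.2 :=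
    (PolyGrowth.self _).mono fun a => Nat.le_add_left _ _
  obtain ⟨Sim, hSim, h⟩ := exists_algorithm (sig := sig) (κ := fun _ => List Bool)
    -- The length of the unit vector that encodes the index is `z`, and each pair contributes two
    -- ciphertexts.
    (fun _ l => l) (fun lam l H => mixedLaw G lam l (l.length * 2) [] H)
    ((hn.add ((PolyGrowth.const _ 300).mul (hK.pow 2))).add ((hn.mul (.const _ 2)).mul
      ((((PolyGrowth.const _ 80).mul (hK.pow 2)).add ((PolyGrowth.const _ 30).mul hs)).add
        (.const _ 1))))
    fun lam hlam n => (Impl.mixedLaw _ G (sig lam) hlam (Reads.self _) (n := n) (fun i => i.1.2)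
      (fun i => i.2) (n * 2)).congr fun i => by rw [i.1.2]; rfl
  refine ⟨Sim, hSim, fun lam hlam x H => (h lam hlam (indexBits x.v x.z) H).trans ?_⟩
  simp only [indexBits, List.length_ofFn]

theorem exists_server2Sim (sig : ℕ → ℕ) :
    ∃ Sim : Algorithm, Sim.PolyTime ∧ ∀ lam, 0 < lam → ∀ H : Hash (sig lam),
      Sim.run H.oracle lam [] = server2Law G lam := by
  have hK : PolyGrowth (fun a : ℕ × ℕ => a.1 + a.2) fun a => G.unitSize a.1 :=
    PolyGrowth.comp G.unitSize_poly ((PolyGrowth.self _).mono fun a => Nat.le_add_right _ _)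
  obtain ⟨Sim, hSim, h⟩ := exists_algorithm (sig := sig) (κ := fun _ => Unit)
    (fun _ _ => []) (fun lam _ _ => server2Law G lam) ((PolyGrowth.const _ 100).mul (hK.pow 2))
    fun lam hlam n => Impl.server2Law _ G hlam
  exact ⟨Sim, hSim, fun lam hlam H => h lam hlam () H⟩

theorem exists_recvSim (hsig : PolyBounded sig) :
    ∃ Sim : Algorithm, Sim.PolyTime ∧ ∀ lam, 0 < lam → ∀ (s : Bool) (m : Str (sig lam))
      (H : Hash (sig lam)), Sim.run H.oracle lam (s :: List.ofFn m) = idealRecvLaw G lam H s m := by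
  have hlam : PolyGrowth (fun a : ℕ × ℕ => a.1 + a.2) fun a => a.1 :=
    (PolyGrowth.self _).mono fun a => Nat.le_add_right _ _
  have hK := PolyGrowth.comp G.unitSize_poly hlam
  have hs := PolyGrowth.comp hsig hlam
  have himpl : ∀ lam, 0 < lam → ∀ n, Impl (inputEnv (fun k : Bool × Str (sig lam) =>
      k.1 :: List.ofFn k.2) n (sig lam)) (fun i => idealRecvLaw G lam i.2 i.1.1.1 i.1.1.2)
      (400 * G.unitSize lam ^ 2 + 70 * sig lam) := by
    intro lam hlam n
    have hself := Reads.self (inputEnv (fun k : Bool × Str (sig lam) => k.1 :: List.ofFn k.2) n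
      (sig lam))
    have hsel : Reads (inputEnv (fun k : Bool × Str (sig lam) => k.1 :: List.ofFn k.2) n
      (sig lam)) fun i => [i.1.1.1] := hself.take 1
    have hm : Reads (inputEnv (fun k : Bool × Str (sig lam) => k.1 :: List.ofFn k.2) n
      (sig lam)) fun i => List.ofFn i.1.1.2 := hself.drop 1
    exact Impl.idealRecvLaw (fun i => rfl) rfl hlam hsel hm
  obtain ⟨Sim, hSim, h⟩ := exists_algorithm (sig := sig) (κ := fun lam => Bool × Str (sig lam))
    (S := fun a => 400 * G.unitSize a.1 ^ 2 + 70 * sig a.1)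
    (fun _ k => k.1 :: List.ofFn k.2) (fun lam k H => idealRecvLaw G lam H k.1 k.2)
    (((PolyGrowth.const _ 400).mul (hK.pow 2)).add ((PolyGrowth.const _ 70).mul hs)) himpl
  exact ⟨Sim, hSim, fun lam hlam s m H => h lam hlam (s, m) H⟩

end DQMR

/-! ## Computational indistinguishability -/

namespace CompIndist

variable {sig : ℕ → ℕ} {ι : ℕ → Type} {size : ∀ lam, ι lam → ℕ}
  {X Y W : ∀ lam, ι lam → Hash (sig lam) → PMF (List Bool)}

theorem symm (h : CompIndist sig size X Y) : CompIndist sig size Y X := by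
  intro D hD Z
  obtain ⟨μ, hμ, h⟩ := h D hD Z
  exact ⟨μ, hμ, fun lam i hi => by rw [abs_sub_comm]; exact h lam i hi⟩

theorem trans (h : CompIndist sig size X Y) (h' : CompIndist sig size Y W) :
    CompIndist sig size X W := by
  intro D hD Z
  obtain ⟨μ, hμ, h⟩ := h D hD Z
  obtain ⟨ν, hν, h'⟩ := h' D hD Z
  exact ⟨fun lam => μ lam + ν lam, hμ.add hν, fun lam i hi =>
    (abs_sub_le _ _ _).trans (add_le_add (h lam i hi) (h' lam i hi))⟩

theorem comap (h : CompIndist sig size X Y) {κ : ℕ → Type} {size' : ∀ lam, κ lam → ℕ}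
    (φ : ∀ lam, κ lam → ι lam) (hφ : ∀ lam k, size lam (φ lam k) ≤ size' lam k) :
    CompIndist sig size' (fun lam k => X lam (φ lam k)) (fun lam k => Y lam (φ lam k)) := by
  intro D hD Z
  obtain ⟨μ, hμ, h⟩ := h D hD Z
  exact ⟨μ, hμ, fun lam k hk => h lam _ ((hφ lam k).trans hk)⟩

end CompIndist

/-! ### From CDH bounds to negligible advantages -/

theorem Close.abs_toReal_sub_le {δ a b : ℝ≥0∞} (h : Close δ a b) (ha : a ≤ 1) (hb : b ≤ 1)
    (hδ : δ ≠ ⊤) : |a.toReal - b.toReal| ≤ δ.toReal := by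
  have ha' : a ≠ ⊤ := ne_top_of_le_ne_top ENNReal.one_ne_top ha
  have hb' : b ≠ ⊤ := ne_top_of_le_ne_top ENNReal.one_ne_top hb
  have h1 := ENNReal.toReal_mono (ENNReal.add_ne_top.2 ⟨hb', hδ⟩) h.1
  have h2 := ENNReal.toReal_mono (ENNReal.add_ne_top.2 ⟨ha', hδ⟩) h.2
  rw [ENNReal.toReal_add hb' hδ] at h1
  rw [ENNReal.toReal_add ha' hδ] at h2
  rw [abs_le]
  constructor <;> linarith

theorem lintegral_pmf_le_one {sig : ℕ} (X : Hash sig → PMF (List Bool)) (v : List Bool) :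
    ∫⁻ H, X H v ∂(randomOracle sig) ≤ 1 := by
  calc ∫⁻ H, X H v ∂(randomOracle sig) ≤ ∫⁻ _, 1 ∂(randomOracle sig) :=
        lintegral_mono fun H => PMF.coe_le_one _ _
    _ = 1 := by simp

/-- Indistinguishability follows from a bound on the advantage by a polynomial multiple of the
probability to solve the CDH problem with polynomial-size circuits. -/
theorem CompIndist.of_close {G : GroupScheme} (hG : G.CDHHard) {sig : ℕ → ℕ} {ι : ℕ → Type}
    {size : ∀ lam, ι lam → ℕ} {X Y : ∀ lam, ι lam → Hash (sig lam) → PMF (List Bool)}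
    (h : ∀ D : Algorithm, D.PolyTime → ∀ Z : Polynomial ℕ, ∃ T B : ℕ → ℕ, PolyBounded T ∧
      PolyBounded B ∧ ∀ lam, 0 < lam → ∀ ε : ℝ≥0∞,
        (∀ c : Circuit, c.size ≤ B lam → G.cdhSucc c lam ≤ ε) → ∀ i : ι lam,
        size lam i ≤ Z.eval lam → Close (T lam * ε)
          (∫⁻ H, ((X lam i H).bind fun w => D.run H.oracle lam w) [true] ∂(randomOracle (sig lam)))
          (∫⁻ H, ((Y lam i H).bind fun w => D.run H.oracle lam w) [true]
            ∂(randomOracle (sig lam)))) : CompIndist sig size X Y := by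
  intro D hD Z
  obtain ⟨T, B, ⟨P, hP⟩, hB, h⟩ := h D hD Z
  obtain ⟨μ, hμ, hμ0, hbound⟩ := hG.exists_bound hB
  -- Nothing is claimed about the views at `lam = 0`; the value 1 bounds any advantage there and
  -- does not affect negligibility.
  refine ⟨fun lam => if lam = 0 then 1 else (P.map (Nat.castRingHom ℝ)).eval (lam : ℝ) * μ lam,
    (hμ.polynomial_mul (P.map (Nat.castRingHom ℝ))).congr' ?_, fun lam i hi => ?_⟩
  · filter_upwards [Filter.eventually_gt_atTop 0] with lam hlam
    rw [if_neg hlam.ne']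
  · have ha := lintegral_pmf_le_one (fun H => (X lam i H).bind fun w => D.run H.oracle lam w) [true]
    have hb := lintegral_pmf_le_one (fun H => (Y lam i H).bind fun w => D.run H.oracle lam w) [true]
    rcases Nat.eq_zero_or_pos lam with rfl | hlam
    · exact (Close.of_le_one (δ := 1) ha hb le_rfl).abs_toReal_sub_le ha hb ENNReal.one_ne_top
    · beta_reduce
      rw [if_neg hlam.ne']
      have hc := (h lam hlam _ (hbound lam) i hi).abs_toReal_sub_le ha hb
        (ENNReal.mul_ne_top (ENNReal.natCast_ne_top _) ENNReal.ofReal_ne_top)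
      refine hc.trans ?_
      rw [ENNReal.toReal_mul, ENNReal.toReal_natCast, ENNReal.toReal_ofReal (hμ0 lam),
        Polynomial.eval_natCast_map, eq_natCast]
      gcongr
      · exact hμ0 lam
      · exact_mod_cast hP lam

theorem CompIndist.of_eq {G : GroupScheme} (hG : G.CDHHard) {sig : ℕ → ℕ} {ι : ℕ → Type}
    {size : ∀ lam, ι lam → ℕ} {X Y : ∀ lam, ι lam → Hash (sig lam) → PMF (List Bool)}
    (h : ∀ lam, 0 < lam → ∀ i H, X lam i H = Y lam i H) : CompIndist sig size X Y :=
  .of_close hG fun D _ Z => ⟨fun _ => 0, fun _ => 0, ⟨0, by simp⟩, ⟨0, by simp⟩,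
    fun lam hlam ε _ i _ => by
      simp only [h lam hlam, Nat.cast_zero, zero_mul]
      exact Close.refl _⟩

/-! ### Security of the protocol -/

namespace DQMR

variable {G : GroupScheme} {sig : ℕ → ℕ}

theorem correct (sig : ℕ → ℕ) (lam : ℕ) (x : Input (sig lam)) (H : Hash (sig lam)) :
    ∀ E ∈ (protocol G sig lam x H).support, E.output = some x.functionality := by
  intro E hE
  rw [protocol_eq] at hE
  simp only [PMF.mem_support_bind_iff, PMF.support_map, Set.mem_image] at hE
  obtain ⟨w, -, C, -, b, -, r₁, -, r₂, -, y, -, rfl⟩ := hE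
  exact execution_output G lam x H w C b r₁ r₂ y

theorem indist_recv (hsig : PolyBounded sig) (hG : G.CDHHard) :
    CompIndist sig (ι := fun lam => Input (sig lam)) (fun _ x => x.z)
      (fun lam x H => idealRecvLaw G lam H x.s (x.m x.v x.s))
      (fun lam x H => (protocol G sig lam x H).map Execution.viewR) := by
  refine .of_close hG fun D hD Z => ?_
  have hid := PolyGrowth.self (Λ := ℕ) id
  have hK : PolyGrowth id G.unitSize := G.unitSize_poly
  have hs : PolyGrowth id sig := hsig
  have hd : PolyGrowth id G.descLen := hK.mono fun lam => by
    simp only [GroupScheme.unitSize]; omega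
  have he : PolyGrowth id G.eltLen := hK.mono G.eltLen_le
  have h1 := PolyGrowth.const (id : ℕ → ℕ) 1
  have hlen : PolyGrowth id fun lam => recvLen G lam (sig lam) :=
    ((h1.add ((h1.add (hid.add h1)).add (hid.add h1))).add (((hd.add (hid.add h1)).add he).add
      he)).add ((PolyGrowth.const _ 2).mul (he.add hs))
  have hS := (((PolyGrowth.const id 400).mul (hK.pow 2)).add ((PolyGrowth.const _ 100).mul hs)).add
    (PolyGrowth.size hD hid hlen)
  have hB := (((PolyGrowth.const _ 3).mul hs).add (PolyGrowth.lazySize hs hS)).add h1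
  refine ⟨_, _, hS, hB, fun lam hlam ε hε x hx => ?_⟩
  simp only [viewR_law]
  exact (close_recv D hlam x le_rfl le_rfl hε [true]).symm

theorem serverSize_mono (lam : ℕ) {sig k k' n n' : ℕ} (hk : k ≤ k') (hn : n ≤ n') :
    serverSize G lam sig k n ≤ serverSize G lam sig k' n' := by
  unfold serverSize
  gcongr

theorem serverLen_mono (lam : ℕ) {sig k k' n n' : ℕ} (hk : k ≤ k') (hn : n ≤ n') :
    serverLen G lam sig k n ≤ serverLen G lam sig k' n' := by
  unfold serverLen
  gcongr

/-- There are `2 * z` hybrids and `z ≤ Z.eval lam`. Evaluating all size bounds at `Z.eval lam` makes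
them functions of `lam` alone, as uniformity over the inputs demands. -/
theorem indist_server1 (hsig : PolyBounded sig) (hG : G.CDHHard) :
    CompIndist sig (ι := fun lam => Input (sig lam)) (fun _ x => x.z)
      (fun lam x H => mixedLaw G lam (indexBits x.v x.z) (x.z * 2) [] H)
      (fun lam x H => (protocol G sig lam x H).map Execution.viewP1) := by
  refine .of_close hG fun D hD Z => ?_
  obtain ⟨P, hP⟩ := hD
  have hid := PolyGrowth.self (Λ := ℕ) id
  have hK : PolyGrowth id G.unitSize := G.unitSize_poly
  have hs : PolyGrowth id sig := hsig
  have hd : PolyGrowth id G.descLen := hK.mono fun lam => by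
    simp only [GroupScheme.unitSize]; omega
  have he : PolyGrowth id G.eltLen := hK.mono G.eltLen_le
  have h1 := PolyGrowth.const (id : ℕ → ℕ) 1
  have hz : PolyGrowth id fun lam => Z.eval lam := PolyGrowth.eval Z hid
  have hz2 := hz.mul (PolyGrowth.const _ 2)
  have hlen : PolyGrowth id fun lam => serverLen G lam (sig lam) (Z.eval lam) (Z.eval lam * 2) :=
    (((hz.add (((hd.add (hid.add h1)).add he).add he)).add (h1.add (hid.add h1))).add
      (he.add he)).add (hz2.mul (he.add hs))
  have hsize : PolyGrowth id fun lam => serverSize G lam (sig lam) (Z.eval lam) (Z.eval lam * 2) :=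
    (((hz2.mul ((((PolyGrowth.const _ 80).mul (hK.pow 2)).add ((PolyGrowth.const _ 30).mul hs)).add
      h1)).add ((PolyGrowth.const _ 300).mul (hK.pow 2))).add ((PolyGrowth.const _ 60).mul hs)).add
      ((PolyGrowth.const _ 5).mul hz)
  have hS := hsize.add (PolyGrowth.eval P (hid.add hlen))
  have hB := (((PolyGrowth.const _ 3).mul hs).add (PolyGrowth.lazySize hs hS)).add h1
  refine ⟨_, _, hz2.mul hS, hB, fun lam hlam ε hε x hx => ?_⟩
  have hidx : (indexBits x.v x.z).length = x.z := by simp [indexBits]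
  -- The circuit bound is the one belonging to the largest admissible `z`; monotonicity of length
  -- and size covers the actual one.
  have h := close_mixed D hlam (indexBits x.v x.z) 0 x.slots (S := _) (le_trans ?_ le_rfl)
    le_rfl hε [true]
  · simp only [viewP1_eq_mixedLaw]
    rw [zero_add, x.length_slots] at h
    refine (h.mono ?_).symm
    rw [← mul_assoc]
    push_cast
    gcongr
  · rw [hidx, zero_add, x.length_slots]
    refine add_le_add (serverSize_mono lam hx (by omega)) ((hP _ _).trans ?_)
    exact polynomial_eval_mono P (add_le_add le_rfl (serverLen_mono lam hx (by omega)))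

theorem securelyComputes (hsig : PolyBounded sig) (hpos : ∀ lam, 0 < sig lam) (hG : G.CDHHard) :
    SecurelyComputes sig (protocol G sig) where
  correct := correct sig
  simS := by
    obtain ⟨Sim, hSim, h⟩ := exists_senderSim G hpos
    exact ⟨Sim, hSim, .of_eq hG fun lam hlam x H => by rw [h lam hlam, viewS_law]⟩
  simP1 := by
    obtain ⟨Sim, hSim, h⟩ := exists_server1Sim G hsig
    exact ⟨Sim, hSim, .trans (.of_eq hG fun lam hlam x H => h lam hlam x H)
      (indist_server1 hsig hG)⟩
  simP2 := by
    obtain ⟨Sim, hSim, h⟩ := exists_server2Sim G sig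
    exact ⟨Sim, hSim, .of_eq hG fun lam hlam x H => by rw [h lam hlam, viewP2_law]⟩
  simR := by
    obtain ⟨Sim, hSim, h⟩ := exists_recvSim G hsig
    exact ⟨Sim, hSim, .trans (.of_eq hG fun lam hlam x H => h lam hlam x.s _ H)
      (indist_recv hsig hG)⟩

/-- Both views are indistinguishable from the same simulated law, which depends on `s` and the
requested message only. -/
theorem hidesCountFromReceiver (hsig : PolyBounded sig) (hG : G.CDHHard) :
    HidesCountFromReceiver sig (protocol G sig) := by
  have h := indist_recv hsig hG
  let κ : ℕ → Type := fun lam => {q : Input (sig lam) × Input (sig lam) //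
    q.1.s = q.2.s ∧ q.1.m q.1.v q.1.s = q.2.m q.2.v q.2.s}
  refine .trans (h.comap (κ := κ) (fun _ q => q.1.1) fun _ q => le_max_left _ _).symm ?_
  refine .trans (.of_eq hG fun lam _ q H => ?_)
    (h.comap (κ := κ) (fun _ q => q.1.2) fun _ q => le_max_right _ _)
  -- The two simulated laws coincide because the bits and the requested messages do.
  rw [q.2.1, ← q.2.2, q.2.1]

/-- The law of the sender's view is a function of `z` and the messages, so the two views even have
the same law. -/
theorem hidesIndexFromSender (hG : G.CDHHard) :
    HidesIndexFromSender sig (protocol G sig) :=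
  .of_eq hG fun lam _ q H => by
    rw [viewS_law, viewS_law]
    rfl

end DQMR

end

theorem theorem5 (G : GroupScheme) (sig : ℕ → ℕ) (hsig : PolyBounded sig)
    (hpos : ∀ lam, 0 < sig lam) (hDL : G.DLHard) (hCDH : G.CDHHard) :
    SecurelyComputes sig (DQMR.protocol G sig) ∧
      HidesCountFromReceiver sig (DQMR.protocol G sig) ∧
      HidesIndexFromSender sig (DQMR.protocol G sig) :=
  ⟨DQMR.securelyComputes hsig hpos hCDH, DQMR.hidesCountFromReceiver hsig hCDH,
    DQMR.hidesIndexFromSender hCDH⟩
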